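/- Let $d\ge 1$, $\beta_0\in(0,1)$, $t\ge 0$, $x\in\mathbb R^d$. **Noise.** Let $\gamma:\mathbb R^d\to[0,\infty]$ be symmetric, continuous and locally integrable, and a tempered distribution whose Fourier transform $\widehat\gamma$ (convention $\widehat\varphi(\xi)=\int e^{-i\xi\cdot y}\varphi(y)\,dy$) is a tempered measurable function that is nonnegative almost everywhere. That is, with the spectral measure $\mu(d\xi)=\widehat\gamma(\xi)\,d\xi$, $\int\gamma\varphi\,dy=(2\pi)^{-d}\int\widehat\varphi\,d\mu$ for every Schwartz function $\varphi$. Assume that either $\gamma(y)<\infty$ holds exactly for $y\ne0$, or $\widehat\gamma\in L^\infty$ and $\gamma(y)<\infty$ for all $y\neq 0$. Let $\mathcal H$ be the completion of $C_0^\infty(\mathbb R_+\times\mathbb R^d)$ for the inner product $$\langle\varphi,\psi\rangle_{\mathcal H}=\int_{\mathbb R_+^2}\int_{\mathbb R^{2d}}\varphi(s,y)\psi(r,z)|r-s|^{-\beta_0}\gamma(y-z)\,dy\,dz\,ds\,dr .$$ A measurable function $\varphi$ for which this integral with $|\varphi|$ in place of both $\varphi$ and $\psi$ is finite is identified with the element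 of $\mathcal H$ whose inner product with each test function $\psi$ is given by the same formula. Let $W=\{W(h):h\in\mathcal H\}$ be an isonormal Gaussian process (a centered Gaussian family with $\mathbb E[W(h)W(g)]=\langle h,g\rangle_{\mathcal H}$) on a probability space $(\Omega,\mathcal F,P)$. **Lévy process.** On the same space let $X=(X_s)_{s\ge0}$ be a symmetric Lévy process in $\mathbb R^d$ with $X_0=0$ (with almost surely càdlàg paths), independent of $W$, such that $X_s$ has a density with respect to Lebesgue measure for every $s>0$. Let $\Psi$ be its characteristic exponent, $\mathbb E\,e^{i\xi\cdot X_s}=e^{-s\Psi(\xi)}$, and write $X_s^x=X_s+x$. Assume $$\int_{\mathbb R^d}\frac{1}{1+\Psi(\xi)^{1-\beta_0}}\,\mu(d\xi)<\infty .$$ **Mollification.** Let $p\in C_0^\infty(\mathbb R^d)$ be a symmetric probability density with $\widehat p\ge0$. For $\varepsilon,\delta>0$ let $p_\varepsilon(y)=\varepsilon^{-d}p(y/\varepsilon)$, $g_\delta=\delta^{-1}\mathbf 1_{[0,\delta]}$, and $$\Phi^{\varepsilon,\delta}_{t,x}(r,y)=\mathbf 1_{[0,t]}(r)\int_0^t g_\delta(t-s-r)\,p_\varepsilon(X_s^x-y)\,ds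 .$$ For a random element $\Phi$ of $\mathcal H$ depending on $X$, $W(\Phi)$ denotes the limit in probability of $W(S_n)$, where the $S_n$ are $\sigma(X)$-measurable simple $\mathcal H$-valued random variables converging to $\Phi$ almost surely, and $W(\sum_i\mathbf 1_{A_i}h_i)=\sum_i\mathbf 1_{A_i}W(h_i)$ for disjoint $A_i$. **Theorem.** 1. For all $\varepsilon,\delta>0$, almost surely $\Phi^{\varepsilon,\delta}_{t,x}\in\mathcal H$. The random variable $W(\Phi^{\varepsilon,\delta}_{t,x})$ exists, is unique up to almost sure equality, and lies in $L^2(\Omega)$. 2. $\bigl(W(\Phi^{\varepsilon,\delta}_{t,x})\bigr)$ is Cauchy in $L^2(\Omega)$ as $(\varepsilon,\delta)\to(0,0)$ with $\varepsilon,\delta>0$, and hence converges in $L^2(\Omega)$ to a limit, denoted $\int_0^t\int_{\mathbb R^d}\delta_0(X^x_{t-r}-y)\,W(dr,dy)$. 3. Almost surely $V:=\int_0^t\int_0^t|r-s|^{-\beta_0}\gamma(X_r-X_s)\,ds\,dr<\infty$, and, conditionally on $X$, the limit is Gaussian with mean $0$ and variance $V$. -/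

import Mathlib

open MeasureTheory ProbabilityTheory Filter Topology Set
open scoped ENNReal NNReal SchwartzMap

noncomputable section

namespace FeynmanKac

/-- The spatial domain `ℝ^d` with its Euclidean norm. -/
abbrev Space (d : ℕ) : Type := EuclideanSpace ℝ (Fin d)

/-! ### The covariance of the noise -/

/-- Fourier transform with the convention `f̂(ξ) = ∫ e^{-i ξ·x} f(x) dx`. -/
def fourierHat {d : ℕ} (f : Space d → ℂ) (ξ : Space d) : ℂ :=
  ∫ x, Complex.exp (-(Complex.I * ((inner ℝ ξ x : ℝ) : ℂ))) * f x

/-- The spectral measure `μ(dξ) = γ̂(ξ) dξ`, for a given density `γ̂`. -/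
def spectralMeasure {d : ℕ} (γhat : Space d → ℝ) : Measure (Space d) :=
  volume.withDensity fun ξ => ENNReal.ofReal (γhat ξ)

/-- The standing assumptions on the spatial covariance `γ : ℝ^d → [0, ∞]`: it is symmetric,
continuous and locally integrable, it is a tempered distribution, and its distributional Fourier
transform is the measurable, almost everywhere nonnegative function `γ̂` (in particular `γ` is
nonnegative definite). -/
structure IsSpatialCovariance {d : ℕ} (γ : Space d → ℝ≥0∞) (γhat : Space d → ℝ) : Prop where
  symm : ∀ x, γ (-x) = γ x
  continuous : Continuous γ
  locallyIntegrable : ∀ K : Set (Space d), IsCompact K → ∫⁻ x in K, γ x < ∞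
  measurable_hat : Measurable γhat
  hat_nonneg : ∀ᵐ ξ, 0 ≤ γhat ξ
  /-- `γ` acts on Schwartz functions by absolutely convergent integrals -/
  tempered : (volume.withDensity γ).HasTemperateGrowth
  /-- so does `γ̂` -/
  tempered_hat : (spectralMeasure γhat).HasTemperateGrowth
  /-- `γ̂` is the Fourier transform of `γ` -/
  spectral : ∀ φ : 𝓢(Space d, ℂ),
    ∫ x, ((γ x).toReal : ℂ) * φ x
      = (((2 * Real.pi) ^ d)⁻¹ : ℝ) * ∫ ξ, fourierHat φ ξ ∂(spectralMeasure γhat)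
  /-- either `γ` is infinite exactly at the origin, or it is finite off the origin and `γ̂` is
  essentially bounded -/
  finite_iff : (∀ x, γ x < ∞ ↔ x ≠ 0) ∨
    ((∃ C : ℝ, ∀ᵐ ξ, γhat ξ ≤ C) ∧ ∀ x, x ≠ 0 → γ x < ∞)

/-- Lebesgue measure on `ℝ₊ × ℝ^d`, regarded as a measure on `ℝ × ℝ^d`. -/
def halfVolume (d : ℕ) : Measure (ℝ × Space d) :=
  (volume.restrict (Ici (0 : ℝ))).prod volume

/-- The covariance kernel `|t - s|^{-β₀} γ(x - y)` of the noise. -/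
def covKernel {d : ℕ} (β₀ : ℝ) (γ : Space d → ℝ≥0∞) (z w : ℝ × Space d) : ℝ≥0∞ :=
  ENNReal.ofReal (|z.1 - w.1| ^ (-β₀)) * γ (z.2 - w.2)

/-- The bilinear form
`⟨φ, ψ⟩ = ∫_{ℝ₊²} ∫_{ℝ^{2d}} φ(s,x) ψ(t,y) |t - s|^{-β₀} γ(x - y) dx dy ds dt`. -/
def covForm {d : ℕ} (β₀ : ℝ) (γ : Space d → ℝ≥0∞) (φ ψ : ℝ × Space d → ℝ) : ℝ :=
  ∫ p, φ p.1 * ψ p.2 * (covKernel β₀ γ p.1 p.2).toReal ∂((halfVolume d).prod (halfVolume d))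

/-- The absolute energy
`∫_{ℝ₊²} ∫_{ℝ^{2d}} |φ(s,x)| |φ(t,y)| |t - s|^{-β₀} γ(x - y) dx dy ds dt`. -/
def absEnergy {d : ℕ} (β₀ : ℝ) (γ : Space d → ℝ≥0∞) (φ : ℝ × Space d → ℝ) : ℝ≥0∞ :=
  ∫⁻ p, ‖φ p.1‖ₑ * ‖φ p.2‖ₑ * covKernel β₀ γ p.1 p.2 ∂((halfVolume d).prod (halfVolume d))

/-! ### The Hilbert space of the noise -/

/-- Smooth compactly supported functions. Only their restrictions to `ℝ₊ × ℝ^d` enter `covForm`,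
and these restrictions are the smooth compactly supported functions on `ℝ₊ × ℝ^d`. -/
def testSubmodule (d : ℕ) : Submodule ℝ (ℝ × Space d → ℝ) where
  carrier := {φ | ContDiff ℝ (⊤ : ℕ∞) φ ∧ HasCompactSupport φ}
  add_mem' := fun ha hb => ⟨ha.1.add hb.1, ha.2.add hb.2⟩
  zero_mem' := ⟨contDiff_const, HasCompactSupport.zero⟩
  smul_mem' := fun c _ ha => ⟨contDiff_const.smul ha.1, ha.2.smul_left (f := fun _ => c)⟩

/-- The space of test functions, tagged with the data that determine its inner product. -/
def TestSpace {d : ℕ} (_β₀ : ℝ) (_γ : Space d → ℝ≥0∞) : Type := testSubmodule d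

instance {d : ℕ} (β₀ : ℝ) (γ : Space d → ℝ≥0∞) : AddCommGroup (TestSpace β₀ γ) :=
  inferInstanceAs (AddCommGroup (testSubmodule d))

instance {d : ℕ} (β₀ : ℝ) (γ : Space d → ℝ≥0∞) : Module ℝ (TestSpace β₀ γ) :=
  inferInstanceAs (Module ℝ (testSubmodule d))

/-- The function underlying a test function. -/
def TestSpace.toFun {d : ℕ} {β₀ : ℝ} {γ : Space d → ℝ≥0∞} (φ : TestSpace β₀ γ) :
    ℝ × Space d → ℝ :=
  Subtype.val (p := fun f => f ∈ testSubmodule d) φ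

/-- The zero form. -/
@[reducible]
def zeroCore {d : ℕ} (β₀ : ℝ) (γ : Space d → ℝ≥0∞) :
    PreInnerProductSpace.Core ℝ (TestSpace β₀ γ) where
  inner := fun _ _ => 0
  conj_inner_symm := fun _ _ => by simp
  re_inner_nonneg := fun _ => by simp
  add_left := fun _ _ _ => by simp
  smul_left := fun _ _ _ => by simp

open Classical in
/-- The (semi-definite) inner product `covForm β₀ γ` on test functions. The zero form is only a
default value, for data `β₀`, `γ` for which `covForm β₀ γ` is not a symmetric positive
semi-definite bilinear form on the test functions. -/
@[reducible]
def testCore {d : ℕ} (β₀ : ℝ) (γ : Space d → ℝ≥0∞) :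
    PreInnerProductSpace.Core ℝ (TestSpace β₀ γ) :=
  if h : ∃ c : PreInnerProductSpace.Core ℝ (TestSpace β₀ γ),
      ∀ φ ψ : TestSpace β₀ γ, c.inner φ ψ = covForm β₀ γ φ.toFun ψ.toFun
  then h.choose else zeroCore β₀ γ

instance {d : ℕ} (β₀ : ℝ) (γ : Space d → ℝ≥0∞) : SeminormedAddCommGroup (TestSpace β₀ γ) :=
  @InnerProductSpace.Core.toSeminormedAddCommGroup ℝ (TestSpace β₀ γ) _ _ _ (testCore β₀ γ)

instance {d : ℕ} (β₀ : ℝ) (γ : Space d → ℝ≥0∞) : InnerProductSpace ℝ (TestSpace β₀ γ) :=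
  InnerProductSpace.ofCore (testCore β₀ γ)

/-- The Hilbert space `𝓗`: the completion of the test functions for the inner product
`covForm β₀ γ` (test functions of norm zero are identified with `0`). -/
abbrev NoiseSpace {d : ℕ} (β₀ : ℝ) (γ : Space d → ℝ≥0∞) : Type :=
  UniformSpace.Completion (TestSpace β₀ γ)

/-- `h ∈ 𝓗` is the class of the measurable function `φ` of finite absolute energy: its inner
product with each test function `ψ` is `∫∫∫∫ φ(s,x) ψ(t,y) |t - s|^{-β₀} γ(x - y)`. As test
functions are dense in `𝓗`, there is at most one such `h`. -/
structure Represents {d : ℕ} (β₀ : ℝ) (γ : Space d → ℝ≥0∞) (φ : ℝ × Space d → ℝ)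
    (h : NoiseSpace β₀ γ) : Prop where
  measurable : Measurable φ
  energy : absEnergy β₀ γ φ < ∞
  inner_eq : ∀ ψ : TestSpace β₀ γ,
    inner ℝ h (ψ : NoiseSpace β₀ γ) = covForm β₀ γ φ ψ.toFun

/-- The function `φ` belongs to `𝓗`. -/
def InNoiseSpace {d : ℕ} (β₀ : ℝ) (γ : Space d → ℝ≥0∞) (φ : ℝ × Space d → ℝ) : Prop :=
  ∃ h : NoiseSpace β₀ γ, Represents β₀ γ φ h

open Classical in
/-- The element of `𝓗` given by a function `φ` (and `0` if `φ` does not belong to `𝓗`). -/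
def toNoiseSpace {d : ℕ} (β₀ : ℝ) (γ : Space d → ℝ≥0∞) (φ : ℝ × Space d → ℝ) :
    NoiseSpace β₀ γ :=
  if h : InNoiseSpace β₀ γ φ then h.choose else 0

/-! ### Isonormal Gaussian process, and its evaluation at random elements -/

/-- `W = {W(h), h ∈ H}` is an isonormal Gaussian process over the inner product space `H`. -/
structure IsIsonormal {Ω H : Type*} [MeasurableSpace Ω] [NormedAddCommGroup H]
    [InnerProductSpace ℝ H] (W : H → Ω → ℝ) (P : Measure Ω) : Prop where
  measurable : ∀ h, Measurable (W h)
  gaussian : IsGaussianProcess W P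
  mean : ∀ h, ∫ ω, W h ω ∂P = 0
  cov : ∀ h g, ∫ ω, W h ω * W g ω ∂P = inner ℝ h g

/-- `Z` is the integral `W(Φ)` of the random element `Φ : Ω → H` with respect to `W`; here `m` is a
σ-algebra independent of `W` with respect to which `Φ` is measurable. For an `m`-measurable simple
`S = ∑ 1_{A_i} h_i` (the `A_i` a partition of `Ω`), `W(S) = ∑ 1_{A_i} W(h_i)`, that is
`W(S)(ω) = W(S(ω))(ω)`; in general `W(Φ)` is the limit in probability of `W(S_n)` for
`m`-measurable simple `S_n` that converge to `Φ` almost surely. -/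
def IsRandomIntegral {Ω H : Type*} (m : MeasurableSpace Ω) [MeasurableSpace Ω]
    [NormedAddCommGroup H] [InnerProductSpace ℝ H] (W : H → Ω → ℝ) (P : Measure Ω)
    (Φ : Ω → H) (Z : Ω → ℝ) : Prop :=
  ∃ S : ℕ → Ω → H,
    (∀ n, (range (S n)).Finite ∧ ∀ h, MeasurableSet[m] (S n ⁻¹' {h})) ∧
    (∀ᵐ ω ∂P, Tendsto (fun n => S n ω) atTop (𝓝 (Φ ω))) ∧
    TendstoInMeasure P (fun n ω => W (S n ω) ω) atTop Z

open Classical in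
/-- A version of `W(Φ)` (and `0` if it does not exist). -/
def randomIntegral {Ω H : Type*} (m : MeasurableSpace Ω) [MeasurableSpace Ω]
    [NormedAddCommGroup H] [InnerProductSpace ℝ H] (W : H → Ω → ℝ) (P : Measure Ω)
    (Φ : Ω → H) : Ω → ℝ :=
  if h : ∃ Z : Ω → ℝ, IsRandomIntegral m W P Φ Z then h.choose else 0

/-! ### The Lévy process -/

/-- `X` is a symmetric Lévy process in `ℝ^d` started at `0` whose law at each positive time has a
density (the transition function `q_t`) with respect to Lebesgue measure. -/
structure IsSymmetricLevy {Ω : Type*} [MeasurableSpace Ω] {d : ℕ} (X : ℝ≥0 → Ω → Space d)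
    (P : Measure Ω) : Prop where
  measurable : ∀ t, Measurable (X t)
  start : ∀ᵐ ω ∂P, X 0 ω = 0
  indep : HasIndepIncrements X P
  stationary : ∀ s h, P.map (fun ω => X (s + h) ω - X s ω) = P.map (X h)
  cadlag : ∀ᵐ ω ∂P, ∀ t, ContinuousWithinAt (fun s => X s ω) (Ici t) t ∧
    ∃ l, Tendsto (fun s => X s ω) (𝓝[<] t) (𝓝 l)
  symm : ∀ t, P.map (fun ω => -X t ω) = P.map (X t)
  density : ∀ t, 0 < t → P.map (X t) ≪ volume

/-- `Ψ` is the characteristic exponent of `X`: `E exp(i ξ·X_t) = exp(-t Ψ(ξ))`. -/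
def IsCharExponent {Ω : Type*} [MeasurableSpace Ω] {d : ℕ} (X : ℝ≥0 → Ω → Space d)
    (P : Measure Ω) (Ψ : Space d → ℝ) : Prop :=
  ∀ (t : ℝ≥0) (ξ : Space d), charFun (P.map (X t)) ξ = Complex.exp (-((t : ℝ) * Ψ ξ : ℝ))

/-- The integrability hypothesis `∫ 1 / (1 + Ψ(ξ)^{1-β₀}) μ(dξ) < ∞`. -/
def HypothesisI {d : ℕ} (β₀ : ℝ) (Ψ γhat : Space d → ℝ) : Prop :=
  ∫⁻ ξ, ENNReal.ofReal (1 / (1 + Ψ ξ ^ (1 - β₀))) ∂(spectralMeasure γhat) < ∞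

/-- The trajectory of `X` as a random element of `(ℝ^d)^{ℝ₊}` (with the product σ-algebra). -/
def trajectory {Ω : Type*} {d : ℕ} (X : ℝ≥0 → Ω → Space d) (ω : Ω) : ℝ≥0 → Space d :=
  fun s => X s ω

/-- The σ-algebra generated by `X`. -/
@[reducible]
def sigmaAlgebra {Ω : Type*} {d : ℕ} (X : ℝ≥0 → Ω → Space d) : MeasurableSpace Ω :=
  MeasurableSpace.comap (trajectory X) inferInstance

/-! ### The mollified kernels -/

/-- `p` is a symmetric smooth compactly supported probability density on `ℝ^d` with nonnegative
Fourier transform (which is real, by symmetry). -/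
structure IsMollifier {d : ℕ} (p : Space d → ℝ) : Prop where
  smooth : ContDiff ℝ (⊤ : ℕ∞) p
  compact : HasCompactSupport p
  nonneg : ∀ x, 0 ≤ p x
  integral_eq : ∫ x, p x = 1
  symm : ∀ x, p (-x) = p x
  hat_nonneg : ∀ ξ, 0 ≤ (fourierHat (fun x => (p x : ℂ)) ξ).re

/-- `p_ε(x) = ε^{-d} p(x / ε)`. -/
def spaceMollifier {d : ℕ} (p : Space d → ℝ) (ε : ℝ) (x : Space d) : ℝ :=
  (ε ^ d)⁻¹ * p (ε⁻¹ • x)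

/-- `g_δ(u) = δ^{-1} 1_{[0,δ]}(u)`. -/
def timeMollifier (δ u : ℝ) : ℝ :=
  (Icc 0 δ).indicator (fun _ => δ⁻¹) u

/-- The mollified kernel
`Φ_{t,x}^{ε,δ}(r,y) = 1_{[0,t]}(r) ∫_0^t g_δ(t - s - r) p_ε(X_s + x - y) ds`
along the trajectory `X = X(ω)`. -/
def mollifiedKernel {d : ℕ} (p : Space d → ℝ) (t : ℝ) (x : Space d) (ε δ : ℝ)
    (path : ℝ≥0 → Space d) (z : ℝ × Space d) : ℝ :=
  (Icc 0 t).indicator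
    (fun r => ∫ s in (0 : ℝ)..t,
      timeMollifier δ (t - s - r) * spaceMollifier p ε (path s.toNNReal + x - z.2)) z.1

/-- The random element `ω ↦ Φ_{t,x}^{ε,δ}` of `𝓗`. -/
def kernelElement {Ω : Type*} {d : ℕ} (β₀ : ℝ) (γ : Space d → ℝ≥0∞) (X : ℝ≥0 → Ω → Space d)
    (p : Space d → ℝ) (t : ℝ) (x : Space d) (ε δ : ℝ) (ω : Ω) : NoiseSpace β₀ γ :=
  toNoiseSpace β₀ γ (mollifiedKernel p t x ε δ (trajectory X ω))

/-- The random variable `W(Φ_{t,x}^{ε,δ})`. -/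
def mollifiedIntegral {Ω : Type*} [MeasurableSpace Ω] {d : ℕ} (β₀ : ℝ) (γ : Space d → ℝ≥0∞)
    (X : ℝ≥0 → Ω → Space d) (W : NoiseSpace β₀ γ → Ω → ℝ) (P : Measure Ω)
    (p : Space d → ℝ) (t : ℝ) (x : Space d) (ε δ : ℝ) : Ω → ℝ :=
  randomIntegral (sigmaAlgebra X) W P (kernelElement β₀ γ X p t x ε δ)

/-- `∫_0^t ∫_0^t |r - s|^{-β₀} γ(X_r - X_s) ds dr`, along a trajectory. -/
def hamiltonian {d : ℕ} (β₀ : ℝ) (γ : Space d → ℝ≥0∞) (t : ℝ) (path : ℝ≥0 → Space d) : ℝ≥0∞ :=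
  ∫⁻ r in Icc 0 t, ∫⁻ s in Icc 0 t,
    ENNReal.ofReal (|r - s| ^ (-β₀)) * γ (path r.toNNReal - path s.toNNReal)

end FeynmanKac

end

open MeasureTheory ProbabilityTheory Filter Topology Set
open scoped ENNReal NNReal SchwartzMap

noncomputable section

namespace FeynmanKac

/-! Everything comes down to one limit in L¹(Ω). Along a càdlàg path the kernel Φ^{ε,δ} is bounded,
measurable and of bounded support, hence an element of 𝓗. For two parameter pairs the inner product
is ∫∫_{[0,t]²} T(s,s') G(X_s - X_s') ds ds', where T averages |·|^{-β₀} over small time shifts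
(`timeKernel`) and G averages γ over small space shifts (`smoothCov`); see
`ofReal_covForm_mollifiedKernel`. If these inner products converge to V in L¹(Ω), then expanding ‖Φ
- Φ'‖² shows that the kernels are Cauchy in L²(Ω; 𝓗) and that the squared norm of their limit is V
(`exists_limit_of_tendsto_inner`). Since W is independent of X, conditionally on X the variable W(Φ)
is N(0, ‖Φ‖²). This is an isometry, so the Cauchy property and the conditional law pass from the
kernels to the integrals.

The L¹ limit (`tendsto_mollifiedCov`) is Scheffé's lemma on [0,t]² × Ω. The integrand converges
pointwise because X_s - X_s' ≠ 0 almost surely for s ≠ s', and γ is continuous and finite off the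
origin. For the total mass, E γ(y + X_u) coincides for almost every y with the continuous function
(2π)^{-d} ∫ cos(ξ·y) e^{-uΨ(ξ)} μ(dξ), which is largest at y = 0 (`potential_ae_eq`,
`specPotential_le`). This bounds the mean of G and gives its limit. The almost everywhere identity
says nothing at y = 0 itself; there the law of X_u is written as the convolution square of the law
of X_{u/2}, which has a density (`lintegral_law`). On the time side, T ≤ C |s - s'|^{-β₀}
(`exists_timeKernel_le`), and ∫_{|v| ≤ t} |v|^{-β₀} e^{-|v|ψ} dv ≤ C/(1 + ψ^{1-β₀}), so the
integrability hypothesis on Ψ is what makes the dominating function integrable.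

None of this has content unless the form is positive semidefinite, since otherwise 𝓗 is built from
the zero form. For the spatial kernel, positivity is the spectral identity applied to an
autocorrelation, whose Fourier transform is a squared modulus. The temporal kernel |s - r|^{-β₀} is
a positive mixture of products 1_I(s) 1_I(r) over intervals I, and for each I integrating out time
reduces the form to the spatial one (`covForm_nonneg`). -/

/-! ### Bounded functions with bounded support, and bilinear forms with a kernel -/

/-- `φ` is bounded by `B` and vanishes outside the closed ball of radius `R`. -/
def BddSupp {E : Type*} [NormedAddCommGroup E] (B R : ℝ) (φ : E → ℝ) : Prop :=
  (∀ x, |φ x| ≤ B) ∧ ∀ x, R < ‖x‖ → φ x = 0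

/-- `k` is integrable on products of balls. -/
def LocIntKernel {E : Type*} [NormedAddCommGroup E] [MeasurableSpace E] (μ : Measure E)
    (k : E × E → ℝ) : Prop :=
  ∀ R : ℝ, IntegrableOn k (Metric.closedBall 0 R ×ˢ Metric.closedBall 0 R) (μ.prod μ)

/-- The bilinear form with kernel `k`. -/
def kernelForm {E : Type*} [MeasurableSpace E] (μ : Measure E)
    (k : E × E → ℝ) (φ ψ : E → ℝ) : ℝ :=
  ∫ p, φ p.1 * ψ p.2 * k p ∂(μ.prod μ)

section Form

variable {E : Type*} [NormedAddCommGroup E]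

lemma BddSupp.mono {B B' R R' : ℝ} {φ : E → ℝ} (h : BddSupp B R φ) (hB : B ≤ B') (hR : R ≤ R') :
    BddSupp B' R' φ :=
  ⟨fun x => (h.1 x).trans hB, fun x hx => h.2 x (hR.trans_lt hx)⟩

lemma BddSupp.sub {B B' R R' : ℝ} {φ ψ : E → ℝ} (h : BddSupp B R φ) (h' : BddSupp B' R' ψ) :
    BddSupp (B + B') (max R R') (fun x => φ x - ψ x) :=
  ⟨fun x => (abs_sub _ _).trans (add_le_add (h.1 x) (h'.1 x)), fun x hx => by
    dsimp only
    rw [h.2 x ((le_max_left _ _).trans_lt hx), h'.2 x ((le_max_right _ _).trans_lt hx), sub_zero]⟩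

lemma BddSupp.nonneg {B R : ℝ} {φ : E → ℝ} (h : BddSupp B R φ) : 0 ≤ B :=
  (abs_nonneg _).trans (h.1 0)

lemma BddSupp.hasCompactSupport [ProperSpace E] {B R : ℝ} {φ : E → ℝ} (h : BddSupp B R φ) :
    HasCompactSupport φ :=
  HasCompactSupport.intro (isCompact_closedBall (0 : E) R) fun x hx =>
    h.2 x (by simpa using hx)

lemma exists_bddSupp {φ : E → ℝ} (hc : Continuous φ) (h : HasCompactSupport φ) :
    ∃ B R : ℝ, BddSupp B R φ := by
  obtain ⟨B, hB⟩ := hc.bounded_above_of_compact_support h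
  obtain ⟨R, hR⟩ := h.isCompact.isBounded.subset_closedBall (0 : E)
  refine ⟨B, R, fun x => hB x, fun x hx => ?_⟩
  by_contra h0
  have := hR (subset_tsupport φ h0)
  simp at this
  linarith

lemma norm_integrand_le {k : E × E → ℝ} {B R : ℝ} {φ ψ : E → ℝ}
    (hφ : BddSupp B R φ) (hψ : BddSupp B R ψ) (p : E × E) :
    ‖φ p.1 * ψ p.2 * k p‖ ≤
      B * B * (Metric.closedBall 0 R ×ˢ Metric.closedBall 0 R).indicator (fun p => ‖k p‖) p := by
  have hB := hφ.nonneg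
  by_cases hp : p ∈ (Metric.closedBall (0 : E) R ×ˢ Metric.closedBall (0 : E) R)
  · rw [indicator_of_mem hp, norm_mul, norm_mul]
    gcongr
    · exact hφ.1 _
    · exact hψ.1 _
  · rw [indicator_of_notMem hp]
    simp only [mem_prod, mem_closedBall_zero_iff, not_and_or, not_le] at hp
    rcases hp with hp | hp
    · simp [hφ.2 _ hp]
    · simp [hψ.2 _ hp]

variable [MeasurableSpace E] [OpensMeasurableSpace E]

lemma LocIntKernel.integrable_dominator {μ : Measure E} [SFinite μ] {k : E × E → ℝ}
    (hk : LocIntKernel μ k) (B R : ℝ) :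
    Integrable (fun p => B * B * (Metric.closedBall (0 : E) R ×ˢ Metric.closedBall 0 R).indicator
      (fun p => ‖k p‖) p) (μ.prod μ) := by
  have h := (hk R).norm
  refine Integrable.const_mul ?_ _
  rw [integrable_indicator_iff
    (Metric.isClosed_closedBall.measurableSet.prod Metric.isClosed_closedBall.measurableSet)]
  exact h

lemma integrable_kernelForm {μ : Measure E} [SFinite μ] {k : E × E → ℝ}
    (hk : LocIntKernel μ k) (hkm : AEStronglyMeasurable k (μ.prod μ)) {B B' R R' : ℝ} {φ ψ : E → ℝ}
    (hφ : BddSupp B R φ) (hψ : BddSupp B' R' ψ) (hφm : Measurable φ) (hψm : Measurable ψ) :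
    Integrable (fun p : E × E => φ p.1 * ψ p.2 * k p) (μ.prod μ) := by
  refine (hk.integrable_dominator (max B B') (max R R')).mono' ?_ ?_
  · exact (((hφm.comp measurable_fst).mul (hψm.comp measurable_snd)).aestronglyMeasurable).mul hkm
  · exact Eventually.of_forall fun p => norm_integrand_le
      (hφ.mono (le_max_left _ _) (le_max_left _ _)) (hψ.mono (le_max_right _ _) (le_max_right _ _)) p

/-- Dominated convergence: `norm_integrand_le` supplies a dominating function that depends only on
the common bound and radius. For this reason the approximations below always keep both uniform. -/
lemma tendsto_kernelForm {μ : Measure E} [SFinite μ] {k : E × E → ℝ}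
    (hk : LocIntKernel μ k) (hkm : AEStronglyMeasurable k (μ.prod μ)) {B R : ℝ}
    {ι : Type*} {l : Filter ι} [l.IsCountablyGenerated] {φ ψ : ι → E → ℝ} {φ' ψ' : E → ℝ}
    (hφ : ∀ i, BddSupp B R (φ i)) (hψ : ∀ i, BddSupp B R (ψ i))
    (hφm : ∀ i, Measurable (φ i)) (hψm : ∀ i, Measurable (ψ i))
    (hφ' : ∀ᵐ x ∂μ, Tendsto (fun i => φ i x) l (𝓝 (φ' x)))
    (hψ' : ∀ᵐ x ∂μ, Tendsto (fun i => ψ i x) l (𝓝 (ψ' x))) :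
    Tendsto (fun i => kernelForm μ k (φ i) (ψ i)) l (𝓝 (kernelForm μ k φ' ψ')) := by
  refine tendsto_integral_filter_of_dominated_convergence _ ?_ ?_
    (hk.integrable_dominator B R) ?_
  · exact Eventually.of_forall fun i => ((((hφm i).comp measurable_fst).mul
      ((hψm i).comp measurable_snd)).aestronglyMeasurable).mul hkm
  · exact Eventually.of_forall fun i => Eventually.of_forall fun p =>
      norm_integrand_le (hφ i) (hψ i) p
  · have h1 : ∀ᵐ p ∂(μ.prod μ), Tendsto (fun i => φ i p.1) l (𝓝 (φ' p.1)) :=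
      Measure.quasiMeasurePreserving_fst.ae hφ'
    have h2 : ∀ᵐ p ∂(μ.prod μ), Tendsto (fun i => ψ i p.2) l (𝓝 (ψ' p.2)) :=
      Measure.quasiMeasurePreserving_snd.ae hψ'
    filter_upwards [h1, h2] with p hp1 hp2
    exact (hp1.mul hp2).mul_const _

end Form

/-- A bounded function with bounded support is an a.e. limit of uniformly bounded smooth functions
supported in a common ball. -/
lemma exists_smooth_approx {E : Type*} [NormedAddCommGroup E] [NormedSpace ℝ E]
    [FiniteDimensional ℝ E] [MeasurableSpace E] [BorelSpace E] (μ : Measure E)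
    [μ.IsAddHaarMeasure] {B R : ℝ} {φ : E → ℝ} (hφ : BddSupp B R φ) (hφm : Measurable φ) :
    ∃ ψ : ℕ → E → ℝ, (∀ n, ContDiff ℝ (⊤ : ℕ∞) (ψ n)) ∧ (∀ n, BddSupp B (R + 1) (ψ n)) ∧
      ∀ᵐ x ∂μ, Tendsto (fun n => ψ n x) atTop (𝓝 (φ x)) := by
  -- The ratio of the two radii is fixed at 2, as almost everywhere convergence of the convolutions
  -- requires, and the outer radius is at most 1, so supports grow by at most 1.
  let b : ℕ → ContDiffBump (0 : E) := fun n =>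
    ⟨1 / (2 * ((n : ℝ) + 1)), 1 / ((n : ℝ) + 1), by positivity, by
      apply one_div_lt_one_div_of_lt <;> [positivity; nlinarith [Nat.cast_nonneg (α := ℝ) n]]⟩
  have hbsupp : ∀ n x, 1 < ‖x‖ → (b n).normed μ x = 0 := by
    intro n x hx
    have : x ∉ Function.support ((b n).normed μ) := by
      rw [ContDiffBump.support_normed_eq]
      simp only [mem_ball_zero_iff, not_lt, b]
      refine le_trans ?_ hx.le
      rw [div_le_one (by positivity)]; linarith [Nat.cast_nonneg (α := ℝ) n]
    simpa using this
  have hint : Integrable φ μ := by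
    have : IntegrableOn φ (Metric.closedBall 0 R) μ := by
      refine Measure.integrableOn_of_bounded (M := B)
        (isCompact_closedBall _ _).measure_lt_top.ne hφm.aestronglyMeasurable ?_
      exact Eventually.of_forall fun x => hφ.1 x
    rw [← integrable_indicator_iff Metric.isClosed_closedBall.measurableSet] at this
    refine this.congr (Eventually.of_forall fun x => ?_)
    show indicator _ _ x = φ x
    by_cases hx : x ∈ Metric.closedBall (0 : E) R
    · rw [indicator_of_mem hx]
    · rw [indicator_of_notMem hx]; exact (hφ.2 x (by simpa using hx)).symm
  refine ⟨fun n => convolution ((b n).normed μ) φ (ContinuousLinearMap.lsmul ℝ ℝ) μ,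
    fun n => ?_, fun n => ⟨fun x => ?_, fun x hx => ?_⟩, ?_⟩
  · exact (b n).hasCompactSupport_normed.contDiff_convolution_left _ (b n).contDiff_normed
      hint.locallyIntegrable
  · dsimp only
    rw [convolution_def]
    have h1 : ∀ t, ‖(ContinuousLinearMap.lsmul ℝ ℝ) ((b n).normed μ t) (φ (x - t))‖
        ≤ B * (b n).normed μ t := by
      intro t
      simp only [ContinuousLinearMap.lsmul_apply, smul_eq_mul, norm_mul, Real.norm_eq_abs]
      rw [abs_of_nonneg ((b n).nonneg_normed t), mul_comm]
      exact mul_le_mul_of_nonneg_right (hφ.1 _) ((b n).nonneg_normed t)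
    calc |∫ t, _ ∂μ| ≤ ∫ t, B * (b n).normed μ t ∂μ :=
          norm_integral_le_of_norm_le ((b n).integrable_normed.const_mul B)
            (Eventually.of_forall h1)
      _ = B := by rw [integral_const_mul, (b n).integral_normed, mul_one]
  · dsimp only
    rw [convolution_def]
    refine integral_eq_zero_of_ae (Eventually.of_forall fun t => ?_)
    simp only [ContinuousLinearMap.lsmul_apply, smul_eq_mul, Pi.zero_apply, mul_eq_zero]
    by_cases ht : 1 < ‖t‖
    · exact Or.inl (hbsupp n t ht)
    · right
      apply hφ.2
      have := norm_sub_norm_le x t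
      linarith
  · refine ContDiffBump.ae_convolution_tendsto_right_of_locallyIntegrable (K := 2) ?_ ?_
      hint.locallyIntegrable
    · exact tendsto_one_div_add_atTop_nhds_zero_nat
    · refine Eventually.of_forall fun n => ?_
      simp only [b]
      apply le_of_eq
      field_simp

end FeynmanKac

namespace FeynmanKac

/-! ### Local integrability of the covariance kernel -/

/-- For x and y in the ball of radius R, the difference x - y lies in the ball of radius 2R; for
fixed y, translation invariance replaces x - y by a single variable there. -/
lemma lintegral_diff_le {E : Type*} [NormedAddCommGroup E] [MeasurableSpace E] [BorelSpace E]
    [SecondCountableTopology E] (μ : Measure E) [SFinite μ] [μ.IsAddRightInvariant]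
    {κ : E → ℝ≥0∞} (hκ : Measurable κ) (R : ℝ) :
    ∫⁻ p in Metric.closedBall (0 : E) R ×ˢ Metric.closedBall 0 R, κ (p.1 - p.2) ∂(μ.prod μ)
      ≤ μ (Metric.closedBall 0 R) * ∫⁻ x in Metric.closedBall 0 (2 * R), κ x ∂μ := by
  rw [← Measure.prod_restrict, lintegral_prod_symm _ (by fun_prop)]
  calc ∫⁻ y in Metric.closedBall 0 R, ∫⁻ x in Metric.closedBall 0 R, κ (x - y) ∂μ ∂μ
      ≤ ∫⁻ y in Metric.closedBall 0 R, ∫⁻ x in Metric.closedBall 0 (2 * R), κ x ∂μ ∂μ := by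
        refine setLIntegral_mono' Metric.isClosed_closedBall.measurableSet fun y hy => ?_
        rw [← lintegral_indicator Metric.isClosed_closedBall.measurableSet,
          ← lintegral_indicator Metric.isClosed_closedBall.measurableSet,
          ← lintegral_sub_right_eq_self ((Metric.closedBall 0 (2 * R)).indicator fun x => κ x) y]
        refine lintegral_mono fun x => ?_
        by_cases hx : x ∈ Metric.closedBall (0 : E) R
        · rw [indicator_of_mem hx, indicator_of_mem]
          simp only [mem_closedBall_zero_iff] at hx hy ⊢
          linarith [norm_sub_le x y]
        · rw [indicator_of_notMem hx]; exact zero_le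
    _ = _ := by rw [lintegral_const, Measure.restrict_apply_univ, mul_comm]

lemma lintegral_abs_rpow_lt_top {β₀ : ℝ} (hβ : β₀ < 1) (R : ℝ) :
    ∫⁻ u in Metric.closedBall (0 : ℝ) R, ENNReal.ofReal (|u| ^ (-β₀)) < ∞ := by
  have h1 : IntegrableOn (fun u : ℝ => |u| ^ (-β₀)) (Icc 0 |R|) := by
    have := (intervalIntegral.intervalIntegrable_rpow' (a := 0) (b := |R|) (r := -β₀) (by linarith))
    rw [intervalIntegrable_iff_integrableOn_Icc_of_le (abs_nonneg _)] at this
    exact this.congr_fun (fun u hu => by simp [abs_of_nonneg hu.1]) measurableSet_Icc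
  have h2 : IntegrableOn (fun u : ℝ => |u| ^ (-β₀)) (Icc (-|R|) 0) := by
    have := h1.comp_neg
    simpa using this
  have h3 := h2.union h1
  rw [Icc_union_Icc_eq_Icc (by simp) (abs_nonneg _)] at h3
  have h4 : IntegrableOn (fun u : ℝ => |u| ^ (-β₀)) (Metric.closedBall (0 : ℝ) R) := by
    refine h3.mono_set fun u hu => ?_
    rw [mem_closedBall_zero_iff, Real.norm_eq_abs] at hu
    exact abs_le.1 (hu.trans (le_abs_self R))
  have := h4.2
  rw [HasFiniteIntegral] at this
  refine lt_of_le_of_lt (lintegral_mono fun u => ?_) this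
  rw [Real.enorm_eq_ofReal_abs]
  exact ENNReal.ofReal_le_ofReal (le_abs_self _)

variable {d : ℕ} {β₀ : ℝ} {γ : Space d → ℝ≥0∞} {γhat : Space d → ℝ}

lemma measurable_covKernel (β₀ : ℝ) (hγ : Measurable γ) :
    Measurable fun p : (ℝ × Space d) × (ℝ × Space d) => covKernel β₀ γ p.1 p.2 := by
  unfold covKernel
  fun_prop

lemma halfVolume_le : halfVolume d ≤ (volume : Measure ℝ).prod (volume : Measure (Space d)) :=
  Measure.prod_mono Measure.restrict_le_self le_rfl

instance : SFinite (halfVolume d) := by unfold halfVolume; infer_instance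

lemma IsSpatialCovariance.measurable (hγ : IsSpatialCovariance γ γhat) : Measurable γ :=
  hγ.continuous.measurable

/-- After enlarging `halfVolume` to Lebesgue measure, only differences matter, and the kernel is the
product of |u|^{-β₀}, integrable near 0 as β₀ < 1, and the locally integrable γ. -/
lemma lintegral_covKernel_lt_top (hβ : β₀ < 1) (hγ : IsSpatialCovariance γ γhat) (R : ℝ) :
    ∫⁻ p in Metric.closedBall 0 R ×ˢ Metric.closedBall 0 R,
      covKernel β₀ γ p.1 p.2 ∂((halfVolume d).prod (halfVolume d)) < ∞ := by
  have hm := hγ.measurable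
  have h0 : ∫⁻ p in Metric.closedBall 0 R ×ˢ Metric.closedBall 0 R,
      covKernel β₀ γ p.1 p.2 ∂((halfVolume d).prod (halfVolume d)) ≤
      ∫⁻ p in Metric.closedBall 0 R ×ˢ Metric.closedBall 0 R,
      covKernel β₀ γ p.1 p.2 ∂(((volume : Measure ℝ).prod (volume : Measure (Space d))).prod
        ((volume : Measure ℝ).prod (volume : Measure (Space d)))) :=
    lintegral_mono' (Measure.restrict_mono subset_rfl
      (Measure.prod_mono halfVolume_le halfVolume_le)) le_rfl
  refine h0.trans_lt ?_
  refine (lintegral_diff_le ((volume : Measure ℝ).prod (volume : Measure (Space d)))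
    (κ := fun z => ENNReal.ofReal (|z.1| ^ (-β₀)) * γ z.2) (by fun_prop) R).trans_lt ?_
  refine ENNReal.mul_lt_top (isCompact_closedBall _ _).measure_lt_top ?_
  rw [show (0 : ℝ × Space d) = (0, 0) from rfl, ← closedBall_prod_same,
    ← Measure.prod_restrict, lintegral_prod_mul (f := fun u : ℝ => ENNReal.ofReal (|u| ^ (-β₀)))
      (g := γ) (by fun_prop) (by fun_prop)]
  exact ENNReal.mul_lt_top (lintegral_abs_rpow_lt_top hβ _)
    (hγ.locallyIntegrable _ (isCompact_closedBall _ _))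

lemma IsSpatialCovariance.ae_lt_top (hγ : IsSpatialCovariance γ γhat) : ∀ᵐ x, γ x < ∞ := by
  have h : ∀ n : ℕ, ∀ᵐ x ∂(volume.restrict (Metric.closedBall (0 : Space d) n)), γ x < ∞ :=
    fun n => MeasureTheory.ae_lt_top hγ.measurable (hγ.locallyIntegrable _ (isCompact_closedBall _ _)).ne
  rw [← Measure.restrict_univ (μ := (volume : Measure (Space d))),
    ← Metric.iUnion_closedBall_nat (0 : Space d)]
  exact (ae_restrict_iUnion_iff _ _).2 h

lemma locIntKernel_covKernel (hβ : β₀ < 1) (hγ : IsSpatialCovariance γ γhat) :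
    LocIntKernel (halfVolume d) (fun p => (covKernel β₀ γ p.1 p.2).toReal) := fun R =>
  integrable_toReal_of_lintegral_ne_top (measurable_covKernel β₀ hγ.measurable).aemeasurable
    (lintegral_covKernel_lt_top hβ hγ R).ne

lemma locIntKernel_spatial (hγ : IsSpatialCovariance γ γhat) :
    LocIntKernel (volume : Measure (Space d)) (fun p => (γ (p.1 - p.2)).toReal) := fun R => by
  have hm := hγ.measurable
  refine integrable_toReal_of_lintegral_ne_top (f := fun p : Space d × Space d => γ (p.1 - p.2))
    (by fun_prop) ?_
  exact ((lintegral_diff_le volume hm R).trans_lt (ENNReal.mul_lt_top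
    (isCompact_closedBall _ _).measure_lt_top
    (hγ.locallyIntegrable _ (isCompact_closedBall _ _)))).ne

lemma aestronglyMeasurable_spatial (hγ : Measurable γ) :
    AEStronglyMeasurable (fun p : Space d × Space d => (γ (p.1 - p.2)).toReal)
      (volume.prod volume) :=
  (hγ.comp (measurable_fst.sub measurable_snd)).ennreal_toReal.aestronglyMeasurable

lemma aestronglyMeasurable_covKernel (β₀ : ℝ) (hγ : Measurable γ) :
    AEStronglyMeasurable
      (fun p : (ℝ × Space d) × (ℝ × Space d) => (covKernel β₀ γ p.1 p.2).toReal)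
      ((halfVolume d).prod (halfVolume d)) :=
  (measurable_covKernel β₀ hγ).ennreal_toReal.aestronglyMeasurable

/-! ### Positivity of the spatial covariance -/

/-- The Fourier transform of an autocorrelation is a squared modulus. -/
lemma fourierHat_autocorrelation {f : Space d → ℝ} (hf : Integrable f) (ξ : Space d) :
    fourierHat (convolution (fun x => (f x : ℂ)) (fun x => (f (-x) : ℂ))
      (ContinuousLinearMap.mul ℝ ℂ) volume) ξ
      = (Complex.normSq (fourierHat (fun x => (f x : ℂ)) ξ) : ℂ) := by
  set e : Space d → ℂ := fun x => Complex.exp (-(Complex.I * ((inner ℝ ξ x : ℝ) : ℂ))) with he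
  have hec : Continuous e := by fun_prop
  have hen : ∀ x, ‖e x‖ ≤ 1 := by
    intro x
    rw [he, Complex.norm_exp]
    simp
  have h1 : ∀ x, e x * (convolution (fun x => (f x : ℂ)) (fun x => (f (-x) : ℂ))
      (ContinuousLinearMap.mul ℝ ℂ) volume) x = (convolution (fun x => e x * (f x : ℂ))
      (fun x => e x * (f (-x) : ℂ)) (ContinuousLinearMap.mul ℝ ℂ) volume) x := by
    intro x
    rw [convolution_def, convolution_def, ← integral_const_mul]
    refine integral_congr_ae (Eventually.of_forall fun t => ?_)
    have : e x = e t * e (x - t) := by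
      simp only [he, ← Complex.exp_add]
      congr 1
      rw [inner_sub_right]; push_cast; ring
    simp only [ContinuousLinearMap.mul_apply', this]
    ring
  have hint1 : Integrable (fun x => e x * (f x : ℂ)) :=
    hf.ofReal.bdd_mul hec.aestronglyMeasurable (Eventually.of_forall hen)
  have hint2 : Integrable (fun x => e x * (f (-x) : ℂ)) :=
    (hf.comp_neg.ofReal).bdd_mul hec.aestronglyMeasurable (Eventually.of_forall hen)
  unfold fourierHat
  calc ∫ x, e x * _ = ∫ x, (convolution (fun x => e x * (f x : ℂ))
      (fun x => e x * (f (-x) : ℂ)) (ContinuousLinearMap.mul ℝ ℂ) volume) x :=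
        integral_congr_ae (Eventually.of_forall h1)
    _ = (∫ x, e x * (f x : ℂ)) * ∫ x, e x * (f (-x) : ℂ) := by
        rw [integral_convolution _ hint1 hint2]; rfl
    _ = (∫ x, e x * (f x : ℂ)) * (starRingEnd ℂ) (∫ x, e x * (f x : ℂ)) := by
        congr 1
        rw [← integral_neg_eq_self, ← integral_conj]
        refine integral_congr_ae (Eventually.of_forall fun t => ?_)
        simp only [neg_neg, map_mul, Complex.conj_ofReal, he, ← Complex.exp_conj]
        congr 2
        simp
    _ = _ := Complex.mul_conj _

/-- The substitution w = x - y turns the form into ∫ γ(w) (f ⋆ f̃)(w) dw with f̃(x) = f(-x), and by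
the spectral identity this is a nonnegative multiple of ∫ |f̂|² dμ. -/
lemma kernelForm_spatial_nonneg_of_smooth (hγ : IsSpatialCovariance γ γhat) {f : Space d → ℝ}
    (hf : ContDiff ℝ (⊤ : ℕ∞) f) (hfc : HasCompactSupport f) :
    0 ≤ kernelForm volume (fun p : Space d × Space d => (γ (p.1 - p.2)).toReal) f f := by
  have hm := hγ.measurable
  obtain ⟨B, R, hBR⟩ := exists_bddSupp hf.continuous hfc
  have hint := integrable_kernelForm (locIntKernel_spatial hγ)
    (aestronglyMeasurable_spatial hm) hBR hBR
    hf.continuous.measurable hf.continuous.measurable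
  set φ := convolution (fun x => (f x : ℂ)) (fun x => (f (-x) : ℂ))
      (ContinuousLinearMap.mul ℝ ℂ) (volume : Measure (Space d)) with hφ
  have hfC : ContDiff ℝ (⊤ : ℕ∞) (fun x => (f x : ℂ)) := Complex.ofRealCLM.contDiff.comp hf
  have hfCc : HasCompactSupport (fun x => (f x : ℂ)) := hfc.comp_left (g := Complex.ofReal) rfl
  have hfN : ContDiff ℝ (⊤ : ℕ∞) (fun x => (f (-x) : ℂ)) := hfC.comp contDiff_neg
  have hfNc : HasCompactSupport (fun x => (f (-x) : ℂ)) :=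
    hfCc.comp_homeomorph (Homeomorph.neg _)
  have hφs : ContDiff ℝ (⊤ : ℕ∞) φ :=
    hfCc.contDiff_convolution_left _ hfC hfN.continuous.locallyIntegrable
  have hφc : HasCompactSupport φ := hfCc.convolution _ hfNc
  have key := hγ.spectral (hφc.toSchwartzMap hφs)
  have hcoe : ∀ x, hφc.toSchwartzMap hφs x = φ x := fun x => rfl
  have h1 : ∫ ξ, fourierHat (hφc.toSchwartzMap hφs) ξ ∂(spectralMeasure γhat) =
      ((∫ ξ, Complex.normSq (fourierHat (fun x => (f x : ℂ)) ξ) ∂(spectralMeasure γhat) : ℝ) : ℂ) := by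
    rw [← integral_complex_ofReal]
    refine integral_congr_ae (Eventually.of_forall fun ξ => ?_)
    exact fourierHat_autocorrelation (hf.continuous.integrable_of_hasCompactSupport hfc) ξ
  have h2 : ∫ x, ((γ x).toReal : ℂ) * hφc.toSchwartzMap hφs x =
      ((kernelForm volume (fun p : Space d × Space d => (γ (p.1 - p.2)).toReal) f f : ℝ) : ℂ) := by
    have hT := measurePreserving_sub_prod (volume : Measure (Space d)) (volume : Measure (Space d))
    set H : Space d × Space d → ℝ := fun p => f (p.1 + p.2) * f p.2 * (γ p.1).toReal with hH
    have hHm : Measurable H := by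
      have := hf.continuous.measurable
      have h3 := hm.ennreal_toReal
      fun_prop
    have hcomp : (fun p : Space d × Space d => f p.1 * f p.2 * (γ (p.1 - p.2)).toReal)
        = fun p : Space d × Space d => H (p.1 - p.2, p.2) := by
      ext p; simp [hH]
    have hHint : Integrable H (volume.prod volume) := by
      rw [← hT.map_eq, integrable_map_measure hHm.aestronglyMeasurable hT.measurable.aemeasurable]
      rw [hcomp] at hint
      exact hint
    have h3 : kernelForm volume (fun p : Space d × Space d => (γ (p.1 - p.2)).toReal) f f =
        ∫ w, ∫ y, H (w, y) := by
      rw [← integral_prod _ hHint]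
      conv_rhs => rw [← hT.map_eq]
      rw [integral_map hT.measurable.aemeasurable hHm.aestronglyMeasurable, kernelForm, hcomp]
    rw [h3, ← integral_complex_ofReal]
    refine integral_congr_ae (Eventually.of_forall fun w => ?_)
    dsimp only
    rw [hcoe, hφ, convolution_def, ← integral_complex_ofReal, ← integral_const_mul,
      ← integral_add_left_eq_self _ w]
    refine integral_congr_ae (Eventually.of_forall fun y => ?_)
    simp [hH]
    ring
  rw [h1, h2, ← Complex.ofReal_mul] at key
  rw [Complex.ofReal_injective key]
  refine mul_nonneg (by positivity) (integral_nonneg fun ξ => Complex.normSq_nonneg _)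

/-- Smoothness has to be removed because the functions to which this is applied, time integrals of a
function of (s, x), are merely measurable. -/
lemma kernelForm_spatial_nonneg (hγ : IsSpatialCovariance γ γhat) {f : Space d → ℝ} {B R : ℝ}
    (hf : BddSupp B R f) (hfm : Measurable f) :
    0 ≤ kernelForm volume (fun p : Space d × Space d => (γ (p.1 - p.2)).toReal) f f := by
  have hm := hγ.measurable
  obtain ⟨ψ, hψs, hψb, hψ⟩ := exists_smooth_approx volume hf hfm
  refine ge_of_tendsto (tendsto_kernelForm (locIntKernel_spatial hγ)
    (aestronglyMeasurable_spatial hm) hψb hψb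
    (fun n => (hψs n).continuous.measurable) (fun n => (hψs n).continuous.measurable) hψ hψ)
    (Eventually.of_forall fun n => ?_)
  exact kernelForm_spatial_nonneg_of_smooth hγ (hψs n) (hψb n).hasCompactSupport

end FeynmanKac

namespace FeynmanKac

/-! ### Positivity of the covariance form -/

lemma measurePreserving_prod_prod_comm {α α' β β' : Type*} [MeasurableSpace α]
    [MeasurableSpace α'] [MeasurableSpace β] [MeasurableSpace β'] (μ : Measure α)
    (μ' : Measure α') (ν : Measure β) (ν' : Measure β') [SFinite μ] [SFinite μ'] [SFinite ν]
    [SFinite ν'] :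
    MeasurePreserving (fun p : (α × β) × (α' × β') => ((p.1.1, p.2.1), (p.1.2, p.2.2)))
      ((μ.prod ν).prod (μ'.prod ν')) ((μ.prod μ').prod (ν.prod ν')) := by
  have h1 := measurePreserving_prodAssoc μ ν (μ'.prod ν')
  have h2 := (measurePreserving_prodAssoc μ' ν ν').comp
    (((Measure.measurePreserving_swap (μ := ν) (ν := μ')).prod (MeasurePreserving.id ν')).comp
    ((measurePreserving_prodAssoc ν μ' ν').symm))
  have h3 := (measurePreserving_prodAssoc μ μ' (ν.prod ν')).symm
  exact h3.comp (((MeasurePreserving.id μ).prod h2).comp h1)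

variable {d : ℕ} {β₀ : ℝ} {γ : Space d → ℝ≥0∞} {γhat : Space d → ℝ}

lemma covKernel_zero (γ : Space d → ℝ≥0∞) (z w : ℝ × Space d) :
    covKernel 0 γ z w = γ (z.2 - w.2) := by
  simp [covKernel]

/-- For β₀ = 0 the kernel ignores time, so by Fubini the form is the spatial form of the time
integral F(x) = ∫ φ(s, x) ds. -/
lemma covForm_zero_nonneg (hγ : IsSpatialCovariance γ γhat) {φ : ℝ × Space d → ℝ} {B R : ℝ}
    (hφ : BddSupp B R φ) (hφm : Measurable φ) : 0 ≤ covForm 0 γ φ φ := by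
  have hint := integrable_kernelForm (locIntKernel_covKernel zero_lt_one hγ)
    (aestronglyMeasurable_covKernel 0 hγ.measurable) hφ hφ hφm hφm
  simp only [covKernel_zero] at hint
  set lam := (volume : Measure ℝ).restrict (Ici 0) with hlam
  set F : Space d → ℝ := fun x => ∫ s, φ (s, x) ∂lam with hF
  have hFm : Measurable F :=
    (hφm.stronglyMeasurable.integral_prod_left' (μ := lam)).measurable
  have hIcc : ∀ x, F x = ∫ s in Icc (-R) R, φ (s, x) ∂lam := by
    intro x
    rw [setIntegral_eq_integral_of_forall_compl_eq_zero]
    intro s hs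
    refine hφ.2 _ (lt_of_lt_of_le ?_ (norm_fst_le _))
    rw [Real.norm_eq_abs]
    by_contra h
    exact hs (abs_le.1 (not_lt.1 h))
  have hFb : BddSupp (B * (lam (Icc (-R) R)).toReal) R F := by
    refine ⟨fun x => ?_, fun x hx => ?_⟩
    · rw [hIcc]
      refine norm_setIntegral_le_of_norm_le_const (f := fun s => φ (s, x)) (C := B) ?_
        fun s _ => hφ.1 _
      exact (Measure.restrict_apply_le _ _).trans_lt (by simp)
    · refine integral_eq_zero_of_ae (Eventually.of_forall fun s => ?_)
      exact hφ.2 _ (lt_of_lt_of_le hx (norm_snd_le (s, x)))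
  refine (kernelForm_spatial_nonneg hγ hFb hFm).trans_eq ?_
  have mp := measurePreserving_prod_prod_comm lam lam (volume : Measure (Space d))
    (volume : Measure (Space d))
  set H : (ℝ × ℝ) × (Space d × Space d) → ℝ :=
    fun q => φ (q.1.1, q.2.1) * φ (q.1.2, q.2.2) * (γ (q.2.1 - q.2.2)).toReal with hH
  have hHm : Measurable H := by
    have hm := hγ.measurable
    fun_prop
  have hHint : Integrable H ((lam.prod lam).prod (volume.prod volume)) := by
    rw [← mp.map_eq, integrable_map_measure hHm.aestronglyMeasurable mp.measurable.aemeasurable]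
    exact hint
  have e1 : covForm 0 γ φ φ = ∫ q, H q ∂((lam.prod lam).prod (volume.prod volume)) := by
    rw [← mp.map_eq, integral_map mp.measurable.aemeasurable hHm.aestronglyMeasurable]
    simp only [covForm, covKernel_zero]
    rfl
  rw [e1, integral_prod_symm _ hHint, kernelForm]
  refine integral_congr_ae (Eventually.of_forall fun p => ?_)
  simp only [hH, hF]
  rw [integral_mul_const, integral_prod_mul (fun s => φ (s, p.1)) (fun s => φ (s, p.2))]

/-- The indicator of `[z, z + a]`, for `j = (a, z)`. -/
def windowFn (j : ℝ × ℝ) (s : ℝ) : ℝ := if j.2 ≤ s ∧ s ≤ j.2 + j.1 then 1 else 0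

/-- The measure `a^{-β₀-2} da dz`, on windows `[z, z + a]`. -/
def windowMeasure (β₀ : ℝ) : Measure (ℝ × ℝ) :=
  ((volume.restrict (Ioi 0)).withDensity fun a : ℝ => ENNReal.ofReal (a ^ (-β₀ - 2))).prod volume

instance : SFinite (windowMeasure β₀) := by unfold windowMeasure; infer_instance

lemma measurable_windowFn : Measurable fun q : (ℝ × ℝ) × ℝ => windowFn q.1 q.2 := by
  unfold windowFn
  refine Measurable.ite ?_ measurable_const measurable_const
  exact (measurableSet_le (f := fun q : (ℝ × ℝ) × ℝ => q.1.2) (g := fun q => q.2)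
    (by fun_prop) (by fun_prop)).inter (measurableSet_le (f := fun q : (ℝ × ℝ) × ℝ => q.2)
    (g := fun q => q.1.2 + q.1.1) (by fun_prop) (by fun_prop))

lemma windowFn_nonneg (j : ℝ × ℝ) (s : ℝ) : 0 ≤ windowFn j s := by
  unfold windowFn; split_ifs <;> simp

lemma windowFn_le_one (j : ℝ × ℝ) (s : ℝ) : windowFn j s ≤ 1 := by
  unfold windowFn; split_ifs <;> simp

/-- The kernel `|s - r|^{-β₀}` is a mixture of the positive definite kernels
`1_{[z, z+a]}(s) 1_{[z, z+a]}(r)`. -/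
lemma lintegral_windowFn (hβ : 0 < β₀) {s r : ℝ} (hsr : s ≠ r) :
    ∫⁻ j, ENNReal.ofReal (windowFn j s * windowFn j r) ∂(windowMeasure β₀) =
      ENNReal.ofReal ((1 / β₀ - 1 / (β₀ + 1)) * |s - r| ^ (-β₀)) := by
  have hm : Measurable fun j : ℝ × ℝ => ENNReal.ofReal (windowFn j s * windowFn j r) := by
    have h1 : Measurable fun j : ℝ × ℝ => windowFn j s :=
      measurable_windowFn.comp (measurable_id.prodMk measurable_const)
    have h2 : Measurable fun j : ℝ × ℝ => windowFn j r :=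
      measurable_windowFn.comp (measurable_id.prodMk measurable_const)
    fun_prop
  have hv : 0 < |s - r| := abs_pos.2 (sub_ne_zero.2 hsr)
  set v := |s - r| with hvdef
  -- A window of length a contains s and r exactly when its left endpoint lies in [max s r - a, min
  -- s r], an interval of length a - |s - r|, empty if this is negative.
  have hin : ∀ a : ℝ, ∫⁻ z, ENNReal.ofReal (windowFn (a, z) s * windowFn (a, z) r) =
      ENNReal.ofReal (a - v) := by
    intro a
    have : ∀ z, ENNReal.ofReal (windowFn (a, z) s * windowFn (a, z) r) =
        (Icc (max s r - a) (min s r)).indicator (fun _ => (1 : ℝ≥0∞)) z := by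
      intro z
      by_cases hz : z ∈ Icc (max s r - a) (min s r)
      · rw [indicator_of_mem hz]
        have h1 := hz.1
        have h2 := le_min_iff.1 hz.2
        have h3 := max_le_iff.1 (sub_le_iff_le_add.1 h1)
        simp [windowFn, h2.1, h2.2, h3.1, h3.2]
      · rw [indicator_of_notMem hz]
        simp only [windowFn]
        split_ifs with h1 h2
        · exact absurd ⟨sub_le_iff_le_add.2 (max_le h1.2 h2.2), le_min h1.1 h2.1⟩ hz
        all_goals simp
    simp_rw [this]
    rw [lintegral_indicator measurableSet_Icc, lintegral_const, one_mul,
      Measure.restrict_apply_univ, Real.volume_Icc]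
    congr 1
    rw [hvdef, ← max_sub_min_eq_abs, max_comm r s, min_comm r s]
    ring
  rw [windowMeasure, lintegral_prod _ hm.aemeasurable]
  simp_rw [hin]
  rw [lintegral_withDensity_eq_lintegral_mul _ (by fun_prop) (by fun_prop)]
  have h1 : ∫⁻ a in Ioi (0 : ℝ), ((fun a : ℝ => ENNReal.ofReal (a ^ (-β₀ - 2))) *
      fun a => ENNReal.ofReal (a - v)) a
      = ∫⁻ a in Ioi v, ENNReal.ofReal (a ^ (-β₀ - 1) - v * a ^ (-β₀ - 2)) := by
    rw [← lintegral_indicator measurableSet_Ioi, ← lintegral_indicator measurableSet_Ioi]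
    refine lintegral_congr fun a => ?_
    by_cases ha : v < a
    · rw [indicator_of_mem (mem_Ioi.2 (hv.trans ha)), indicator_of_mem (mem_Ioi.2 ha)]
      have ha0 := hv.trans ha
      simp only [Pi.mul_apply]
      rw [← ENNReal.ofReal_mul (by positivity)]
      congr 1
      have : a ^ (-β₀ - 1) = a ^ (-β₀ - 2) * a := by
        rw [← Real.rpow_add_one ha0.ne']; congr 1; ring
      rw [this]; ring
    · rw [indicator_of_notMem (s := Ioi v) (by simpa using ha)]
      by_cases h0 : a ∈ Ioi (0 : ℝ)
      · rw [indicator_of_mem h0]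
        simp only [Pi.mul_apply]
        rw [ENNReal.ofReal_of_nonpos (p := a - v) (by linarith), mul_zero]
      · rw [indicator_of_notMem h0]
  rw [h1]
  -- The remaining integral is ∫_v^∞ (a^{-β₀-1} - v a^{-β₀-2}) da = (1/β₀ - 1/(β₀+1)) v^{-β₀}; it
  -- converges at infinity because β₀ > 0.
  have i1 := integrableOn_Ioi_rpow_of_lt (a := -β₀ - 1) (by linarith) hv
  have i2 := (integrableOn_Ioi_rpow_of_lt (a := -β₀ - 2) (by linarith) hv).const_mul v
  rw [← ofReal_integral_eq_lintegral_ofReal (f := fun a => a ^ (-β₀ - 1) - v * a ^ (-β₀ - 2))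
    (i1.sub i2)]
  · congr 1
    rw [integral_sub i1 i2, integral_const_mul, integral_Ioi_rpow_of_lt (by linarith) hv,
      integral_Ioi_rpow_of_lt (by linarith) hv]
    have e1 : v ^ (-β₀ - 2 + 1) = v ^ (-β₀) / v := by
      rw [← Real.rpow_sub_one hv.ne']; congr 1; ring
    rw [e1, show -β₀ - 1 + 1 = -β₀ by ring]
    rw [show -β₀ - 2 + 1 = -(β₀ + 1) by ring]
    have h3 : β₀ + 1 ≠ 0 := by linarith
    field_simp
  · refine (ae_restrict_mem measurableSet_Ioi).mono fun a ha => ?_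
    have ha0 := hv.trans ha
    have : a ^ (-β₀ - 1) = a ^ (-β₀ - 2) * a := by
      rw [← Real.rpow_add_one ha0.ne']; congr 1; ring
    simp only [Pi.zero_apply, this]
    have h3 : v < a := ha
    nlinarith [Real.rpow_pos_of_pos ha0 (-β₀ - 2)]

/-- Equal times must be discarded in the window identity: at s = r its left side is infinite, while
the real power `0 ^ (-β₀)` is 0. -/
lemma ae_fst_ne : ∀ᵐ p ∂((halfVolume d).prod (halfVolume d)), p.1.1 ≠ p.2.1 := by
  have hms : MeasurableSet {p : (ℝ × Space d) × (ℝ × Space d) | p.1.1 ≠ p.2.1} :=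
    (measurableSet_eq_fun (by fun_prop) (by fun_prop)).compl
  rw [Measure.ae_prod_iff_ae_ae hms]
  refine Eventually.of_forall fun z => ?_
  have : ∀ᵐ r ∂((volume : Measure ℝ).restrict (Ici 0)), z.1 ≠ r := by
    rw [ae_iff]
    simp only [ne_eq, not_not]
    exact Measure.restrict_apply_eq_zero' measurableSet_Ici |>.2 (measure_mono_null
      (fun x hx => by simpa using hx.1.symm) (measure_singleton (z.1 : ℝ)))
  exact Measure.quasiMeasurePreserving_fst.ae this

/-- With the window representation inserted and the integrals exchanged, C · ⟨φ, φ⟩ is an integral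
over windows j of the time-independent form evaluated at `windowFn j` · φ, and each of these values
is nonnegative. -/
lemma covForm_nonneg (hβ : β₀ ∈ Ioo (0 : ℝ) 1) (hγ : IsSpatialCovariance γ γhat)
    {φ : ℝ × Space d → ℝ} {B R : ℝ} (hφ : BddSupp B R φ) (hφm : Measurable φ) :
    0 ≤ covForm β₀ γ φ φ := by
  have hm := hγ.measurable
  have hC : 0 < 1 / β₀ - 1 / (β₀ + 1) := by
    have := hβ.1
    rw [sub_pos]
    exact one_div_lt_one_div_of_lt hβ.1 (by linarith)
  set C := 1 / β₀ - 1 / (β₀ + 1) with hCdef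
  set N := (halfVolume d).prod (halfVolume d) with hN
  have hint := integrable_kernelForm (locIntKernel_covKernel hβ.2 hγ)
    (aestronglyMeasurable_covKernel β₀ hm) hφ hφ hφm hφm
  set g : (ℝ × Space d) × (ℝ × Space d) → ℝ :=
    fun p => φ p.1 * φ p.2 * (γ (p.1.2 - p.2.2)).toReal with hg
  have hgm : Measurable g := by
    have := hm.ennreal_toReal
    fun_prop
  set H : ((ℝ × Space d) × (ℝ × Space d)) × (ℝ × ℝ) → ℝ :=
    fun q => g q.1 * (windowFn q.2 q.1.1.1 * windowFn q.2 q.1.2.1) with hH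
  have hHm : Measurable H := by
    have h1 : Measurable fun q : ((ℝ × Space d) × (ℝ × Space d)) × (ℝ × ℝ) =>
        windowFn q.2 q.1.1.1 :=
      measurable_windowFn.comp (measurable_snd.prodMk (by fun_prop))
    have h2 : Measurable fun q : ((ℝ × Space d) × (ℝ × Space d)) × (ℝ × ℝ) =>
        windowFn q.2 q.1.2.1 :=
      measurable_windowFn.comp (measurable_snd.prodMk (by fun_prop))
    fun_prop
  have hk : ∀ p : (ℝ × Space d) × (ℝ × Space d), φ p.1 * φ p.2 * (covKernel β₀ γ p.1 p.2).toReal =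
      g p * |p.1.1 - p.2.1| ^ (-β₀) := by
    intro p
    simp only [covKernel, ENNReal.toReal_mul, hg]
    rw [ENNReal.toReal_ofReal (by positivity)]
    ring
  -- Integrating |H| over the windows gives back C times the modulus of the integrand of the form,
  -- which is integrable; this justifies Fubini.
  have hHint : Integrable H (N.prod (windowMeasure β₀)) := by
    refine ⟨hHm.aestronglyMeasurable, ?_⟩
    rw [HasFiniteIntegral, lintegral_prod _ hHm.enorm.aemeasurable]
    have h2 := (hint.const_mul C).2
    rw [HasFiniteIntegral] at h2
    refine lt_of_le_of_lt (le_of_eq (lintegral_congr_ae ?_)) h2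
    filter_upwards [ae_fst_ne] with p hp
    simp only [hH, enorm_mul, hk]
    rw [lintegral_const_mul' _ _ (by simp)]
    have : ∀ j, ‖windowFn j p.1.1‖ₑ * ‖windowFn j p.2.1‖ₑ =
        ENNReal.ofReal (windowFn j p.1.1 * windowFn j p.2.1) := fun j => by
      rw [← enorm_mul, Real.enorm_of_nonneg (mul_nonneg (windowFn_nonneg _ _) (windowFn_nonneg _ _))]
    simp_rw [this]
    rw [lintegral_windowFn hβ.1 hp, ← hCdef, ENNReal.ofReal_mul hC.le, Real.enorm_of_nonneg hC.le,
      Real.enorm_of_nonneg (by positivity : 0 ≤ |p.1.1 - p.2.1| ^ (-β₀))]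
    ring
  have e1 : C * covForm β₀ γ φ φ = ∫ p, ∫ j, H (p, j) ∂(windowMeasure β₀) ∂N := by
    rw [covForm, ← integral_const_mul]
    refine integral_congr_ae ?_
    filter_upwards [ae_fst_ne] with p hp
    simp only [hH, hk]
    rw [integral_const_mul, integral_eq_lintegral_of_nonneg_ae
      (Eventually.of_forall fun j => mul_nonneg (windowFn_nonneg _ _) (windowFn_nonneg _ _)),
      lintegral_windowFn hβ.1 hp, ENNReal.toReal_ofReal (by positivity)]
    · ring
    · have h1 : Measurable fun j : ℝ × ℝ => windowFn j p.1.1 :=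
        measurable_windowFn.comp (measurable_id.prodMk measurable_const)
      have h2 : Measurable fun j : ℝ × ℝ => windowFn j p.2.1 :=
        measurable_windowFn.comp (measurable_id.prodMk measurable_const)
      exact (h1.mul h2).aestronglyMeasurable
  rw [integral_integral_swap (f := fun p j => H (p, j)) hHint] at e1
  refine nonneg_of_mul_nonneg_right (b := covForm β₀ γ φ φ) ?_ hC
  rw [e1]
  refine integral_nonneg fun j => ?_
  have hw : Measurable fun s : ℝ => windowFn j s :=
    measurable_windowFn.comp (measurable_const.prodMk measurable_id)
  have h3 : BddSupp B R (fun z : ℝ × Space d => windowFn j z.1 * φ z) := by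
    refine ⟨fun z => ?_, fun z hz => by simp [hφ.2 z hz]⟩
    rw [abs_mul, abs_of_nonneg (windowFn_nonneg _ _)]
    exact (mul_le_of_le_one_left (abs_nonneg _) (windowFn_le_one _ _)).trans (hφ.1 z)
  have h4 := covForm_zero_nonneg hγ h3 (by fun_prop)
  refine h4.trans_eq ?_
  rw [covForm]
  refine integral_congr_ae (Eventually.of_forall fun p => ?_)
  simp only [hH, hg, covKernel_zero]
  ring

end FeynmanKac

namespace FeynmanKac

/-! ### Functions of bounded support as elements of the noise space -/

variable {d : ℕ} {β₀ : ℝ} {γ : Space d → ℝ≥0∞} {γhat : Space d → ℝ}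

lemma covKernel_symm (hγ : IsSpatialCovariance γ γhat) (z w : ℝ × Space d) :
    covKernel β₀ γ z w = covKernel β₀ γ w z := by
  rw [covKernel, covKernel, abs_sub_comm, ← hγ.symm, neg_sub]

lemma covForm_symm (hγ : IsSpatialCovariance γ γhat) (φ ψ : ℝ × Space d → ℝ) :
    covForm β₀ γ φ ψ = covForm β₀ γ ψ φ := by
  unfold covForm
  rw [← integral_prod_swap]
  refine integral_congr_ae (Eventually.of_forall fun p => ?_)
  simp only [Prod.fst_swap, Prod.snd_swap]
  rw [covKernel_symm hγ p.2 p.1]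
  ring

section Bilinear

variable {φ φ' ψ : ℝ × Space d → ℝ} {B B' B'' R R' R'' : ℝ}

lemma integrable_covForm (hβ : β₀ ∈ Ioo (0 : ℝ) 1) (hγ : IsSpatialCovariance γ γhat)
    (hφ : BddSupp B R φ) (hψ : BddSupp B' R' ψ) (hφm : Measurable φ) (hψm : Measurable ψ) :
    Integrable (fun p => φ p.1 * ψ p.2 * (covKernel β₀ γ p.1 p.2).toReal)
      ((halfVolume d).prod (halfVolume d)) :=
  integrable_kernelForm (locIntKernel_covKernel hβ.2 hγ)
    (aestronglyMeasurable_covKernel β₀ hγ.measurable) hφ hψ hφm hψm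

lemma covForm_add_left (hβ : β₀ ∈ Ioo (0 : ℝ) 1) (hγ : IsSpatialCovariance γ γhat)
    (hφ : BddSupp B R φ) (hφ' : BddSupp B' R' φ') (hψ : BddSupp B'' R'' ψ)
    (hφm : Measurable φ) (hφm' : Measurable φ') (hψm : Measurable ψ) :
    covForm β₀ γ (φ + φ') ψ = covForm β₀ γ φ ψ + covForm β₀ γ φ' ψ := by
  unfold covForm
  rw [← integral_add (integrable_covForm hβ hγ hφ hψ hφm hψm)
    (integrable_covForm hβ hγ hφ' hψ hφm' hψm)]
  refine integral_congr_ae (Eventually.of_forall fun p => ?_)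
  simp only [Pi.add_apply]
  ring

lemma covForm_smul_left (c : ℝ) (φ ψ : ℝ × Space d → ℝ) :
    covForm β₀ γ (c • φ) ψ = c * covForm β₀ γ φ ψ := by
  unfold covForm
  rw [← integral_const_mul]
  refine integral_congr_ae (Eventually.of_forall fun p => ?_)
  simp only [Pi.smul_apply, smul_eq_mul]
  ring

end Bilinear

lemma TestSpace.contDiff (φ : TestSpace β₀ γ) : ContDiff ℝ (⊤ : ℕ∞) φ.toFun := φ.2.1

lemma TestSpace.measurable (φ : TestSpace β₀ γ) : Measurable φ.toFun :=
  φ.contDiff.continuous.measurable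

lemma TestSpace.exists_bddSupp (φ : TestSpace β₀ γ) : ∃ B R : ℝ, BddSupp B R φ.toFun :=
  FeynmanKac.exists_bddSupp φ.contDiff.continuous φ.2.2

/-- This is the existence on which `testCore` branches: under the hypotheses its default value, the
zero form, does not occur. -/
lemma exists_testCore (hβ : β₀ ∈ Ioo (0 : ℝ) 1) (hγ : IsSpatialCovariance γ γhat) :
    ∃ c : PreInnerProductSpace.Core ℝ (TestSpace β₀ γ),
      ∀ φ ψ : TestSpace β₀ γ, c.inner φ ψ = covForm β₀ γ φ.toFun ψ.toFun :=
  ⟨{ inner := fun φ ψ => covForm β₀ γ φ.toFun ψ.toFun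
     conj_inner_symm := fun φ ψ => by
       simpa using covForm_symm hγ _ _
     re_inner_nonneg := fun φ => by
       obtain ⟨B, R, h⟩ := φ.exists_bddSupp
       simpa using covForm_nonneg hβ hγ h φ.measurable
     add_left := fun φ φ' ψ => by
       obtain ⟨B, R, h⟩ := φ.exists_bddSupp
       obtain ⟨B', R', h'⟩ := φ'.exists_bddSupp
       obtain ⟨B'', R'', h''⟩ := ψ.exists_bddSupp
       exact covForm_add_left hβ hγ h h' h'' φ.measurable φ'.measurable ψ.measurable
     smul_left := fun φ ψ c => by
       exact covForm_smul_left c φ.toFun ψ.toFun }, fun φ ψ => rfl⟩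

lemma inner_test (hβ : β₀ ∈ Ioo (0 : ℝ) 1) (hγ : IsSpatialCovariance γ γhat)
    (φ ψ : TestSpace β₀ γ) : inner ℝ φ ψ = covForm β₀ γ φ.toFun ψ.toFun := by
  have h := exists_testCore hβ hγ
  have e : testCore β₀ γ = h.choose := dif_pos h
  have := h.choose_spec φ ψ
  rw [← e] at this
  exact this

lemma Represents.unique {φ : ℝ × Space d → ℝ} {h h' : NoiseSpace β₀ γ}
    (H : Represents β₀ γ φ h) (H' : Represents β₀ γ φ h') : h = h' := by
  refine ext_inner_right ℝ fun v => ?_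
  induction v using UniformSpace.Completion.induction_on with
  | hp => exact isClosed_eq (by fun_prop) (by fun_prop)
  | ih ψ => rw [H.inner_eq, H'.inner_eq]

lemma Represents.toNoiseSpace_eq {φ : ℝ × Space d → ℝ} {h : NoiseSpace β₀ γ}
    (H : Represents β₀ γ φ h) : toNoiseSpace β₀ γ φ = h := by
  have hex : InNoiseSpace β₀ γ φ := ⟨h, H⟩
  rw [toNoiseSpace, dif_pos hex]
  exact hex.choose_spec.unique H

lemma absEnergy_lt_top (hβ : β₀ ∈ Ioo (0 : ℝ) 1) (hγ : IsSpatialCovariance γ γhat)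
    {φ : ℝ × Space d → ℝ} {B R : ℝ} (hφ : BddSupp B R φ) : absEnergy β₀ γ φ < ∞ := by
  refine lt_of_le_of_lt (?_ : _ ≤ ∫⁻ p, ENNReal.ofReal B * ENNReal.ofReal B *
    (Metric.closedBall 0 R ×ˢ Metric.closedBall 0 R).indicator
      (fun p => covKernel β₀ γ p.1 p.2) p ∂((halfVolume d).prod (halfVolume d))) ?_
  · refine lintegral_mono fun p => ?_
    dsimp only
    by_cases hp : p ∈ (Metric.closedBall (0 : ℝ × Space d) R ×ˢ Metric.closedBall 0 R)
    · rw [indicator_of_mem hp]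
      gcongr
      · rw [Real.enorm_eq_ofReal_abs]; exact ENNReal.ofReal_le_ofReal (hφ.1 _)
      · rw [Real.enorm_eq_ofReal_abs]; exact ENNReal.ofReal_le_ofReal (hφ.1 _)
    · rw [indicator_of_notMem hp]
      simp only [mem_prod, mem_closedBall_zero_iff, not_and_or, not_le] at hp
      rcases hp with hp | hp
      · simp [hφ.2 _ hp]
      · simp [hφ.2 _ hp]
  · rw [lintegral_const_mul' _ _ (by simp [ENNReal.mul_ne_top]), lintegral_indicator
      (Metric.isClosed_closedBall.measurableSet.prod Metric.isClosed_closedBall.measurableSet)]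
    exact ENNReal.mul_lt_top (by simp [ENNReal.mul_lt_top]) (lintegral_covKernel_lt_top hβ.2 hγ R)

lemma tendsto_covForm (hβ : β₀ ∈ Ioo (0 : ℝ) 1) (hγ : IsSpatialCovariance γ γhat) {B R : ℝ}
    {ι : Type*} {l : Filter ι} [l.IsCountablyGenerated] {φ ψ : ι → ℝ × Space d → ℝ}
    {φ' ψ' : ℝ × Space d → ℝ}
    (hφ : ∀ i, BddSupp B R (φ i)) (hψ : ∀ i, BddSupp B R (ψ i))
    (hφm : ∀ i, Measurable (φ i)) (hψm : ∀ i, Measurable (ψ i))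
    (hφ' : ∀ᵐ x ∂(halfVolume d), Tendsto (fun i => φ i x) l (𝓝 (φ' x)))
    (hψ' : ∀ᵐ x ∂(halfVolume d), Tendsto (fun i => ψ i x) l (𝓝 (ψ' x))) :
    Tendsto (fun i => covForm β₀ γ (φ i) (ψ i)) l (𝓝 (covForm β₀ γ φ' ψ')) :=
  tendsto_kernelForm (locIntKernel_covKernel hβ.2 hγ)
    (aestronglyMeasurable_covKernel β₀ hγ.measurable) hφ hψ hφm hψm hφ' hψ'

/-- A bounded measurable function of bounded support is represented by the limit of test functions
which are uniformly bounded, have a common support, and converge to it almost everywhere. -/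
lemma exists_represents (hβ : β₀ ∈ Ioo (0 : ℝ) 1) (hγ : IsSpatialCovariance γ γhat)
    {φ : ℝ × Space d → ℝ} {B R : ℝ} (hφ : BddSupp B R φ) (hφm : Measurable φ) :
    ∃ (ψ : ℕ → TestSpace β₀ γ) (h : NoiseSpace β₀ γ), Represents β₀ γ φ h ∧
      (∀ n, BddSupp B (R + 1) (ψ n).toFun) ∧
      (∀ᵐ x ∂(halfVolume d), Tendsto (fun n => (ψ n).toFun x) atTop (𝓝 (φ x))) ∧
      Tendsto (fun n => (ψ n : NoiseSpace β₀ γ)) atTop (𝓝 h) := by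
  obtain ⟨f, hfs, hfb, hf⟩ :=
    exists_smooth_approx ((volume : Measure ℝ).prod (volume : Measure (Space d))) hφ hφm
  let ψ : ℕ → TestSpace β₀ γ := fun n => ⟨f n, hfs n, (hfb n).hasCompactSupport⟩
  have hψ : ∀ n, (ψ n).toFun = f n := fun n => rfl
  have hf' : ∀ᵐ x ∂(halfVolume d), Tendsto (fun n => f n x) atTop (𝓝 (φ x)) :=
    Measure.absolutelyContinuous_of_le halfVolume_le hf
  have hfm : ∀ n, Measurable (f n) := fun n => (hfs n).continuous.measurable
  -- The squared distance is the form evaluated at f_m - f_n, which tends to 0 almost everywhere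
  -- with a uniform bound and support as (m, n) → ∞.
  have hcauchy : CauchySeq (fun n => (ψ n : NoiseSpace β₀ γ)) := by
    rw [cauchySeq_iff_tendsto_dist_atTop_0]
    have h1 : ∀ q : ℕ × ℕ, dist (ψ q.1 : NoiseSpace β₀ γ) (ψ q.2 : NoiseSpace β₀ γ) =
        √(covForm β₀ γ (fun x => f q.1 x - f q.2 x) (fun x => f q.1 x - f q.2 x)) := by
      intro q
      rw [UniformSpace.Completion.dist_eq, dist_eq_norm, norm_eq_sqrt_real_inner,
        inner_test hβ hγ]
      rfl
    simp_rw [h1]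
    have h0 : covForm β₀ γ (fun _ => 0) (fun _ => 0) = 0 := by simp [covForm]
    have h2 : ∀ᵐ x ∂(halfVolume d), Tendsto (fun q : ℕ × ℕ => f q.1 x - f q.2 x) atTop
        (𝓝 0) := by
      filter_upwards [hf'] with x hx
      rw [← prod_atTop_atTop_eq, ← sub_self (φ x)]
      exact (hx.comp tendsto_fst).sub (hx.comp tendsto_snd)
    have h3 := tendsto_covForm hβ hγ (l := (atTop : Filter (ℕ × ℕ)))
      (fun q : ℕ × ℕ => (hfb q.1).sub (hfb q.2)) (fun q : ℕ × ℕ => (hfb q.1).sub (hfb q.2))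
      (fun q => (hfm q.1).sub (hfm q.2)) (fun q => (hfm q.1).sub (hfm q.2)) h2 h2
    rw [h0] at h3
    have := (Real.continuous_sqrt.tendsto 0).comp h3
    rw [Real.sqrt_zero] at this
    exact this
  obtain ⟨h, hh⟩ := cauchySeq_tendsto_of_complete hcauchy
  refine ⟨ψ, h, ⟨hφm, absEnergy_lt_top hβ hγ hφ, fun χ => ?_⟩, hfb, hf', hh⟩
  obtain ⟨B', R', hχ⟩ := χ.exists_bddSupp
  have t1 : Tendsto (fun n => inner ℝ (ψ n : NoiseSpace β₀ γ) (χ : NoiseSpace β₀ γ)) atTop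
      (𝓝 (inner ℝ h (χ : NoiseSpace β₀ γ))) := hh.inner tendsto_const_nhds
  have t2 : Tendsto (fun n => covForm β₀ γ (f n) χ.toFun) atTop (𝓝 (covForm β₀ γ φ χ.toFun)) :=
    tendsto_covForm hβ hγ
      (fun n => (hfb n).mono (le_max_left _ _) (le_max_left _ _))
      (fun _ => hχ.mono (le_max_right _ _) (le_max_right _ _)) hfm (fun _ => χ.measurable) hf'
      (Eventually.of_forall fun _ => tendsto_const_nhds)
  refine tendsto_nhds_unique t1 (t2.congr fun n => ?_)
  rw [UniformSpace.Completion.inner_coe, inner_test hβ hγ, hψ]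

lemma inNoiseSpace_of_bddSupp (hβ : β₀ ∈ Ioo (0 : ℝ) 1) (hγ : IsSpatialCovariance γ γhat)
    {φ : ℝ × Space d → ℝ} {B R : ℝ} (hφ : BddSupp B R φ) (hφm : Measurable φ) :
    InNoiseSpace β₀ γ φ := by
  obtain ⟨ψ, h, H, -⟩ := exists_represents hβ hγ hφ hφm
  exact ⟨h, H⟩

/-- `Represents` prescribes only the pairings with test functions. Approximating both arguments by
test functions extends the formula to two represented functions. -/
lemma inner_toNoiseSpace (hβ : β₀ ∈ Ioo (0 : ℝ) 1) (hγ : IsSpatialCovariance γ γhat)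
    {φ φ' : ℝ × Space d → ℝ} {B R B' R' : ℝ} (hφ : BddSupp B R φ) (hφm : Measurable φ)
    (hφ' : BddSupp B' R' φ') (hφm' : Measurable φ') :
    inner ℝ (toNoiseSpace β₀ γ φ) (toNoiseSpace β₀ γ φ') = covForm β₀ γ φ φ' := by
  obtain ⟨ψ, h, H, hψb, hψ, hh⟩ := exists_represents hβ hγ hφ hφm
  obtain ⟨ψ', h', H', hψb', hψ', hh'⟩ := exists_represents hβ hγ hφ' hφm'
  rw [H.toNoiseSpace_eq, H'.toNoiseSpace_eq]
  refine tendsto_nhds_unique (hh.inner hh') ((tendsto_covForm hβ hγ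
    (fun n => (hψb n).mono (le_max_left _ _) (le_max_left _ _))
    (fun n => (hψb' n).mono (le_max_right _ _) (le_max_right _ _)) (fun n => (ψ n).measurable)
    (fun n => (ψ' n).measurable) hψ hψ').congr fun n => ?_)
  rw [UniformSpace.Completion.inner_coe, inner_test hβ hγ]

/-- The squared distance expands into three values of the form, each of which tends to ⟨φ', φ'⟩ or
equals it. -/
lemma tendsto_toNoiseSpace (hβ : β₀ ∈ Ioo (0 : ℝ) 1) (hγ : IsSpatialCovariance γ γhat)
    {B R : ℝ} {ι : Type*} {l : Filter ι} [l.IsCountablyGenerated] {φ : ι → ℝ × Space d → ℝ}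
    {φ' : ℝ × Space d → ℝ} (hφ : ∀ i, BddSupp B R (φ i)) (hφm : ∀ i, Measurable (φ i))
    (hφ' : BddSupp B R φ') (hφm' : Measurable φ')
    (h : ∀ᵐ x ∂(halfVolume d), Tendsto (fun i => φ i x) l (𝓝 (φ' x))) :
    Tendsto (fun i => toNoiseSpace β₀ γ (φ i)) l (𝓝 (toNoiseSpace β₀ γ φ')) := by
  rw [tendsto_iff_norm_sub_tendsto_zero]
  have h1 : ∀ i, ‖toNoiseSpace β₀ γ (φ i) - toNoiseSpace β₀ γ φ'‖ =
      √(covForm β₀ γ (φ i) (φ i) - 2 * covForm β₀ γ (φ i) φ' + covForm β₀ γ φ' φ') := by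
    intro i
    rw [← Real.sqrt_sq (norm_nonneg _), norm_sub_sq_real, ← real_inner_self_eq_norm_sq,
      ← real_inner_self_eq_norm_sq, inner_toNoiseSpace hβ hγ (hφ i) (hφm i) (hφ i) (hφm i),
      inner_toNoiseSpace hβ hγ (hφ i) (hφm i) hφ' hφm',
      inner_toNoiseSpace hβ hγ hφ' hφm' hφ' hφm']
  simp_rw [h1]
  have t1 := tendsto_covForm hβ hγ hφ hφ hφm hφm h h
  have t2 := tendsto_covForm hβ hγ hφ (fun _ => hφ') hφm (fun _ => hφm') h
    (Eventually.of_forall fun _ => tendsto_const_nhds)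
  have t3 := ((t1.sub (t2.const_mul 2)).add_const (covForm β₀ γ φ' φ')).sqrt
  convert t3 using 2
  rw [eq_comm, Real.sqrt_eq_zero']
  linarith

end FeynmanKac

namespace FeynmanKac

/-! ### The mollified kernels along a path -/

variable {d : ℕ} {β₀ : ℝ} {γ : Space d → ℝ≥0∞} {γhat : Space d → ℝ} {p : Space d → ℝ}
  {ε δ ε' δ' t : ℝ} {x : Space d} {path : ℝ≥0 → Space d}

lemma spaceMollifier_nonneg (hp : IsMollifier p) (hε : 0 < ε) (y : Space d) :
    0 ≤ spaceMollifier p ε y := mul_nonneg (by positivity) (hp.nonneg _)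

@[fun_prop]
lemma continuous_spaceMollifier (hp : IsMollifier p) : Continuous (spaceMollifier p ε) := by
  have := hp.smooth.continuous
  unfold spaceMollifier
  fun_prop

lemma exists_bddSupp_spaceMollifier (hp : IsMollifier p) (hε : 0 < ε) :
    ∃ B R : ℝ, BddSupp B R (spaceMollifier p ε) := by
  obtain ⟨B, R, h⟩ := exists_bddSupp hp.smooth.continuous hp.compact
  refine ⟨|(ε ^ d)⁻¹| * B, ε * R, fun y => ?_, fun y hy => ?_⟩
  · rw [spaceMollifier, abs_mul]
    exact mul_le_mul_of_nonneg_left (h.1 _) (abs_nonneg _)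
  · rw [spaceMollifier, h.2, mul_zero]
    rw [norm_smul, norm_inv, Real.norm_of_nonneg hε.le, lt_inv_mul_iff₀ hε]
    exact hy

lemma timeMollifier_nonneg (hδ : 0 < δ) (u : ℝ) : 0 ≤ timeMollifier δ u :=
  indicator_nonneg (fun _ _ => by positivity) _

lemma timeMollifier_le (hδ : 0 < δ) (u : ℝ) : timeMollifier δ u ≤ δ⁻¹ :=
  indicator_le_self' (fun _ _ => by positivity) _

@[fun_prop]
lemma measurable_timeMollifier : Measurable (timeMollifier δ) :=
  measurable_const.indicator measurableSet_Icc

/-- The integrand of the mollified kernel. -/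
def kernelIntegrand (p : Space d → ℝ) (t : ℝ) (x : Space d) (ε δ : ℝ) (path : ℝ≥0 → Space d)
    (z : ℝ × Space d) (s : ℝ) : ℝ :=
  timeMollifier δ (t - s - z.1) * spaceMollifier p ε (path s.toNNReal + x - z.2)

lemma mollifiedKernel_eq (ht : 0 ≤ t) (z : ℝ × Space d) :
    mollifiedKernel p t x ε δ path z =
      (Icc 0 t).indicator (fun _ => ∫ s in Ioc 0 t, kernelIntegrand p t x ε δ path z s) z.1 := by
  unfold mollifiedKernel kernelIntegrand
  by_cases h : z.1 ∈ Icc 0 t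
  · rw [indicator_of_mem h, indicator_of_mem h, intervalIntegral.integral_of_le ht]
  · rw [indicator_of_notMem h, indicator_of_notMem h]

lemma kernelIntegrand_nonneg (hp : IsMollifier p) (hε : 0 < ε) (hδ : 0 < δ) (z : ℝ × Space d)
    (s : ℝ) : 0 ≤ kernelIntegrand p t x ε δ path z s :=
  mul_nonneg (timeMollifier_nonneg hδ _) (spaceMollifier_nonneg hp hε _)

lemma measurable_kernelIntegrand (hp : IsMollifier p) (hpath : Measurable path) :
    Measurable fun q : (ℝ × Space d) × ℝ => kernelIntegrand p t x ε δ path q.1 q.2 := by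
  have h1 := (continuous_spaceMollifier hp (ε := ε)).measurable
  unfold kernelIntegrand
  fun_prop

lemma kernelIntegrand_le (hδ : 0 < δ) {B R : ℝ}
    (hB : BddSupp B R (spaceMollifier p ε)) (z : ℝ × Space d) (s : ℝ) :
    ‖kernelIntegrand p t x ε δ path z s‖ ≤ δ⁻¹ * B := by
  rw [kernelIntegrand, norm_mul, Real.norm_of_nonneg (timeMollifier_nonneg hδ _)]
  exact mul_le_mul (timeMollifier_le hδ _) (hB.1 _) (norm_nonneg _) (by positivity)

lemma integrable_kernelIntegrand (hp : IsMollifier p) (hε : 0 < ε) (hδ : 0 < δ)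
    (hpath : Measurable path) (z : ℝ × Space d) :
    IntegrableOn (kernelIntegrand p t x ε δ path z) (Ioc 0 t) := by
  obtain ⟨B, R, hB⟩ := exists_bddSupp_spaceMollifier hp hε
  refine Measure.integrableOn_of_bounded (M := δ⁻¹ * B) (by simp) ?_
    (Eventually.of_forall fun s => kernelIntegrand_le hδ hB z s)
  exact ((measurable_kernelIntegrand hp hpath).comp
    (measurable_const.prodMk measurable_id)).aestronglyMeasurable

lemma mollifiedKernel_nonneg (hp : IsMollifier p) (ht : 0 ≤ t) (hε : 0 < ε) (hδ : 0 < δ)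
    (z : ℝ × Space d) : 0 ≤ mollifiedKernel p t x ε δ path z := by
  rw [mollifiedKernel_eq ht]
  exact indicator_nonneg (fun _ _ => integral_nonneg fun s => kernelIntegrand_nonneg hp hε hδ z s) _

lemma measurable_mollifiedKernel (hp : IsMollifier p) (ht : 0 ≤ t) (hpath : Measurable path) :
    Measurable (mollifiedKernel p t x ε δ path) := by
  have h : Measurable fun z : ℝ × Space d =>
      ∫ s in Ioc 0 t, kernelIntegrand p t x ε δ path z s :=
    ((measurable_kernelIntegrand hp hpath).stronglyMeasurable.integral_prod_right
      (ν := volume.restrict (Ioc 0 t))).measurable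
  have : mollifiedKernel p t x ε δ path = ((fun z : ℝ × Space d => z.1) ⁻¹' Icc 0 t).indicator
      (fun z => ∫ s in Ioc 0 t, kernelIntegrand p t x ε δ path z s) := by
    ext z
    rw [mollifiedKernel_eq ht]
    by_cases hz : z.1 ∈ Icc 0 t
    · rw [indicator_of_mem hz, indicator_of_mem (by exact hz)]
    · rw [indicator_of_notMem hz, indicator_of_notMem (by exact hz)]
  rw [this]
  exact h.indicator (measurable_fst measurableSet_Icc)

/-- The bound and the support of the mollified kernel are uniform over bounded paths. -/
lemma exists_bddSupp_mollifiedKernel (hp : IsMollifier p) (ht : 0 ≤ t) (hε : 0 < ε) (hδ : 0 < δ)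
    (x : Space d) (b : ℝ) :
    ∃ B R : ℝ, ∀ path : ℝ≥0 → Space d, (∀ s : ℝ≥0, (s : ℝ) ≤ t → ‖path s‖ ≤ b) →
      BddSupp B R (mollifiedKernel p t x ε δ path) := by
  obtain ⟨B, R, hB⟩ := exists_bddSupp_spaceMollifier hp hε
  -- The time coordinate is confined to [0, t]. If p_ε(path s + x - y) ≠ 0, then ‖y‖ ≤ b + ‖x‖ + R,
  -- with R the support radius of p_ε.
  refine ⟨δ⁻¹ * B * (volume (Ioc 0 t)).toReal, max t (b + ‖x‖ + R), fun path hpath =>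
    ⟨fun z => ?_, fun z hz => ?_⟩⟩
  · rw [mollifiedKernel_eq ht]
    have h0 : 0 ≤ δ⁻¹ * B * (volume (Ioc 0 t)).toReal := by
      have := hB.nonneg; positivity
    by_cases hz : z.1 ∈ Icc 0 t
    · rw [indicator_of_mem hz]
      exact norm_setIntegral_le_of_norm_le_const (by simp) fun s _ => kernelIntegrand_le hδ hB z s
    · rw [indicator_of_notMem hz]; simpa using h0
  · rw [mollifiedKernel_eq ht]
    by_cases hz' : z.1 ∈ Icc 0 t
    · rw [indicator_of_mem hz']
      refine integral_eq_zero_of_ae ((ae_restrict_mem measurableSet_Ioc).mono fun s hs => ?_)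
      simp only [kernelIntegrand, Pi.zero_apply]
      rw [hB.2, mul_zero]
      have h1 : max t (b + ‖x‖ + R) < ‖z.2‖ := by
        rw [Prod.norm_def] at hz
        rcases lt_max_iff.1 hz with h | h
        · rw [Real.norm_of_nonneg hz'.1] at h
          exact absurd h (not_lt.2 (hz'.2.trans (le_max_left _ _)))
        · exact h
      have h2 := hpath s.toNNReal (by rw [Real.coe_toNNReal _ hs.1.le]; exact hs.2)
      have h3 : ‖z.2‖ ≤ ‖path s.toNNReal + x‖ + ‖path s.toNNReal + x - z.2‖ := by
        have := norm_sub_le (path s.toNNReal + x) (path s.toNNReal + x - z.2)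
        simpa using this
      have h4 := norm_add_le (path s.toNNReal) x
      linarith [(le_max_right t (b + ‖x‖ + R)).trans_lt h1]
    · rw [indicator_of_notMem hz']

/-- Dominated convergence in s, with constant dominating function. It serves twice: to compare step
paths whose values converge, and to pass from step paths to a càdlàg path. -/
lemma tendsto_mollifiedKernel (hp : IsMollifier p) (ht : 0 ≤ t) (hε : 0 < ε) (hδ : 0 < δ)
    {ι : Type*} {l : Filter ι} [l.IsCountablyGenerated] {paths : ι → ℝ≥0 → Space d}
    (hm : ∀ i, Measurable (paths i))
    (h : ∀ s : ℝ≥0, (s : ℝ) ≤ t → Tendsto (fun i => paths i s) l (𝓝 (path s))) (z : ℝ × Space d) :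
    Tendsto (fun i => mollifiedKernel p t x ε δ (paths i) z) l
      (𝓝 (mollifiedKernel p t x ε δ path z)) := by
  obtain ⟨B, R, hB⟩ := exists_bddSupp_spaceMollifier hp hε
  simp_rw [mollifiedKernel_eq ht]
  by_cases hz : z.1 ∈ Icc 0 t
  · simp_rw [indicator_of_mem hz]
    refine tendsto_integral_filter_of_dominated_convergence (fun _ => δ⁻¹ * B) ?_ ?_ ?_ ?_
    · exact Eventually.of_forall fun i => (integrable_kernelIntegrand hp hε hδ (hm i) z).1
    · exact Eventually.of_forall fun i => Eventually.of_forall fun s =>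
        kernelIntegrand_le hδ hB z s
    · exact integrable_const _
    · refine (ae_restrict_mem measurableSet_Ioc).mono fun s hs => ?_
      have h1 := h s.toNNReal (by rw [Real.coe_toNNReal _ hs.1.le]; exact hs.2)
      have h2 := (continuous_spaceMollifier hp (ε := ε)).tendsto (path s.toNNReal + x - z.2)
      exact (h2.comp ((h1.add_const x).sub_const z.2)).const_mul _
  · simp_rw [indicator_of_notMem hz]
    exact tendsto_const_nhds

lemma inNoiseSpace_mollifiedKernel (hβ : β₀ ∈ Ioo (0 : ℝ) 1) (hγ : IsSpatialCovariance γ γhat)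
    (hp : IsMollifier p) (ht : 0 ≤ t) (hε : 0 < ε) (hδ : 0 < δ) (hpath : Measurable path) {b : ℝ}
    (hb : ∀ s : ℝ≥0, (s : ℝ) ≤ t → ‖path s‖ ≤ b) :
    InNoiseSpace β₀ γ (mollifiedKernel p t x ε δ path) := by
  obtain ⟨B, R, hB⟩ := exists_bddSupp_mollifiedKernel hp ht hε hδ x b
  exact inNoiseSpace_of_bddSupp hβ hγ (hB path hb) (measurable_mollifiedKernel hp ht hpath)

lemma tendsto_toNoiseSpace_mollifiedKernel (hβ : β₀ ∈ Ioo (0 : ℝ) 1)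
    (hγ : IsSpatialCovariance γ γhat) (hp : IsMollifier p) (ht : 0 ≤ t) (hε : 0 < ε) (hδ : 0 < δ)
    {ι : Type*} {l : Filter ι} [l.IsCountablyGenerated] {paths : ι → ℝ≥0 → Space d}
    (hm : ∀ i, Measurable (paths i)) (hpath : Measurable path) {b : ℝ}
    (hbs : ∀ i, ∀ s : ℝ≥0, (s : ℝ) ≤ t → ‖paths i s‖ ≤ b)
    (hb : ∀ s : ℝ≥0, (s : ℝ) ≤ t → ‖path s‖ ≤ b)
    (h : ∀ s : ℝ≥0, (s : ℝ) ≤ t → Tendsto (fun i => paths i s) l (𝓝 (path s))) :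
    Tendsto (fun i => toNoiseSpace β₀ γ (mollifiedKernel p t x ε δ (paths i))) l
      (𝓝 (toNoiseSpace β₀ γ (mollifiedKernel p t x ε δ path))) := by
  obtain ⟨B, R, hB⟩ := exists_bddSupp_mollifiedKernel hp ht hε hδ x b
  exact tendsto_toNoiseSpace hβ hγ (fun i => hB _ (hbs i))
    (fun i => measurable_mollifiedKernel hp ht (hm i)) (hB _ hb)
    (measurable_mollifiedKernel hp ht hpath)
    (Eventually.of_forall fun z => tendsto_mollifiedKernel hp ht hε hδ hm h z)

/-! ### Change of variables -/

/-- The uniform distribution on `[0, 1]`. -/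
def unifMeasure : Measure ℝ := volume.restrict (Icc 0 1)

instance : IsProbabilityMeasure unifMeasure := ⟨by simp [unifMeasure]⟩

/-- The law with density `p`. -/
def densityMeasure (p : Space d → ℝ) : Measure (Space d) :=
  volume.withDensity fun y => ENNReal.ofReal (p y)

instance : SFinite (densityMeasure p) := by unfold densityMeasure; infer_instance

lemma isProbabilityMeasure_densityMeasure (hp : IsMollifier p) :
    IsProbabilityMeasure (densityMeasure p) := by
  refine ⟨?_⟩
  rw [densityMeasure, withDensity_apply _ MeasurableSet.univ, Measure.restrict_univ,
    ← ofReal_integral_eq_lintegral_ofReal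
      (hp.smooth.continuous.integrable_of_hasCompactSupport hp.compact)
      (Eventually.of_forall hp.nonneg), hp.integral_eq, ENNReal.ofReal_one]

lemma lintegral_comp_sub_smul {E : Type*} [NormedAddCommGroup E] [NormedSpace ℝ E]
    [MeasurableSpace E] [BorelSpace E] [FiniteDimensional ℝ E] (μ : Measure E)
    [μ.IsAddHaarMeasure] {F : E → ℝ≥0∞} (hF : Measurable F) {r : ℝ} (hr : 0 < r) (w : E) :
    ∫⁻ b, F (w - r • b) ∂μ =
      ENNReal.ofReal ((r ^ Module.finrank ℝ E)⁻¹) * ∫⁻ y, F y ∂μ := by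
  have h1 : Measurable fun y => F (w - y) := by fun_prop
  have h2 := lintegral_map (μ := μ) h1 (measurable_const_smul r)
  rw [← h2, Measure.map_addHaar_smul μ hr.ne', lintegral_smul_measure, lintegral_sub_left_eq_self,
    abs_of_pos (by positivity), smul_eq_mul]

/-- Substitution y = w - εb, whose Jacobian cancels the factor ε^{-d}. -/
lemma lintegral_spaceMollifier (hp : IsMollifier p) (hε : 0 < ε) {F : Space d → ℝ≥0∞}
    (hF : Measurable F) (w : Space d) :
    ∫⁻ y, ENNReal.ofReal (spaceMollifier p ε (w - y)) * F y =
      ∫⁻ b, F (w - ε • b) ∂(densityMeasure p) := by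
  have hpm := hp.smooth.continuous.measurable
  rw [densityMeasure, lintegral_withDensity_eq_lintegral_mul _ (by fun_prop) (by fun_prop)]
  have h1 : ∀ b, ((fun y => ENNReal.ofReal (p y)) * fun b => F (w - ε • b)) b =
      (fun y => ENNReal.ofReal (p (ε⁻¹ • (w - y))) * F y) (w - ε • b) := by
    intro b
    simp [smul_smul, inv_mul_cancel₀ hε.ne']
  simp_rw [h1]
  rw [lintegral_comp_sub_smul volume (F := fun y => ENNReal.ofReal (p (ε⁻¹ • (w - y))) * F y)
    (by fun_prop) hε w, ← lintegral_const_mul _ (by fun_prop)]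
  refine lintegral_congr fun y => ?_
  rw [spaceMollifier, ENNReal.ofReal_mul (by positivity), mul_assoc]
  simp

/-- Substitution r = c - δa, whose Jacobian cancels the height δ^{-1}. -/
lemma lintegral_timeMollifier (hδ : 0 < δ) {F : ℝ → ℝ≥0∞} (hF : Measurable F) (c : ℝ) :
    ∫⁻ r, ENNReal.ofReal (timeMollifier δ (c - r)) * F r =
      ∫⁻ a, F (c - δ * a) ∂unifMeasure := by
  have hm : Measurable (timeMollifier δ) := measurable_timeMollifier
  rw [unifMeasure, ← lintegral_indicator measurableSet_Icc]
  have h1 : ∀ a, (Icc (0 : ℝ) 1).indicator (fun a => F (c - δ * a)) a =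
      (fun r => ENNReal.ofReal δ * ENNReal.ofReal (timeMollifier δ (c - r)) * F r) (c - δ • a) := by
    intro a
    simp only [smul_eq_mul, sub_sub_cancel, timeMollifier]
    by_cases ha : a ∈ Icc (0 : ℝ) 1
    · rw [indicator_of_mem ha, indicator_of_mem
        (show δ * a ∈ Icc 0 δ from ⟨mul_nonneg hδ.le ha.1, mul_le_of_le_one_right hδ.le ha.2⟩),
        ← ENNReal.ofReal_mul hδ.le, mul_inv_cancel₀ hδ.ne', ENNReal.ofReal_one, one_mul]
    · rw [indicator_of_notMem ha, indicator_of_notMem]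
      · simp
      · rintro ⟨h2, h3⟩
        exact ha ⟨nonneg_of_mul_nonneg_right h2 hδ, by nlinarith⟩
  simp_rw [h1]
  rw [lintegral_comp_sub_smul volume
    (F := fun r => ENNReal.ofReal δ * ENNReal.ofReal (timeMollifier δ (c - r)) * F r)
    (by fun_prop) hδ c, ← lintegral_const_mul _ (by fun_prop)]
  refine lintegral_congr fun y => ?_
  rw [← mul_assoc, ← mul_assoc, ← ENNReal.ofReal_mul (by positivity)]
  simp [inv_mul_cancel₀ hδ.ne']

lemma ofReal_mollifiedKernel (hp : IsMollifier p) (ht : 0 ≤ t) (hε : 0 < ε) (hδ : 0 < δ)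
    (hpath : Measurable path) (z : ℝ × Space d) :
    ENNReal.ofReal (mollifiedKernel p t x ε δ path z) = (Icc 0 t).indicator
      (fun _ => ∫⁻ s in Icc 0 t, ENNReal.ofReal (timeMollifier δ (t - s - z.1)) *
        ENNReal.ofReal (spaceMollifier p ε (path s.toNNReal + x - z.2))) z.1 := by
  rw [mollifiedKernel_eq ht]
  by_cases hz : z.1 ∈ Icc 0 t
  · rw [indicator_of_mem hz, indicator_of_mem hz, ofReal_integral_eq_lintegral_ofReal
      (integrable_kernelIntegrand hp hε hδ hpath z)
      (Eventually.of_forall fun s => kernelIntegrand_nonneg hp hε hδ z s),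
      Measure.restrict_congr_set Ioc_ae_eq_Icc]
    refine lintegral_congr fun s => ?_
    rw [kernelIntegrand, ENNReal.ofReal_mul (timeMollifier_nonneg hδ _)]
  · rw [indicator_of_notMem hz, indicator_of_notMem hz, ENNReal.ofReal_zero]

/-- The mollified kernel as a mixture of point masses. -/
lemma lintegral_mollifiedKernel (hp : IsMollifier p) (ht : 0 ≤ t) (hε : 0 < ε) (hδ : 0 < δ)
    (hpath : Measurable path) {F : ℝ × Space d → ℝ≥0∞} (hF : Measurable F) :
    ∫⁻ z, ENNReal.ofReal (mollifiedKernel p t x ε δ path z) * F z ∂(halfVolume d) =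
      ∫⁻ s in Icc 0 t, ∫⁻ a, (Icc 0 t).indicator (fun r => ∫⁻ b,
        F (r, path s.toNNReal + x - ε • b) ∂(densityMeasure p)) (t - s - δ * a) ∂unifMeasure := by
  have hsm := (continuous_spaceMollifier hp (ε := ε)).measurable
  have htm : Measurable (timeMollifier δ) := measurable_timeMollifier
  simp_rw [ofReal_mollifiedKernel hp ht hε hδ hpath]
  have h1 : ∀ z : ℝ × Space d, (Icc 0 t).indicator
      (fun _ => ∫⁻ s in Icc 0 t, ENNReal.ofReal (timeMollifier δ (t - s - z.1)) *
        ENNReal.ofReal (spaceMollifier p ε (path s.toNNReal + x - z.2))) z.1 * F z =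
      ∫⁻ s in Icc 0 t, (Icc 0 t).indicator (fun _ => (1 : ℝ≥0∞)) z.1 *
        (ENNReal.ofReal (timeMollifier δ (t - s - z.1)) *
        (ENNReal.ofReal (spaceMollifier p ε (path s.toNNReal + x - z.2)) * F z)) := by
    intro z
    rw [lintegral_const_mul _ (by fun_prop)]
    by_cases hz : z.1 ∈ Icc 0 t
    · rw [indicator_of_mem hz, indicator_of_mem hz, one_mul, ← lintegral_mul_const _ (by fun_prop)]
      refine lintegral_congr fun s => ?_
      rw [mul_assoc]
    · rw [indicator_of_notMem hz, indicator_of_notMem hz, zero_mul, zero_mul]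
  simp_rw [h1]
  have hind : Measurable fun r : ℝ => (Icc 0 t).indicator (fun _ => (1 : ℝ≥0∞)) r :=
    measurable_const.indicator measurableSet_Icc
  rw [lintegral_lintegral_swap (by fun_prop)]
  refine lintegral_congr fun s => ?_
  rw [halfVolume, lintegral_prod _ (by fun_prop)]
  have h2 : ∀ r, ∫⁻ y, (Icc 0 t).indicator (fun _ => (1 : ℝ≥0∞)) r *
        (ENNReal.ofReal (timeMollifier δ (t - s - r)) *
        (ENNReal.ofReal (spaceMollifier p ε (path s.toNNReal + x - y)) * F (r, y))) =
      ENNReal.ofReal (timeMollifier δ (t - s - r)) * (Icc 0 t).indicator (fun r => ∫⁻ b,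
        F (r, path s.toNNReal + x - ε • b) ∂(densityMeasure p)) r := by
    intro r
    rw [lintegral_const_mul _ (by fun_prop), lintegral_const_mul _ (by fun_prop),
      lintegral_spaceMollifier hp hε (F := fun y => F (r, y)) (by fun_prop)]
    by_cases hr : r ∈ Icc 0 t
    · rw [indicator_of_mem hr, indicator_of_mem hr, one_mul]
    · rw [indicator_of_notMem hr, indicator_of_notMem hr, zero_mul, mul_zero]
  simp_rw [h2]
  have hG : Measurable ((Icc 0 t).indicator (fun r => ∫⁻ b,
      F (r, path s.toNNReal + x - ε • b) ∂(densityMeasure p))) := by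
    refine Measurable.indicator ?_ measurableSet_Icc
    exact Measurable.lintegral_prod_right' (f := fun q : ℝ × Space d =>
      F (q.1, path s.toNNReal + x - ε • q.2)) (by fun_prop)
  -- The restriction of `halfVolume` to nonnegative times costs nothing, as the indicator already
  -- confines r to [0, t].
  rw [← lintegral_timeMollifier hδ hG, ← lintegral_indicator measurableSet_Ici]
  refine lintegral_congr fun r => ?_
  by_cases hr : r ∈ Ici (0 : ℝ)
  · rw [indicator_of_mem hr]
  · rw [indicator_of_notMem hr, indicator_of_notMem (fun h => hr h.1), mul_zero]

end FeynmanKac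

namespace FeynmanKac

/-! ### The covariance of two mollified kernels -/

variable {d : ℕ} {β₀ : ℝ} {γ : Space d → ℝ≥0∞} {γhat : Space d → ℝ} {p : Space d → ℝ}
  {ε δ ε' δ' t : ℝ} {x : Space d} {path : ℝ≥0 → Space d}

/-- The indicator of `[0, t]`. -/
def cutoff (t r : ℝ) : ℝ≥0∞ := (Icc 0 t).indicator (fun _ => 1) r

@[fun_prop]
lemma measurable_cutoff : Measurable (cutoff t) := measurable_const.indicator measurableSet_Icc

lemma cutoff_le_one (t r : ℝ) : cutoff t r ≤ 1 := indicator_le_self' (fun _ _ => zero_le) _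

/-- The mollified temporal covariance. -/
def timeKernel (β₀ t δ δ' s s' : ℝ) : ℝ≥0∞ :=
  ∫⁻ a, ∫⁻ a', cutoff t (t - s - δ * a) * cutoff t (t - s' - δ' * a') *
    ENNReal.ofReal (|s' - s + δ' * a' - δ * a| ^ (-β₀)) ∂unifMeasure ∂unifMeasure

/-- The mollified spatial covariance. -/
def smoothCov (γ : Space d → ℝ≥0∞) (p : Space d → ℝ) (ε ε' : ℝ) (w : Space d) : ℝ≥0∞ :=
  ∫⁻ b, ∫⁻ b', γ (w + ε' • b' - ε • b) ∂(densityMeasure p) ∂(densityMeasure p)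

lemma measurable_timeKernel :
    Measurable fun q : ℝ × ℝ => timeKernel β₀ t δ δ' q.1 q.2 := by
  unfold timeKernel
  refine Measurable.lintegral_prod_right' (f := fun q : (ℝ × ℝ) × ℝ => ∫⁻ a',
    cutoff t (t - q.1.1 - δ * q.2) * cutoff t (t - q.1.2 - δ' * a') *
    ENNReal.ofReal (|q.1.2 - q.1.1 + δ' * a' - δ * q.2| ^ (-β₀)) ∂unifMeasure) ?_
  exact Measurable.lintegral_prod_right' (f := fun q : ((ℝ × ℝ) × ℝ) × ℝ =>
    cutoff t (t - q.1.1.1 - δ * q.1.2) * cutoff t (t - q.1.1.2 - δ' * q.2) *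
    ENNReal.ofReal (|q.1.1.2 - q.1.1.1 + δ' * q.2 - δ * q.1.2| ^ (-β₀))) (by fun_prop)

lemma measurable_smoothCov (hγ : Measurable γ) : Measurable (smoothCov γ p ε ε') := by
  unfold smoothCov
  refine Measurable.lintegral_prod_right' (f := fun q : Space d × Space d => ∫⁻ b',
    γ (q.1 + ε' • b' - ε • q.2) ∂(densityMeasure p)) ?_
  exact Measurable.lintegral_prod_right' (f := fun q : (Space d × Space d) × Space d =>
    γ (q.1.1 + ε' • q.2 - ε • q.1.2)) (by fun_prop)

lemma ae_covKernel_lt_top (hγ : IsSpatialCovariance γ γhat) :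
    ∀ᵐ q ∂((halfVolume d).prod (halfVolume d)), covKernel β₀ γ q.1 q.2 < ∞ := by
  have hm := hγ.measurable
  have hms : MeasurableSet {q : (ℝ × Space d) × (ℝ × Space d) | covKernel β₀ γ q.1 q.2 < ∞} :=
    measurableSet_lt (measurable_covKernel β₀ hm) measurable_const
  rw [Measure.ae_prod_iff_ae_ae hms]
  refine Eventually.of_forall fun z => ?_
  have h1 : ∀ᵐ y : Space d, γ (z.2 - y) < ∞ :=
    (Measure.measurePreserving_sub_left volume z.2).quasiMeasurePreserving.ae hγ.ae_lt_top
  have h2 : ∀ᵐ w ∂(halfVolume d), γ (z.2 - w.2) < ∞ :=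
    Measure.quasiMeasurePreserving_snd.ae h1
  filter_upwards [h2] with w hw
  exact ENNReal.mul_lt_top ENNReal.ofReal_lt_top hw

/-- From here on the form of nonnegative functions is an iterated integral in [0, ∞], where
exchanging integrals needs only measurability. The `toReal` in the form is undone off the null set
where the kernel is infinite. -/
lemma ofReal_covForm (hβ : β₀ ∈ Ioo (0 : ℝ) 1) (hγ : IsSpatialCovariance γ γhat)
    {φ ψ : ℝ × Space d → ℝ} {B R B' R' : ℝ} (hφ : BddSupp B R φ) (hψ : BddSupp B' R' ψ)
    (hφm : Measurable φ) (hψm : Measurable ψ) (hφ0 : ∀ z, 0 ≤ φ z) (hψ0 : ∀ z, 0 ≤ ψ z) :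
    ENNReal.ofReal (covForm β₀ γ φ ψ) = ∫⁻ z, ENNReal.ofReal (φ z) * ∫⁻ w,
      ENNReal.ofReal (ψ w) * covKernel β₀ γ z w ∂(halfVolume d) ∂(halfVolume d) := by
  have hkm := measurable_covKernel β₀ hγ.measurable
  rw [covForm, ofReal_integral_eq_lintegral_ofReal (integrable_covForm hβ hγ hφ hψ hφm hψm)
    (Eventually.of_forall fun q => mul_nonneg (mul_nonneg (hφ0 _) (hψ0 _)) ENNReal.toReal_nonneg)]
  have h1 : ∫⁻ q, ENNReal.ofReal (φ q.1 * ψ q.2 * (covKernel β₀ γ q.1 q.2).toReal)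
      ∂((halfVolume d).prod (halfVolume d)) = ∫⁻ q, ENNReal.ofReal (φ q.1) *
      (ENNReal.ofReal (ψ q.2) * covKernel β₀ γ q.1 q.2) ∂((halfVolume d).prod (halfVolume d)) := by
    refine lintegral_congr_ae ?_
    filter_upwards [ae_covKernel_lt_top hγ (β₀ := β₀)] with q hq
    rw [ENNReal.ofReal_mul (mul_nonneg (hφ0 _) (hψ0 _)), ENNReal.ofReal_mul (hφ0 _),
      ENNReal.ofReal_toReal hq.ne, mul_assoc]
  have hm1 : Measurable fun q : (ℝ × Space d) × (ℝ × Space d) =>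
      ENNReal.ofReal (ψ q.2) * covKernel β₀ γ q.1 q.2 :=
    (hψm.comp measurable_snd).ennreal_ofReal.mul hkm
  have hm2 : Measurable fun q : (ℝ × Space d) × (ℝ × Space d) => ENNReal.ofReal (φ q.1) *
      (ENNReal.ofReal (ψ q.2) * covKernel β₀ γ q.1 q.2) :=
    (hφm.comp measurable_fst).ennreal_ofReal.mul hm1
  rw [h1, lintegral_prod _ hm2.aemeasurable]
  refine lintegral_congr fun z => ?_
  exact lintegral_const_mul (ENNReal.ofReal (φ z)) (hm1.comp (measurable_prodMk_left (x := z)))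

/-- Tonelli for an integrand that factors, for each s, into a function of the time shifts a, a' and
a function of the space shifts b, b'. This is what splits the inner product of two kernels into
`timeKernel` times `smoothCov`. -/
lemma lintegral_mul_lintegral_swap {α α' τ κ κ' : Type*} [MeasurableSpace α] [MeasurableSpace α']
    [MeasurableSpace τ] [MeasurableSpace κ] [MeasurableSpace κ'] (μ : Measure α) (μ' : Measure α')
    (θ : Measure τ) (ν : Measure κ) (ν' : Measure κ') [SFinite μ] [SFinite μ'] [SFinite θ]
    [SFinite ν] [SFinite ν'] {U : τ → α → α' → ℝ≥0∞} {V : τ → κ → κ' → ℝ≥0∞}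
    (hU : Measurable fun q : (τ × α) × α' => U q.1.1 q.1.2 q.2)
    (hV : Measurable fun q : (τ × κ) × κ' => V q.1.1 q.1.2 q.2) :
    ∫⁻ a, ∫⁻ b, ∫⁻ s, ∫⁻ a', ∫⁻ b', U s a a' * V s b b' ∂ν' ∂μ' ∂θ ∂ν ∂μ =
      ∫⁻ s, (∫⁻ a, ∫⁻ a', U s a a' ∂μ' ∂μ) * ∫⁻ b, ∫⁻ b', V s b b' ∂ν' ∂ν ∂θ := by
  have hU1 : Measurable fun q : τ × α => ∫⁻ a', U q.1 q.2 a' ∂μ' :=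
    Measurable.lintegral_prod_right' (f := fun q : (τ × α) × α' => U q.1.1 q.1.2 q.2) hU
  have hV1 : Measurable fun q : τ × κ => ∫⁻ b', V q.1 q.2 b' ∂ν' :=
    Measurable.lintegral_prod_right' (f := fun q : (τ × κ) × κ' => V q.1.1 q.1.2 q.2) hV
  have hV2 : Measurable fun s => ∫⁻ b, ∫⁻ b', V s b b' ∂ν' ∂ν :=
    Measurable.lintegral_prod_right' (f := fun q : τ × κ => ∫⁻ b', V q.1 q.2 b' ∂ν') hV1
  have e0 : ∀ a b s, ∫⁻ a', ∫⁻ b', U s a a' * V s b b' ∂ν' ∂μ' =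
      (∫⁻ a', U s a a' ∂μ') * ∫⁻ b', V s b b' ∂ν' := by
    intro a b s
    have hUa : Measurable fun a' => U s a a' :=
      hU.comp (f := fun a' => ((s, a), a')) (by fun_prop)
    have hVb : Measurable fun b' => V s b b' :=
      hV.comp (f := fun b' => ((s, b), b')) (by fun_prop)
    rw [← lintegral_mul_const _ hUa]
    exact lintegral_congr fun a' => lintegral_const_mul _ hVb
  simp_rw [e0]
  have e2 : ∀ a, ∫⁻ b, ∫⁻ s, (∫⁻ a', U s a a' ∂μ') * (∫⁻ b', V s b b' ∂ν') ∂θ ∂ν =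
      ∫⁻ s, (∫⁻ a', U s a a' ∂μ') * ∫⁻ b, ∫⁻ b', V s b b' ∂ν' ∂ν ∂θ := by
    intro a
    rw [lintegral_lintegral_swap]
    · refine lintegral_congr fun s => ?_
      rw [lintegral_const_mul]
      exact hV1.comp (f := fun b => (s, b)) (by fun_prop)
    · exact ((hU1.comp (f := fun q : κ × τ => (q.2, a)) (by fun_prop)).mul
        (hV1.comp (f := fun q : κ × τ => (q.2, q.1)) (by fun_prop))).aemeasurable
  simp_rw [e2]
  rw [lintegral_lintegral_swap]
  · refine lintegral_congr fun s => ?_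
    rw [lintegral_mul_const]
    exact hU1.comp (f := fun a => (s, a)) (by fun_prop)
  · exact ((hU1.comp (f := fun q : α × τ => (q.2, q.1)) (by fun_prop)).mul
      (hV2.comp measurable_snd)).aemeasurable

/-- The inner product of two mollified kernels along a path. -/
lemma ofReal_covForm_mollifiedKernel (hβ : β₀ ∈ Ioo (0 : ℝ) 1) (hγ : IsSpatialCovariance γ γhat)
    (hp : IsMollifier p) (ht : 0 ≤ t) (hε : 0 < ε) (hδ : 0 < δ) (hε' : 0 < ε') (hδ' : 0 < δ')
    (hpath : Measurable path) {b₀ : ℝ} (hb : ∀ s : ℝ≥0, (s : ℝ) ≤ t → ‖path s‖ ≤ b₀) :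
    ENNReal.ofReal (covForm β₀ γ (mollifiedKernel p t x ε δ path)
        (mollifiedKernel p t x ε' δ' path)) =
      ∫⁻ s in Icc 0 t, ∫⁻ s' in Icc 0 t, timeKernel β₀ t δ δ' s s' *
        smoothCov γ p ε ε' (path s.toNNReal - path s'.toNNReal) := by
  obtain ⟨B, R, hB⟩ := exists_bddSupp_mollifiedKernel hp ht hε hδ x b₀
  obtain ⟨B', R', hB'⟩ := exists_bddSupp_mollifiedKernel hp ht hε' hδ' x b₀
  have hm := hγ.measurable
  have hkm := measurable_covKernel β₀ hm
  rw [ofReal_covForm hβ hγ (hB path hb) (hB' path hb) (measurable_mollifiedKernel hp ht hpath)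
    (measurable_mollifiedKernel hp ht hpath) (mollifiedKernel_nonneg hp ht hε hδ)
    (mollifiedKernel_nonneg hp ht hε' hδ')]
  have hcut : ∀ (G : ℝ → ℝ≥0∞) r, (Icc 0 t).indicator G r = cutoff t r * G r := by
    intro G r
    by_cases hr : r ∈ Icc 0 t
    · rw [cutoff, indicator_of_mem hr, indicator_of_mem hr, one_mul]
    · rw [cutoff, indicator_of_notMem hr, indicator_of_notMem hr, zero_mul]
  have hcut' : ∀ r, cutoff t r ≠ ∞ := fun r => ((cutoff_le_one t r).trans_lt ENNReal.one_lt_top).ne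
  -- J is the covariance kernel between z and the point (t - s' - δ'a', path s' + x - ε'b') of the
  -- mixture that represents the second mollified kernel, weighted by the time cutoff.
  set J : ℝ × Space d → ℝ → ℝ → Space d → ℝ≥0∞ := fun z s' a' b' =>
    cutoff t (t - s' - δ' * a') * (ENNReal.ofReal (|z.1 - (t - s' - δ' * a')| ^ (-β₀)) *
      γ (z.2 - (path s'.toNNReal + x - ε' • b'))) with hJ
  have h1 : ∀ z : ℝ × Space d, ∫⁻ w, ENNReal.ofReal (mollifiedKernel p t x ε' δ' path w) *
      covKernel β₀ γ z w ∂(halfVolume d) = ∫⁻ s' in Icc 0 t, ∫⁻ a', ∫⁻ b', J z s' a' b'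
        ∂(densityMeasure p) ∂unifMeasure := by
    intro z
    rw [lintegral_mollifiedKernel hp ht hε' hδ' hpath (F := fun w => covKernel β₀ γ z w)
      (hkm.comp (f := fun w => (z, w)) (by fun_prop))]
    refine lintegral_congr fun s' => lintegral_congr fun a' => ?_
    rw [hcut, ← lintegral_const_mul' _ _ (hcut' _)]
    rfl
  simp_rw [h1]
  have h2m : Measurable fun z : ℝ × Space d => ∫⁻ s' in Icc 0 t, ∫⁻ a', ∫⁻ b', J z s' a' b'
        ∂(densityMeasure p) ∂unifMeasure := by
    refine Measurable.lintegral_prod_right' (f := fun q : (ℝ × Space d) × ℝ => ∫⁻ a', ∫⁻ b',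
        J q.1 q.2 a' b' ∂(densityMeasure p) ∂unifMeasure) ?_
    refine Measurable.lintegral_prod_right' (f := fun q : ((ℝ × Space d) × ℝ) × ℝ => ∫⁻ b',
        J q.1.1 q.1.2 q.2 b' ∂(densityMeasure p)) ?_
    refine Measurable.lintegral_prod_right' (f := fun q : (((ℝ × Space d) × ℝ) × ℝ) × Space d =>
        J q.1.1.1 q.1.1.2 q.1.2 q.2) ?_
    simp only [hJ]
    fun_prop
  rw [lintegral_mollifiedKernel hp ht hε hδ hpath h2m]
  refine lintegral_congr fun s => ?_
  refine Eq.trans ?_ (lintegral_mul_lintegral_swap unifMeasure unifMeasure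
    (volume.restrict (Icc 0 t)) (densityMeasure p) (densityMeasure p)
    (U := fun s' a a' => cutoff t (t - s - δ * a) *
      cutoff t (t - s' - δ' * a') * ENNReal.ofReal (|s' - s + δ' * a' - δ * a| ^ (-β₀)))
    (V := fun s' b b' => γ (path s.toNNReal - path s'.toNNReal + ε' • b' - ε • b))
    (by fun_prop) (by fun_prop))
  refine lintegral_congr fun a => ?_
  rw [hcut, ← lintegral_const_mul' _ _ (hcut' _)]
  refine lintegral_congr fun b => ?_
  rw [← lintegral_const_mul' _ _ (hcut' _)]
  refine lintegral_congr fun s' => ?_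
  rw [← lintegral_const_mul' _ _ (hcut' _)]
  refine lintegral_congr fun a' => ?_
  rw [← lintegral_const_mul' _ _ (hcut' _)]
  refine lintegral_congr fun b' => ?_
  simp only [hJ]
  -- The starting point x and the reversal of time cancel in the differences.
  rw [show t - s - δ * a - (t - s' - δ' * a') = s' - s + δ' * a' - δ * a by ring,
    show path s.toNNReal + x - ε • b - (path s'.toNNReal + x - ε' • b') =
      path s.toNNReal - path s'.toNNReal + ε' • b' - ε • b by abel]
  ring

end FeynmanKac

namespace FeynmanKac

/-! ### The potential of a law with respect to the spatial covariance -/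

variable {d : ℕ} {γ : Space d → ℝ≥0∞} {γhat : Space d → ℝ}

/-- The character `e^{-i ξ·y}`. -/
def expNeg (ξ y : Space d) : ℂ := Complex.exp (-(Complex.I * ((inner ℝ ξ y : ℝ) : ℂ)))

lemma continuous_expNeg : Continuous fun q : Space d × Space d => expNeg q.1 q.2 := by
  unfold expNeg; fun_prop

lemma norm_expNeg (ξ y : Space d) : ‖expNeg ξ y‖ = 1 := by
  rw [expNeg, Complex.norm_exp]; simp

instance : SFinite (spectralMeasure γhat) := by unfold spectralMeasure; infer_instance

/-- `(2π)^{-d} ∫ cos(ξ·y) ψ(ξ) μ(dξ)`. -/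
def specPotential (γhat ψ : Space d → ℝ) (y : Space d) : ℝ :=
  ((2 * Real.pi) ^ d)⁻¹ * (∫ ξ, expNeg ξ y * (ψ ξ : ℂ) ∂(spectralMeasure γhat)).re

lemma integrable_expNeg_mul {m : Measure (Space d)} [SFinite m] {ρ : Measure (Space d)}
    [IsFiniteMeasure ρ] {g : Space d → ℂ} (hg : Integrable g m) :
    Integrable (fun q : Space d × Space d => expNeg q.2 q.1 * g q.2) (ρ.prod m) := by
  have h1 : Integrable (fun q : Space d × Space d => g q.2) (ρ.prod m) := hg.comp_snd ρ
  exact h1.bdd_mul (c := 1) (continuous_expNeg.comp continuous_swap).aestronglyMeasurable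
    (Eventually.of_forall fun q => (norm_expNeg _ _).le)

lemma integral_expNeg_swap {m : Measure (Space d)} [SFinite m] {ρ : Measure (Space d)}
    [IsFiniteMeasure ρ] {g : Space d → ℂ} (hg : Integrable g m) :
    ∫ y, ∫ ξ, expNeg ξ y * g ξ ∂m ∂ρ = ∫ ξ, (∫ y, expNeg ξ y ∂ρ) * g ξ ∂m := by
  rw [integral_integral_swap (f := fun y ξ => expNeg ξ y * g ξ) (integrable_expNeg_mul hg)]
  simp_rw [integral_mul_const]

lemma integral_expNeg_eq {ν : Measure (Space d)} {ψ : Space d → ℝ}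
    (hν : ∀ ξ, charFun ν ξ = ψ ξ) (ξ : Space d) : ∫ y, expNeg ξ y ∂ν = ψ ξ := by
  have h1 : ∫ y, expNeg ξ y ∂ν = charFun ν (-ξ) := by
    rw [charFun_apply]
    refine integral_congr_ae (Eventually.of_forall fun y => ?_)
    simp only [expNeg, inner_neg_right, real_inner_comm]
    congr 1
    push_cast
    ring
  rw [h1, charFun_neg, hν, Complex.conj_ofReal]

/-- Up to the dilation ξ ↦ ξ/(2π), this is the Fourier transform of a Schwartz function in the other
normalisation, hence a Schwartz function, hence integrable against a measure of temperate growth. -/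
lemma integrable_fourierHat (hγ : IsSpatialCovariance γ γhat) (φ : 𝓢(Space d, ℂ)) :
    Integrable (fourierHat φ) (spectralMeasure γhat) := by
  have hc : (2 * Real.pi)⁻¹ ≠ 0 := by positivity
  let e : Space d ≃L[ℝ] Space d := ContinuousLinearEquiv.smulLeft (Units.mk0 _ hc)
  let g : 𝓢(Space d, ℂ) := SchwartzMap.compCLMOfContinuousLinearEquiv ℂ e
    (FourierTransform.fourier φ)
  have hg : ⇑g = fourierHat φ := by
    ext ξ
    have h1 : g ξ = FourierTransform.fourier (φ : Space d → ℂ) ((2 * Real.pi)⁻¹ • ξ) := rfl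
    rw [h1, Real.fourier_eq', fourierHat]
    refine integral_congr_ae (Eventually.of_forall fun v => ?_)
    simp only [smul_eq_mul, inner_smul_right]
    congr 2
    rw [real_inner_comm]
    push_cast
    field_simp
  have := hγ.tempered_hat
  rw [← hg]
  exact g.integrable

/-- A compactly supported smooth function as a complex Schwartz function. -/
def testSchwartz {φ : Space d → ℝ} (h : ContDiff ℝ (⊤ : ℕ∞) φ) (hc : HasCompactSupport φ) :
    𝓢(Space d, ℂ) :=
  (hc.comp_left (g := Complex.ofReal) rfl).toSchwartzMap (Complex.ofRealCLM.contDiff.comp h)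

lemma testSchwartz_apply {φ : Space d → ℝ} (h : ContDiff ℝ (⊤ : ℕ∞) φ)
    (hc : HasCompactSupport φ) (y : Space d) : testSchwartz h hc y = φ y := rfl

lemma fourierHat_comp_sub (f : Space d → ℂ) (w ξ : Space d) :
    fourierHat (fun x => f (x - w)) ξ = expNeg ξ w * fourierHat f ξ := by
  unfold fourierHat
  rw [← integral_const_mul, ← integral_add_right_eq_self _ w]
  refine integral_congr_ae (Eventually.of_forall fun y => ?_)
  simp only [add_sub_cancel_right, expNeg]
  rw [← mul_assoc, ← Complex.exp_add]
  congr 2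
  rw [inner_add_right]
  push_cast
  ring

lemma integrable_mul_of_bddSupp (hγ : IsSpatialCovariance γ γhat) {f : Space d → ℝ} {B R : ℝ}
    (hf : BddSupp B R f) (hfm : Measurable f) : Integrable (fun x => (γ x).toReal * f x) := by
  have h1 : IntegrableOn (fun x => (γ x).toReal) (Metric.closedBall 0 R) :=
    integrable_toReal_of_lintegral_ne_top hγ.measurable.aemeasurable
      (hγ.locallyIntegrable _ (isCompact_closedBall _ _)).ne
  have h2 : IntegrableOn (fun x => (γ x).toReal * f x) (Metric.closedBall 0 R) :=
    h1.mul_bdd (c := B) hfm.aestronglyMeasurable (Eventually.of_forall hf.1)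
  refine (integrableOn_iff_integrable_of_support_subset fun x hx => ?_).1 h2
  by_contra h
  exact hx (by simp [hf.2 x (by simpa using h)])

/-- Integrals of `γ` against a translated test function, in Fourier variables. -/
lemma integral_translate (hγ : IsSpatialCovariance γ γhat) {φ : Space d → ℝ}
    (h : ContDiff ℝ (⊤ : ℕ∞) φ) (hc : HasCompactSupport φ) (w : Space d) :
    ((∫ x, (γ x).toReal * φ (x - w) : ℝ) : ℂ) = (((2 * Real.pi) ^ d)⁻¹ : ℝ) *
      ∫ ξ, expNeg ξ w * fourierHat (testSchwartz h hc) ξ ∂(spectralMeasure γhat) := by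
  have h' : ContDiff ℝ (⊤ : ℕ∞) fun x => φ (x - w) := h.comp (contDiff_id.sub contDiff_const)
  have hc' : HasCompactSupport fun x => φ (x - w) :=
    hc.comp_homeomorph (Homeomorph.subRight w)
  have key := hγ.spectral (testSchwartz h' hc')
  rw [← integral_complex_ofReal]
  refine Eq.trans ?_ (key.trans ?_)
  · refine integral_congr_ae (Eventually.of_forall fun x => ?_)
    simp [testSchwartz_apply]
  · congr 1
    refine integral_congr_ae (Eventually.of_forall fun ξ => ?_)
    exact fourierHat_comp_sub (testSchwartz h hc) w ξ

/-- Both sides equal (2π)^{-d} ∫ ψ φ̂ dμ: on the left the character e^{-iξ·w} is averaged over ν and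
gives ψ(ξ), on the right it is integrated against φ and gives φ̂(ξ). -/
lemma integral_translate_law (hγ : IsSpatialCovariance γ γhat) {ν : Measure (Space d)}
    [IsProbabilityMeasure ν] {ψ : Space d → ℝ} (hν : ∀ ξ, charFun ν ξ = ψ ξ)
    (hψ : Integrable ψ (spectralMeasure γhat)) {φ : Space d → ℝ}
    (h : ContDiff ℝ (⊤ : ℕ∞) φ) (hc : HasCompactSupport φ) (hφ0 : ∀ y, 0 ≤ φ y) :
    Integrable (fun w => ∫ x, (γ x).toReal * φ (x - w)) ν ∧
    ∫ w, (∫ x, (γ x).toReal * φ (x - w)) ∂ν = ∫ y, φ y * specPotential γhat ψ y := by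
  set c : ℝ := ((2 * Real.pi) ^ d)⁻¹ with hcdef
  have hφhat := integrable_fourierHat hγ (testSchwartz h hc)
  have hint : Integrable (fun w => ((∫ x, (γ x).toReal * φ (x - w) : ℝ) : ℂ)) ν := by
    simp_rw [integral_translate hγ h hc]
    exact ((integrable_expNeg_mul hφhat).integral_prod_left).const_mul _
  have hreal : Integrable (fun w => ∫ x, (γ x).toReal * φ (x - w)) ν := by
    have := hint.re
    simpa using this
  refine ⟨hreal, ?_⟩
  have e1 : ((∫ w, (∫ x, (γ x).toReal * φ (x - w)) ∂ν : ℝ) : ℂ) =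
      c * ∫ ξ, (ψ ξ : ℂ) * fourierHat (testSchwartz h hc) ξ ∂(spectralMeasure γhat) := by
    rw [← integral_complex_ofReal]
    simp_rw [integral_translate hγ h hc]
    rw [integral_const_mul, integral_expNeg_swap hφhat]
    simp_rw [integral_expNeg_eq hν]
    rfl
  -- As a finite measure, φ(y) dy can be treated by the same exchange of integrals as ν.
  set ρ : Measure (Space d) := volume.withDensity fun y => ENNReal.ofReal (φ y) with hρ
  have hφi : Integrable φ := h.continuous.integrable_of_hasCompactSupport hc
  have hfin : IsFiniteMeasure ρ := isFiniteMeasure_withDensity_ofReal hφi.2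
  have hρint : ∀ f : Space d → ℂ, ∫ y, f y ∂ρ = ∫ y, (φ y : ℂ) * f y := by
    intro f
    rw [hρ, integral_withDensity_eq_integral_toReal_smul (by have := h.continuous.measurable; fun_prop)
      (Eventually.of_forall fun _ => ENNReal.ofReal_lt_top)]
    refine integral_congr_ae (Eventually.of_forall fun y => ?_)
    simp [ENNReal.toReal_ofReal (hφ0 y)]
  have e2 : ∫ y, (φ y : ℂ) * ∫ ξ, expNeg ξ y * (ψ ξ : ℂ) ∂(spectralMeasure γhat) =
      ∫ ξ, (ψ ξ : ℂ) * fourierHat (testSchwartz h hc) ξ ∂(spectralMeasure γhat) := by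
    rw [← hρint, integral_expNeg_swap (g := fun ξ => (ψ ξ : ℂ)) hψ.ofReal]
    refine integral_congr_ae (Eventually.of_forall fun ξ => ?_)
    simp only
    rw [hρint, mul_comm]
    congr 1
    refine integral_congr_ae (Eventually.of_forall fun y => ?_)
    simp only [testSchwartz_apply, expNeg]
    ring
  have hint2 : Integrable (fun y => (φ y : ℂ) *
      ∫ ξ, expNeg ξ y * (ψ ξ : ℂ) ∂(spectralMeasure γhat)) := by
    have h3 : Integrable (fun y => ∫ ξ, expNeg ξ y * (ψ ξ : ℂ) ∂(spectralMeasure γhat)) ρ :=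
      (integrable_expNeg_mul hψ.ofReal).integral_prod_left
    rw [hρ, integrable_withDensity_iff_integrable_smul' (by have := h.continuous.measurable; fun_prop)
      (Eventually.of_forall fun _ => ENNReal.ofReal_lt_top)] at h3
    refine h3.congr (Eventually.of_forall fun y => ?_)
    simp [ENNReal.toReal_ofReal (hφ0 y)]
  have e3 : ∫ y, φ y * specPotential γhat ψ y = c * (∫ y, (φ y : ℂ) *
      ∫ ξ, expNeg ξ y * (ψ ξ : ℂ) ∂(spectralMeasure γhat)).re := by
    have h4 := integral_re hint2
    simp only [RCLike.re_eq_complex_re] at h4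
    rw [← h4, ← integral_const_mul]
    refine integral_congr_ae (Eventually.of_forall fun y => ?_)
    simp only [specPotential, Complex.re_ofReal_mul]
    ring
  rw [e3, e2, ← Complex.re_ofReal_mul, ← e1, Complex.ofReal_re]

/-- Passing to integrals in [0, ∞] allows the potential to be integrated before it is known to be
finite anywhere. -/
lemma lintegral_translate_law (hγ : IsSpatialCovariance γ γhat) {ν : Measure (Space d)}
    [IsProbabilityMeasure ν] {ψ : Space d → ℝ} (hν : ∀ ξ, charFun ν ξ = ψ ξ)
    (hψ : Integrable ψ (spectralMeasure γhat)) {φ : Space d → ℝ}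
    (h : ContDiff ℝ (⊤ : ℕ∞) φ) (hc : HasCompactSupport φ) (hφ0 : ∀ y, 0 ≤ φ y) :
    0 ≤ ∫ y, φ y * specPotential γhat ψ y ∧
    ∫⁻ y, ENNReal.ofReal (φ y) * ∫⁻ w, γ (y + w) ∂ν =
      ENNReal.ofReal (∫ y, φ y * specPotential γhat ψ y) := by
  have hm := hγ.measurable
  have hφm := h.continuous.measurable
  obtain ⟨h1, h2⟩ := integral_translate_law hγ hν hψ h hc hφ0
  have h0 : ∀ w, 0 ≤ ∫ x, (γ x).toReal * φ (x - w) := fun w =>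
    integral_nonneg fun x => mul_nonneg ENNReal.toReal_nonneg (hφ0 _)
  refine ⟨h2 ▸ integral_nonneg h0, ?_⟩
  rw [← h2, ofReal_integral_eq_lintegral_ofReal h1 (Eventually.of_forall h0)]
  have h3 : ∀ y, ENNReal.ofReal (φ y) * ∫⁻ w, γ (y + w) ∂ν =
      ∫⁻ w, ENNReal.ofReal (φ y) * γ (y + w) ∂ν := fun y => by
    rw [lintegral_const_mul _ (by fun_prop)]
  simp_rw [h3]
  rw [lintegral_lintegral_swap (by fun_prop)]
  refine lintegral_congr fun w => ?_
  have h' : Continuous fun x => φ (x - w) := h.continuous.comp (by fun_prop)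
  have hc' : HasCompactSupport fun x => φ (x - w) := hc.comp_homeomorph (Homeomorph.subRight w)
  obtain ⟨B, R, hBR⟩ := exists_bddSupp h' hc'
  rw [ofReal_integral_eq_lintegral_ofReal (integrable_mul_of_bddSupp hγ hBR h'.measurable)
    (Eventually.of_forall fun x => mul_nonneg ENNReal.toReal_nonneg (hφ0 _)),
    ← lintegral_sub_right_eq_self (fun y => ENNReal.ofReal (φ y) * γ (y + w)) w]
  refine lintegral_congr_ae ?_
  filter_upwards [hγ.ae_lt_top] with x hx
  rw [sub_add_cancel, ENNReal.ofReal_mul ENNReal.toReal_nonneg, ENNReal.ofReal_toReal hx.ne,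
    mul_comm]

lemma continuous_specPotential {ψ : Space d → ℝ} (hψ : Integrable ψ (spectralMeasure γhat)) :
    Continuous (specPotential γhat ψ) := by
  unfold specPotential
  refine continuous_const.mul (Complex.continuous_re.comp ?_)
  refine continuous_of_dominated (bound := fun ξ => ‖ψ ξ‖) ?_ ?_ hψ.norm ?_
  · intro y
    exact (continuous_expNeg.comp (continuous_id.prodMk continuous_const)).aestronglyMeasurable.mul
      hψ.ofReal.1
  · intro y
    exact Eventually.of_forall fun ξ => by simp [norm_expNeg]
  · exact Eventually.of_forall fun ξ => (continuous_expNeg.comp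
      (continuous_const.prodMk continuous_id)).mul continuous_const

lemma specPotential_zero (ψ : Space d → ℝ) : specPotential γhat ψ 0 =
    ((2 * Real.pi) ^ d)⁻¹ * ∫ ξ, ψ ξ ∂(spectralMeasure γhat) := by
  simp only [specPotential, expNeg, inner_zero_right, Complex.ofReal_zero, mul_zero, neg_zero,
    Complex.exp_zero, one_mul, integral_complex_ofReal, Complex.ofReal_re]

/-- The modulus of the Fourier integral is at most the integral of ψ ≥ 0. Hence averaging over
mollifier shifts never exceeds the unmollified value, which is the source of the dominating
functions for the means. -/
lemma specPotential_le {ψ : Space d → ℝ} (hψ : ∀ ξ, 0 ≤ ψ ξ) (y : Space d) :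
    |specPotential γhat ψ y| ≤ specPotential γhat ψ 0 := by
  rw [specPotential_zero, specPotential, abs_mul, abs_of_pos (by positivity)]
  gcongr
  refine (Complex.abs_re_le_norm _).trans ((norm_integral_le_integral_norm _).trans_eq ?_)
  refine integral_congr_ae (Eventually.of_forall fun ξ => ?_)
  simp [norm_expNeg, abs_of_nonneg (hψ ξ)]

/-- The potential `y ↦ ∫ γ(y + w) ν(dw)` agrees almost everywhere with its continuous version
`specPotential γhat ψ`. -/
lemma potential_ae_eq (hγ : IsSpatialCovariance γ γhat) {ν : Measure (Space d)}
    [IsProbabilityMeasure ν] {ψ : Space d → ℝ} (hν : ∀ ξ, charFun ν ξ = ψ ξ)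
    (hψ : Integrable ψ (spectralMeasure γhat)) :
    ∀ᵐ y, 0 ≤ specPotential γhat ψ y ∧
      ∫⁻ w, γ (y + w) ∂ν = ENNReal.ofReal (specPotential γhat ψ y) := by
  have hm := hγ.measurable
  set G : Space d → ℝ≥0∞ := fun y => ∫⁻ w, γ (y + w) ∂ν with hG
  have hGm : Measurable G :=
    Measurable.lintegral_prod_right' (f := fun q : Space d × Space d => γ (q.1 + q.2)) (by fun_prop)
  set F := specPotential γhat ψ with hF
  have hFc : Continuous F := continuous_specPotential hψ
  let χ : ℕ → ContDiffBump (0 : Space d) := fun n => ⟨n + 1, n + 2, by positivity, by linarith⟩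
  have hχ1 : ∀ n : ℕ, ∀ y ∈ Metric.closedBall (0 : Space d) (n + 1), χ n y = 1 := fun n y hy =>
    (χ n).one_of_mem_closedBall hy
  have hχs : ∀ n, ContDiff ℝ (⊤ : ℕ∞) (χ n) := fun n => (χ n).contDiff
  have hloc : ∀ n : ℕ, ∫⁻ y in Metric.closedBall (0 : Space d) (n + 1), G y < ∞ := by
    intro n
    have h1 := (lintegral_translate_law hγ hν hψ (hχs n) (χ n).hasCompactSupport
      (fun y => (χ n).nonneg)).2
    refine lt_of_le_of_lt ?_ (h1.trans_lt ENNReal.ofReal_lt_top)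
    rw [← lintegral_indicator Metric.isClosed_closedBall.measurableSet]
    refine lintegral_mono fun y => ?_
    by_cases hy : y ∈ Metric.closedBall (0 : Space d) (n + 1)
    · simp [indicator_of_mem hy, hχ1 n y hy, hG]
    · rw [indicator_of_notMem hy]; exact zero_le
  have hlt : ∀ᵐ y, G y < ∞ := by
    have h : ∀ n : ℕ, ∀ᵐ x ∂(volume.restrict (Metric.closedBall (0 : Space d) n)), G x < ∞ := by
      intro n
      refine MeasureTheory.ae_lt_top hGm (lt_of_le_of_lt (lintegral_mono_set
        (Metric.closedBall_subset_closedBall (by linarith))) (hloc n)).ne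
    rw [← Measure.restrict_univ (μ := (volume : Measure (Space d))),
      ← Metric.iUnion_closedBall_nat (0 : Space d)]
    exact (ae_restrict_iUnion_iff _ _).2 h
  have hGloc : LocallyIntegrable (fun y => (G y).toReal) := by
    rw [locallyIntegrable_iff]
    intro K hK
    obtain ⟨R, hR⟩ := hK.isBounded.subset_closedBall (0 : Space d)
    obtain ⟨n, hn⟩ := exists_nat_ge R
    have h1 : IntegrableOn (fun y => (G y).toReal) (Metric.closedBall (0 : Space d) (n + 1)) :=
      integrable_toReal_of_lintegral_ne_top hGm.aemeasurable (hloc n).ne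
    exact h1.mono_set (hR.trans (Metric.closedBall_subset_closedBall (by linarith)))
  have hpos : ∀ g : Space d → ℝ, ContDiff ℝ (⊤ : ℕ∞) g → HasCompactSupport g → (∀ y, 0 ≤ g y) →
      ∫ y, g y • (G y).toReal = ∫ y, g y • F y := by
    intro g hg hgc hg0
    obtain ⟨h1, h2⟩ := lintegral_translate_law hγ hν hψ hg hgc hg0
    simp only [smul_eq_mul]
    rw [integral_eq_lintegral_of_nonneg_ae
      (Eventually.of_forall fun y => mul_nonneg (hg0 y) ENNReal.toReal_nonneg)
      (hg.continuous.aestronglyMeasurable.mul hGm.ennreal_toReal.aestronglyMeasurable)]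
    rw [← ENNReal.toReal_ofReal h1, ← h2]
    congr 1
    refine lintegral_congr_ae ?_
    filter_upwards [hlt] with y hy
    rw [ENNReal.ofReal_mul (hg0 y), ENNReal.ofReal_toReal hy.ne]
  have key : ∀ᵐ y, (G y).toReal = F y := by
    refine ae_eq_of_integral_contDiff_smul_eq hGloc hFc.locallyIntegrable fun g hg hgc => ?_
    obtain ⟨B, R, hBR⟩ := exists_bddSupp hg.continuous hgc
    obtain ⟨n, hn⟩ := exists_nat_ge R
    have hB := hBR.nonneg
    -- A signed g is the difference of the nonnegative test functions g + Bχ_n and Bχ_n, because |g|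
    -- ≤ B and χ_n = 1 on the support of g.
    have hu : ContDiff ℝ (⊤ : ℕ∞) fun y => B * χ n y := contDiff_const.mul (hχs n)
    have huc : HasCompactSupport fun y => B * χ n y := (χ n).hasCompactSupport.mul_left
    have hu0 : ∀ y, 0 ≤ B * χ n y := fun y => mul_nonneg hB (χ n).nonneg
    have hv0 : ∀ y, 0 ≤ g y + B * χ n y := by
      intro y
      by_cases hy : y ∈ Metric.closedBall (0 : Space d) (n + 1)
      · rw [hχ1 n y hy]
        linarith [neg_le_of_abs_le (hBR.1 y)]
      · rw [hBR.2 y]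
        · linarith [hu0 y]
        · simp only [mem_closedBall_zero_iff, not_le] at hy
          linarith
    have e1 := hpos _ hu huc hu0
    have e2 := hpos _ (hg.add hu) (hgc.add huc) hv0
    have hi : ∀ (f : Space d → ℝ), LocallyIntegrable f → ∀ u : Space d → ℝ, Continuous u →
        HasCompactSupport u → Integrable (fun y => u y • f y) := fun f hf u hu huc =>
      hf.integrable_smul_left_of_hasCompactSupport hu huc
    simp only [add_smul] at e2
    rw [integral_add (hi _ hGloc g hg.continuous hgc) (hi _ hGloc _ hu.continuous huc),
      integral_add (hi _ hFc.locallyIntegrable g hg.continuous hgc)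
      (hi _ hFc.locallyIntegrable _ hu.continuous huc), e1] at e2
    exact add_right_cancel e2
  filter_upwards [key, hlt] with y hy hy'
  rw [← hy, ENNReal.ofReal_toReal hy'.ne]
  exact ⟨ENNReal.toReal_nonneg, rfl⟩

/-- The energy of a law which is the convolution square of an absolutely continuous law. -/
lemma lintegral_conv_self (hγ : IsSpatialCovariance γ γhat) {ν : Measure (Space d)}
    [IsProbabilityMeasure ν] (hac : ν ≪ volume) {ψ : Space d → ℝ} (hν : ∀ ξ, charFun ν ξ = ψ ξ)
    (hψ : Integrable ψ (spectralMeasure γhat)) :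
    ∫⁻ y, γ y ∂(ν.conv ν) = ENNReal.ofReal (specPotential γhat (fun ξ => ψ ξ ^ 2) 0) := by
  have hm := hγ.measurable
  have h1 := potential_ae_eq hγ hν hψ
  -- Absolute continuity of ν is essential here, since the potential is identified only up to
  -- Lebesgue null sets.
  have h1' : ∀ᵐ y ∂ν, _ := hac.ae_le h1
  rw [Measure.lintegral_conv hm, lintegral_congr_ae (h1'.mono fun y hy => hy.2)]
  have hi : Integrable (fun y => ∫ ξ, expNeg ξ y * (ψ ξ : ℂ) ∂(spectralMeasure γhat)) ν :=
    (integrable_expNeg_mul (g := fun ξ => (ψ ξ : ℂ)) hψ.ofReal).integral_prod_left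
  have hi' : Integrable (specPotential γhat ψ) ν := hi.re.const_mul _
  rw [← ofReal_integral_eq_lintegral_ofReal hi' (h1'.mono fun y hy => hy.1), specPotential_zero]
  congr 1
  unfold specPotential
  have h4 := integral_re hi
  simp only [RCLike.re_eq_complex_re] at h4
  rw [integral_const_mul, h4, integral_expNeg_swap (g := fun ξ => (ψ ξ : ℂ)) hψ.ofReal]
  simp_rw [integral_expNeg_eq hν]
  congr 1
  rw [← Complex.ofReal_re (∫ ξ, ψ ξ ^ 2 ∂(spectralMeasure γhat)), ← integral_complex_ofReal]
  congr 2
  ext ξ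
  push_cast
  ring

end FeynmanKac

namespace FeynmanKac

/-! ### Laws of the increments of the Lévy process -/

variable {Ω : Type*} [MeasurableSpace Ω] {P : Measure Ω}
  {d : ℕ} {β₀ : ℝ} {γ : Space d → ℝ≥0∞} {γhat : Space d → ℝ} {p : Space d → ℝ}
  {X : ℝ≥0 → Ω → Space d} {Ψ : Space d → ℝ}

lemma charFun_law (hΨ : IsCharExponent X P Ψ) (u : ℝ≥0) (ξ : Space d) :
    charFun (P.map (X u)) ξ = (Real.exp (-((u : ℝ) * Ψ ξ)) : ℝ) := by
  rw [hΨ u ξ]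
  push_cast
  rfl

/-- Stationarity treats ordered times; the opposite order is reduced to it by the symmetry of the
law. -/
lemma map_increment (hX : IsSymmetricLevy X P) (s s' : ℝ≥0) :
    P.map (fun ω => X s ω - X s' ω) = P.map (X (nndist s s')) := by
  have key : ∀ a b : ℝ≥0, a ≤ b → P.map (fun ω => X b ω - X a ω) = P.map (X (b - a)) := by
    intro a b hab
    have := hX.stationary a (b - a)
    rwa [add_tsub_cancel_of_le hab] at this
  have hd : ∀ a b : ℝ≥0, a ≤ b → nndist b a = b - a := by
    intro a b hab
    rw [NNReal.nndist_eq, tsub_eq_zero_of_le hab, max_eq_left zero_le]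
  rcases le_total s' s with h | h
  · rw [key _ _ h, hd _ _ h]
  · rw [nndist_comm, hd _ _ h, ← hX.symm]
    have h1 := key _ _ h
    have h2 : P.map (fun ω => X s ω - X s' ω) =
        (P.map (fun ω => X s' ω - X s ω)).map (fun y => -y) := by
      rw [Measure.map_map (g := fun y : Space d => -y) (f := fun ω => X s' ω - X s ω)
        measurable_neg ((hX.measurable _).sub (hX.measurable _))]
      congr 1
      ext1 ω
      simp
    rw [h2, h1, Measure.map_map measurable_neg (hX.measurable _)]
    rfl

variable [IsProbabilityMeasure P]

lemma IsCharExponent.nonneg (hX : IsSymmetricLevy X P) (hΨ : IsCharExponent X P Ψ) (ξ : Space d) :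
    0 ≤ Ψ ξ := by
  have : IsProbabilityMeasure (P.map (X 1)) :=
    Measure.isProbabilityMeasure_map (hX.measurable 1).aemeasurable
  have h1 := norm_charFun_le_one (μ := P.map (X 1)) ξ
  rw [hΨ 1 ξ, Complex.norm_exp] at h1
  simpa using h1

lemma IsCharExponent.measurable (hX : IsSymmetricLevy X P) (hΨ : IsCharExponent X P Ψ) :
    Measurable Ψ := by
  have : IsProbabilityMeasure (P.map (X 1)) :=
    Measure.isProbabilityMeasure_map (hX.measurable 1).aemeasurable
  have h1 : Ψ = fun ξ => -Real.log ‖charFun (P.map (X 1)) ξ‖ := by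
    ext ξ
    rw [hΨ 1 ξ, Complex.norm_exp]
    simp
  have h2 : Measurable (charFun (P.map (X 1))) := measurable_charFun
  rw [h1]
  fun_prop

/-- As ψ^θ ≤ 1 + ψ, it suffices that 2 + ψ ≤ (2 + 1/u)(1 + uψ) ≤ (2 + 1/u) e^{uψ}. With θ = 1 - β₀
this makes e^{-uΨ} integrable against the spectral measure for every u > 0. -/
lemma one_add_rpow_mul_exp_le {θ u ψ : ℝ} (hθ : θ ∈ Ioo (0 : ℝ) 1) (hu : 0 < u) (hψ : 0 ≤ ψ) :
    Real.exp (-(u * ψ)) ≤ (2 + 1 / u) * (1 / (1 + ψ ^ θ)) := by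
  have h1 : ψ ^ θ ≤ 1 + ψ := by
    rcases le_total ψ 1 with h | h
    · have := Real.rpow_le_one hψ h hθ.1.le
      linarith
    · have := Real.rpow_le_rpow_of_exponent_le h hθ.2.le
      rw [Real.rpow_one] at this
      linarith
  have h0 : 0 ≤ ψ ^ θ := Real.rpow_nonneg hψ _
  rw [mul_one_div, le_div_iff₀ (by linarith), Real.exp_neg, inv_mul_le_iff₀ (Real.exp_pos _)]
  have h2 := Real.add_one_le_exp (u * ψ)
  have h3 : 0 ≤ u * ψ := by positivity
  have h5 : 0 < 1 / u := by positivity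
  calc 1 + ψ ^ θ ≤ 2 + ψ := by linarith
    _ ≤ (u * ψ + 1) * (2 + 1 / u) := by
        have : u * ψ * (1 / u) = ψ := by field_simp
        nlinarith
    _ ≤ _ := by gcongr

lemma integrable_exp_exponent (hβ : β₀ ∈ Ioo (0 : ℝ) 1) (hX : IsSymmetricLevy X P)
    (hΨ : IsCharExponent X P Ψ) (hI : HypothesisI β₀ Ψ γhat) {u : ℝ} (hu : 0 < u) :
    Integrable (fun ξ => Real.exp (-(u * Ψ ξ))) (spectralMeasure γhat) := by
  have hm := hΨ.measurable hX
  have h1 : Integrable (fun ξ => 1 / (1 + Ψ ξ ^ (1 - β₀))) (spectralMeasure γhat) := by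
    refine ⟨Measurable.aestronglyMeasurable (by fun_prop), ?_⟩
    rw [hasFiniteIntegral_iff_ofReal (Eventually.of_forall fun ξ => ?_)]
    · exact hI
    · have := Real.rpow_nonneg (hΨ.nonneg hX ξ) (1 - β₀)
      simp only [Pi.zero_apply]
      positivity
  refine (h1.const_mul (2 + 1 / u)).mono' (by fun_prop) (Eventually.of_forall fun ξ => ?_)
  rw [Real.norm_of_nonneg (Real.exp_pos _).le]
  exact one_add_rpow_mul_exp_le ⟨by linarith [hβ.2], by linarith [hβ.1]⟩ hu (hΨ.nonneg hX ξ)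

/-- The continuous version of the potential of the law of `X_u`. -/
def levyPotential (γhat Ψ : Space d → ℝ) (u : ℝ) : Space d → ℝ :=
  specPotential γhat fun ξ => Real.exp (-(u * Ψ ξ))

lemma law_potential_ae_eq (hβ : β₀ ∈ Ioo (0 : ℝ) 1) (hγ : IsSpatialCovariance γ γhat)
    (hX : IsSymmetricLevy X P) (hΨ : IsCharExponent X P Ψ) (hI : HypothesisI β₀ Ψ γhat)
    {u : ℝ≥0} (hu : 0 < u) :
    ∀ᵐ y, ∫⁻ w, γ (y + w) ∂(P.map (X u)) = ENNReal.ofReal (levyPotential γhat Ψ u y) := by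
  have : IsProbabilityMeasure (P.map (X u)) :=
    Measure.isProbabilityMeasure_map (hX.measurable u).aemeasurable
  exact (potential_ae_eq hγ (charFun_law hΨ u)
    (integrable_exp_exponent hβ hX hΨ hI (NNReal.coe_pos.2 hu))).mono fun y hy => hy.2

/-- The almost everywhere identity for the potential is void at the single point y = 0. Splitting
X_u into two independent copies of X_{u/2}, one of which plays the role of y and has a density,
determines the value there. -/
lemma lintegral_law (hβ : β₀ ∈ Ioo (0 : ℝ) 1) (hγ : IsSpatialCovariance γ γhat)
    (hX : IsSymmetricLevy X P) (hΨ : IsCharExponent X P Ψ) (hI : HypothesisI β₀ Ψ γhat)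
    {u : ℝ≥0} (hu : 0 < u) :
    ∫⁻ y, γ y ∂(P.map (X u)) = ENNReal.ofReal (levyPotential γhat Ψ u 0) := by
  have hpr : ∀ v : ℝ≥0, IsProbabilityMeasure (P.map (X v)) := fun v =>
    Measure.isProbabilityMeasure_map (hX.measurable v).aemeasurable
  have hu2 : 0 < u / 2 := by positivity
  have := hpr u
  have := hpr (u / 2)
  have hconv : P.map (X u) = (P.map (X (u / 2))).conv (P.map (X (u / 2))) := by
    refine Measure.ext_of_charFun ?_
    ext ξ
    rw [charFun_conv, hΨ, hΨ, ← Complex.exp_add]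
    congr 1
    push_cast
    ring
  rw [hconv, lintegral_conv_self hγ (hX.density _ hu2) (charFun_law hΨ (u / 2))
    (integrable_exp_exponent hβ hX hΨ hI (NNReal.coe_pos.2 hu2)), levyPotential]
  congr 2
  ext ξ
  rw [← Real.exp_nat_mul]
  congr 1
  push_cast
  ring

lemma levyPotential_le (u : ℝ) (y : Space d) :
    levyPotential γhat Ψ u y ≤ levyPotential γhat Ψ u 0 :=
  (le_abs_self _).trans (specPotential_le (fun _ => (Real.exp_pos _).le) y)

/-- Mean of the mollified spatial covariance, in terms of the potential. -/
lemma lintegral_smoothCov (hβ : β₀ ∈ Ioo (0 : ℝ) 1) (hγ : IsSpatialCovariance γ γhat)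
    (hX : IsSymmetricLevy X P) (hΨ : IsCharExponent X P Ψ) (hI : HypothesisI β₀ Ψ γhat)
    {u : ℝ≥0} (hu : 0 < u) (ε : ℝ) {ε' : ℝ} (hε' : 0 < ε') :
    ∫⁻ w, smoothCov γ p ε ε' w ∂(P.map (X u)) = ∫⁻ b, ∫⁻ b',
      ENNReal.ofReal (levyPotential γhat Ψ u (ε' • b' - ε • b)) ∂(densityMeasure p)
        ∂(densityMeasure p) := by
  have hm := hγ.measurable
  have : IsProbabilityMeasure (P.map (X u)) :=
    Measure.isProbabilityMeasure_map (hX.measurable u).aemeasurable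
  unfold smoothCov
  rw [lintegral_lintegral_swap]
  swap
  · exact (Measurable.lintegral_prod_right' (f := fun q : (Space d × Space d) × Space d =>
      γ (q.1.1 + ε' • q.2 - ε • q.1.2)) (by fun_prop)).aemeasurable
  refine lintegral_congr fun b => ?_
  rw [lintegral_lintegral_swap (by fun_prop)]
  refine lintegral_congr_ae ?_
  have h1 := law_potential_ae_eq hβ hγ hX hΨ hI hu
  -- Since ε' ≠ 0, the shift ε'b' - εb with b fixed has an absolutely continuous law, so the almost
  -- everywhere identity for the potential may be used inside the integral.
  have hq : Measure.QuasiMeasurePreserving (fun b' : Space d => ε' • b' - ε • b)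
      (densityMeasure p) volume := by
    have h2 : Measure.QuasiMeasurePreserving (fun b' : Space d => ε' • b') volume volume := by
      refine ⟨measurable_const_smul _, ?_⟩
      rw [Measure.map_addHaar_smul _ hε'.ne']
      exact Measure.smul_absolutelyContinuous
    exact ((measurePreserving_sub_right volume (ε • b)).quasiMeasurePreserving.comp h2).mono_left
      (withDensity_absolutelyContinuous _ _)
  filter_upwards [hq.ae h1] with b' hb'
  rw [← hb']
  refine lintegral_congr fun w => ?_
  congr 1
  abel

lemma lintegral_smoothCov_le (hβ : β₀ ∈ Ioo (0 : ℝ) 1) (hγ : IsSpatialCovariance γ γhat)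
    (hp : IsMollifier p)
    (hX : IsSymmetricLevy X P) (hΨ : IsCharExponent X P Ψ) (hI : HypothesisI β₀ Ψ γhat)
    {u : ℝ≥0} (hu : 0 < u) (ε : ℝ) {ε' : ℝ} (hε' : 0 < ε') :
    ∫⁻ w, smoothCov γ p ε ε' w ∂(P.map (X u)) ≤ ENNReal.ofReal (levyPotential γhat Ψ u 0) := by
  have := isProbabilityMeasure_densityMeasure hp
  rw [lintegral_smoothCov hβ hγ hX hΨ hI hu ε hε']
  calc _ ≤ ∫⁻ b, ∫⁻ b', ENNReal.ofReal (levyPotential γhat Ψ u 0) ∂(densityMeasure p)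
        ∂(densityMeasure p) :=
        lintegral_mono fun b => lintegral_mono fun b' =>
          ENNReal.ofReal_le_ofReal (levyPotential_le _ _)
    _ = _ := by simp

/-- The mean is an average of the continuous potential over shifts that shrink to 0, and the
potential is bounded by its value at 0. -/
lemma tendsto_lintegral_smoothCov (hβ : β₀ ∈ Ioo (0 : ℝ) 1) (hγ : IsSpatialCovariance γ γhat)
    (hp : IsMollifier p)
    (hX : IsSymmetricLevy X P) (hΨ : IsCharExponent X P Ψ) (hI : HypothesisI β₀ Ψ γhat)
    {u : ℝ≥0} (hu : 0 < u) {ι : Type*} {l : Filter ι} [l.IsCountablyGenerated] {ε ε' : ι → ℝ}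
    (hε' : ∀ᶠ i in l, 0 < ε' i) (h : Tendsto ε l (𝓝 0)) (h' : Tendsto ε' l (𝓝 0)) :
    Tendsto (fun i => ∫⁻ w, smoothCov γ p (ε i) (ε' i) w ∂(P.map (X u))) l
      (𝓝 (ENNReal.ofReal (levyPotential γhat Ψ u 0))) := by
  have := isProbabilityMeasure_densityMeasure hp
  have hFc : Continuous (levyPotential γhat Ψ u) :=
    continuous_specPotential (integrable_exp_exponent hβ hX hΨ hI (NNReal.coe_pos.2 hu))
  have h1 : Tendsto (fun i => ∫⁻ q : Space d × Space d,
      ENNReal.ofReal (levyPotential γhat Ψ u (ε' i • q.2 - ε i • q.1))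
        ∂((densityMeasure p).prod (densityMeasure p))) l
      (𝓝 (∫⁻ q : Space d × Space d, ENNReal.ofReal (levyPotential γhat Ψ u 0)
        ∂((densityMeasure p).prod (densityMeasure p)))) := by
    refine tendsto_lintegral_filter_of_dominated_convergence
      (fun _ => ENNReal.ofReal (levyPotential γhat Ψ u 0)) ?_ ?_ (by simp) ?_
    · exact Eventually.of_forall fun i => by have := hFc.measurable; fun_prop
    · exact Eventually.of_forall fun i => Eventually.of_forall fun q =>
        ENNReal.ofReal_le_ofReal (levyPotential_le _ _)
    · refine Eventually.of_forall fun q => ?_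
      refine (ENNReal.continuous_ofReal.tendsto _).comp ((hFc.tendsto 0).comp ?_)
      have := (h'.smul_const q.2).sub (h.smul_const q.1)
      simpa using this
  rw [lintegral_const, measure_univ, mul_one] at h1
  refine h1.congr' ?_
  filter_upwards [hε'] with i hi
  rw [lintegral_smoothCov hβ hγ hX hΨ hI hu _ hi, lintegral_prod]
  have := hFc.measurable
  fun_prop

/-! ### Integrability of the Hamiltonian -/

/-- On [-1, 1] the exponential is dropped; outside, the power is dropped and e^{-|v|} ≤ 2/(1 + v²).
-/
lemma lintegral_abs_rpow_mul_exp_lt_top (hβ : β₀ ∈ Ioo (0 : ℝ) 1) :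
    ∫⁻ v : ℝ, ENNReal.ofReal (|v| ^ (-β₀) * Real.exp (-|v|)) < ∞ := by
  have h2 : ∫⁻ v : ℝ, ENNReal.ofReal (2 * (1 + v ^ 2)⁻¹) < ∞ := by
    have := (integrable_inv_one_add_sq.const_mul 2).2
    rwa [hasFiniteIntegral_iff_ofReal (Eventually.of_forall fun v => by
      simp only [Pi.zero_apply]; positivity)] at this
  have h1 := lintegral_abs_rpow_lt_top hβ.2 1
  rw [← lintegral_indicator Metric.isClosed_closedBall.measurableSet] at h1
  refine lt_of_le_of_lt ?_ (ENNReal.add_lt_top.2 ⟨h1, h2⟩)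
  rw [← lintegral_add_right _ (by fun_prop)]
  refine lintegral_mono fun v => ?_
  by_cases hv : v ∈ Metric.closedBall (0 : ℝ) 1
  · rw [indicator_of_mem hv]
    refine le_add_right (ENNReal.ofReal_le_ofReal ?_)
    refine mul_le_of_le_one_right (by positivity) ?_
    simp
  · rw [indicator_of_notMem hv, zero_add]
    refine ENNReal.ofReal_le_ofReal ?_
    have hv1 : 1 ≤ |v| := by
      simp only [mem_closedBall_zero_iff, Real.norm_eq_abs, not_le] at hv
      exact hv.le
    have h3 : |v| ^ (-β₀) ≤ 1 := Real.rpow_le_one_of_one_le_of_nonpos hv1 (by linarith [hβ.1])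
    have h4 : Real.exp (-|v|) ≤ 2 * (1 + v ^ 2)⁻¹ := by
      rw [Real.exp_neg, ← div_eq_mul_inv, inv_le_comm₀ (Real.exp_pos _) (by positivity), inv_div]
      have := Real.quadratic_le_exp_of_nonneg (abs_nonneg v)
      rw [sq_abs] at this
      linarith [abs_nonneg v]
    calc _ ≤ 1 * Real.exp (-|v|) := by gcongr
      _ ≤ _ := by rw [one_mul]; exact h4

/-- Two bounds are added: the integral I is at most A, the integral without the exponential, and
ψ^{1-β₀} I ≤ A' by the scaling v ↦ ψv. The exponent 1 - β₀ of the integrability hypothesis comes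
from this scaling. -/
lemma exists_lintegral_rpow_exp_le (hβ : β₀ ∈ Ioo (0 : ℝ) 1) (t : ℝ) :
    ∃ C : ℝ≥0∞, C < ∞ ∧ ∀ ψ : ℝ, 0 ≤ ψ → ∫⁻ v in Metric.closedBall (0 : ℝ) t,
      ENNReal.ofReal (|v| ^ (-β₀) * Real.exp (-(|v| * ψ))) ≤
        C * ENNReal.ofReal (1 / (1 + ψ ^ (1 - β₀))) := by
  set A := ∫⁻ v in Metric.closedBall (0 : ℝ) t, ENNReal.ofReal (|v| ^ (-β₀)) with hA
  set A' := ∫⁻ v : ℝ, ENNReal.ofReal (|v| ^ (-β₀) * Real.exp (-|v|)) with hA'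
  have hAt : A < ∞ := lintegral_abs_rpow_lt_top hβ.2 t
  have hAt' : A' < ∞ := lintegral_abs_rpow_mul_exp_lt_top hβ
  refine ⟨A + A', ENNReal.add_lt_top.2 ⟨hAt, hAt'⟩, fun ψ hψ => ?_⟩
  set I := ∫⁻ v in Metric.closedBall (0 : ℝ) t,
      ENNReal.ofReal (|v| ^ (-β₀) * Real.exp (-(|v| * ψ))) with hI
  have h1 : I ≤ A := by
    refine lintegral_mono fun v => ENNReal.ofReal_le_ofReal ?_
    refine mul_le_of_le_one_right (by positivity) (Real.exp_le_one_iff.2 ?_)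
    have : 0 ≤ |v| * ψ := by positivity
    linarith
  have h2 : ENNReal.ofReal (ψ ^ (1 - β₀)) * I ≤ A' := by
    rcases hψ.eq_or_lt with h0 | h0
    · rw [← h0, Real.zero_rpow (by linarith [hβ.2])]
      simp
    · have h3 := lintegral_comp_sub_smul volume
        (F := fun v : ℝ => ENNReal.ofReal (|v| ^ (-β₀) * Real.exp (-|v|))) (by fun_prop) h0 0
      rw [← hA', Module.finrank_self, pow_one] at h3
      have h4 : ∀ v : ℝ, ENNReal.ofReal (|0 - ψ • v| ^ (-β₀) * Real.exp (-|0 - ψ • v|)) =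
          ENNReal.ofReal (ψ ^ (-β₀)) * ENNReal.ofReal (|v| ^ (-β₀) * Real.exp (-(|v| * ψ))) := by
        intro v
        rw [← ENNReal.ofReal_mul (by positivity), zero_sub, abs_neg, smul_eq_mul, abs_mul,
          abs_of_pos h0, Real.mul_rpow h0.le (abs_nonneg _), mul_assoc, mul_comm ψ]
      simp_rw [h4] at h3
      rw [lintegral_const_mul _ (by fun_prop)] at h3
      have h5 : ENNReal.ofReal (ψ ^ (-β₀)) * I ≤ ENNReal.ofReal ψ⁻¹ * A' := by
        rw [← h3]
        gcongr
        exact setLIntegral_le_lintegral _ _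
      calc ENNReal.ofReal (ψ ^ (1 - β₀)) * I
          = ENNReal.ofReal ψ * (ENNReal.ofReal (ψ ^ (-β₀)) * I) := by
            rw [← mul_assoc, ← ENNReal.ofReal_mul hψ, sub_eq_add_neg, Real.rpow_add h0,
              Real.rpow_one]
        _ ≤ ENNReal.ofReal ψ * (ENNReal.ofReal ψ⁻¹ * A') := by gcongr
        _ = A' := by
            rw [← mul_assoc, ← ENNReal.ofReal_mul hψ, mul_inv_cancel₀ h0.ne', ENNReal.ofReal_one,
              one_mul]
  have hr : 0 ≤ ψ ^ (1 - β₀) := Real.rpow_nonneg hψ _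
  have h3 : ENNReal.ofReal (1 + ψ ^ (1 - β₀)) * I ≤ A + A' := by
    rw [ENNReal.ofReal_add zero_le_one hr, ENNReal.ofReal_one, add_mul, one_mul]
    exact add_le_add h1 h2
  rw [one_div, ENNReal.ofReal_inv_of_pos (by positivity), ← div_eq_mul_inv,
    ENNReal.le_div_iff_mul_le (Or.inl (by simp; positivity)) (Or.inl ENNReal.ofReal_ne_top), mul_comm]
  exact h3

/-- The mean of the Hamiltonian is finite. -/
lemma lintegral_levyPotential_lt_top (hβ : β₀ ∈ Ioo (0 : ℝ) 1) (hX : IsSymmetricLevy X P)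
    (hΨ : IsCharExponent X P Ψ) (hI : HypothesisI β₀ Ψ γhat) (t : ℝ) :
    ∫⁻ s in Icc 0 t, ∫⁻ s' in Icc 0 t, ENNReal.ofReal (|s - s'| ^ (-β₀)) *
      ENNReal.ofReal (levyPotential γhat Ψ |s - s'| 0) < ∞ := by
  have hΨm := hΨ.measurable hX
  obtain ⟨C, hC, hCle⟩ := exists_lintegral_rpow_exp_le hβ t
  set c : ℝ≥0∞ := ENNReal.ofReal ((2 * Real.pi) ^ d)⁻¹ with hc
  have h1 : ∀ u : ℝ, 0 < u → ENNReal.ofReal (levyPotential γhat Ψ u 0) =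
      c * ∫⁻ ξ, ENNReal.ofReal (Real.exp (-(u * Ψ ξ))) ∂(spectralMeasure γhat) := by
    intro u hu
    rw [levyPotential, specPotential_zero, ENNReal.ofReal_mul (by positivity),
      ofReal_integral_eq_lintegral_ofReal (integrable_exp_exponent hβ hX hΨ hI hu)
      (Eventually.of_forall fun ξ => (Real.exp_pos _).le)]
  have h2 : ∀ s ∈ Icc 0 t, ∫⁻ s' in Icc 0 t, ENNReal.ofReal (|s - s'| ^ (-β₀)) *
      ENNReal.ofReal (levyPotential γhat Ψ |s - s'| 0) ≤ c * (C * ∫⁻ ξ,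
        ENNReal.ofReal (1 / (1 + Ψ ξ ^ (1 - β₀))) ∂(spectralMeasure γhat)) := by
    intro s hs
    have h3 : ∀ᵐ s' ∂(volume.restrict (Icc 0 t)), ENNReal.ofReal (|s - s'| ^ (-β₀)) *
        ENNReal.ofReal (levyPotential γhat Ψ |s - s'| 0) = c * ∫⁻ ξ,
        ENNReal.ofReal (|s - s'| ^ (-β₀) * Real.exp (-(|s - s'| * Ψ ξ)))
          ∂(spectralMeasure γhat) := by
      refine ae_restrict_of_ae ?_
      have : ∀ᵐ s' : ℝ, s' ≠ s := by
        rw [ae_iff]; simp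
      filter_upwards [this] with s' hs'
      rw [h1 _ (abs_pos.2 (sub_ne_zero.2 hs'.symm)), mul_left_comm,
        ← lintegral_const_mul _ (by fun_prop)]
      congr 1
      refine lintegral_congr fun ξ => ?_
      rw [ENNReal.ofReal_mul (by positivity)]
    rw [lintegral_congr_ae h3, lintegral_const_mul' _ _ ENNReal.ofReal_ne_top]
    gcongr
    -- For each frequency ξ the integral over s' is taken first; s - s' stays in [-t, t], so the
    -- previous estimate with ψ = Ψ(ξ) bounds it uniformly in s.
    rw [lintegral_lintegral_swap (by fun_prop), ← lintegral_const_mul' _ _ hC.ne]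
    refine lintegral_mono fun ξ => (le_trans ?_ (hCle (Ψ ξ) (hΨ.nonneg hX ξ)))
    rw [← lintegral_indicator measurableSet_Icc,
      ← lintegral_indicator Metric.isClosed_closedBall.measurableSet,
      ← lintegral_sub_left_eq_self ((Metric.closedBall 0 t).indicator _) s]
    refine lintegral_mono fun s' => ?_
    by_cases h : s' ∈ Icc 0 t
    · rw [indicator_of_mem h, indicator_of_mem]
      rw [mem_closedBall_zero_iff, Real.norm_eq_abs, abs_le]
      constructor <;> linarith [hs.1, hs.2, h.1, h.2]
    · rw [indicator_of_notMem h]; exact zero_le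
  refine lt_of_le_of_lt (setLIntegral_mono' measurableSet_Icc h2) ?_
  rw [lintegral_const]
  refine ENNReal.mul_lt_top (ENNReal.mul_lt_top ENNReal.ofReal_lt_top (ENNReal.mul_lt_top hC hI)) ?_
  simp

end FeynmanKac

namespace FeynmanKac

/-! ### Limits of the mollified covariances -/

variable {d : ℕ} {β₀ : ℝ} {γ : Space d → ℝ≥0∞} {γhat : Space d → ℝ} {p : Space d → ℝ} {t : ℝ}

/-- Averaging `|·|^{-β₀}` over a segment issued from `c` is harmless, uniformly in the segment. -/
lemma exists_lintegral_segment_le (hβ : β₀ ∈ Ioo (0 : ℝ) 1) :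
    ∃ C : ℝ≥0∞, C < ∞ ∧ ∀ c κ : ℝ, c ≠ 0 → κ ≠ 0 →
      ∫⁻ a, ENNReal.ofReal (|c - κ * a| ^ (-β₀)) ∂unifMeasure ≤
        C * ENNReal.ofReal (|c| ^ (-β₀)) := by
  set A := ∫⁻ v in Metric.closedBall (0 : ℝ) 1, ENNReal.ofReal (|v| ^ (-β₀)) with hA
  have hAt : A < ∞ := lintegral_abs_rpow_lt_top hβ.2 1
  refine ⟨2 + A, by simp [hAt], fun c κ hc hκ => ?_⟩
  have hc0 : 0 < |c| := abs_pos.2 hc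
  have hunif : ∀ c' : ℝ, ∫⁻ a, ENNReal.ofReal (|c' - a| ^ (-β₀)) ∂unifMeasure ≤ 1 + A := by
    intro c'
    have h1 : ∀ v : ℝ, ENNReal.ofReal (|v| ^ (-β₀)) ≤ 1 + (Metric.closedBall (0 : ℝ) 1).indicator
        (fun v => ENNReal.ofReal (|v| ^ (-β₀))) v := by
      intro v
      by_cases hv : v ∈ Metric.closedBall (0 : ℝ) 1
      · rw [indicator_of_mem hv]; exact le_add_self
      · rw [indicator_of_notMem hv, add_zero, ENNReal.ofReal_le_one]
        simp only [mem_closedBall_zero_iff, Real.norm_eq_abs, not_le] at hv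
        exact Real.rpow_le_one_of_one_le_of_nonpos hv.le (by linarith [hβ.1])
    calc ∫⁻ a, ENNReal.ofReal (|c' - a| ^ (-β₀)) ∂unifMeasure
        ≤ ∫⁻ a, (1 + (Metric.closedBall (0 : ℝ) 1).indicator
          (fun v => ENNReal.ofReal (|v| ^ (-β₀))) (c' - a)) ∂unifMeasure :=
          lintegral_mono fun a => h1 _
      _ = 1 + ∫⁻ a, (Metric.closedBall (0 : ℝ) 1).indicator
          (fun v => ENNReal.ofReal (|v| ^ (-β₀))) (c' - a) ∂unifMeasure := by
          rw [lintegral_add_left measurable_const]; simp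
      _ ≤ 1 + ∫⁻ a, (Metric.closedBall (0 : ℝ) 1).indicator
          (fun v => ENNReal.ofReal (|v| ^ (-β₀))) (c' - a) := by
          gcongr; exact Measure.restrict_le_self
      _ = 1 + A := by
          rw [lintegral_sub_left_eq_self ((Metric.closedBall (0 : ℝ) 1).indicator
            (fun v => ENNReal.ofReal (|v| ^ (-β₀)))) c',
            lintegral_indicator Metric.isClosed_closedBall.measurableSet]
  -- Subadditivity of r ↦ r^{β₀} gives |c|^{β₀} ≤ |c - κa|^{β₀} + |κ|^{β₀} for a in [0, 1]. Divided
  -- by |c - κa|^{β₀}, the right side has mean at most 2 + A, uniformly in c and κ.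
  have h2 : ∀ a ∈ Icc (0 : ℝ) 1, |c| ^ β₀ * |c - κ * a| ^ (-β₀) ≤ 1 + |c / κ - a| ^ (-β₀) := by
    intro a ha
    by_cases h0 : c - κ * a = 0
    · rw [h0, abs_zero, Real.zero_rpow (by linarith [hβ.1]), mul_zero]; positivity
    have hp : 0 < |c - κ * a| := abs_pos.2 h0
    have h3 : |c| ^ β₀ ≤ |c - κ * a| ^ β₀ + |κ| ^ β₀ := by
      calc |c| ^ β₀ ≤ (|c - κ * a| + |κ|) ^ β₀ := by
            refine Real.rpow_le_rpow (abs_nonneg _) ?_ hβ.1.le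
            have h4 : |c| ≤ |c - κ * a| + |κ * a| := by
              have := abs_add_le (c - κ * a) (κ * a); simpa using this
            have h5 : |κ * a| ≤ |κ| := by
              rw [abs_mul, abs_of_nonneg ha.1]
              exact mul_le_of_le_one_right (abs_nonneg _) ha.2
            linarith
        _ ≤ _ := Real.rpow_add_le_add_rpow (abs_nonneg _) (abs_nonneg _) hβ.1.le hβ.2.le
    have h6 : |c / κ - a| ^ (-β₀) = |κ| ^ β₀ * |c - κ * a| ^ (-β₀) := by
      have : c / κ - a = (c - κ * a) / κ := by field_simp
      rw [this, abs_div, Real.div_rpow (abs_nonneg _) (abs_nonneg _), Real.rpow_neg (abs_nonneg κ)]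
      field_simp
    have h7 : |c - κ * a| ^ β₀ * |c - κ * a| ^ (-β₀) = 1 := by
      rw [← Real.rpow_add hp]; simp
    rw [h6, ← h7, ← add_mul]
    exact mul_le_mul_of_nonneg_right h3 (by positivity)
  have h8 : ENNReal.ofReal (|c| ^ β₀) * ∫⁻ a, ENNReal.ofReal (|c - κ * a| ^ (-β₀)) ∂unifMeasure ≤
      2 + A := by
    rw [← lintegral_const_mul' _ _ ENNReal.ofReal_ne_top]
    calc _ ≤ ∫⁻ a, (1 + ENNReal.ofReal (|c / κ - a| ^ (-β₀))) ∂unifMeasure := by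
          refine setLIntegral_mono' measurableSet_Icc fun a ha => ?_
          rw [← ENNReal.ofReal_mul (by positivity), ← ENNReal.ofReal_one,
            ← ENNReal.ofReal_add zero_le_one (by positivity)]
          exact ENNReal.ofReal_le_ofReal (h2 a ha)
      _ ≤ 1 + (1 + A) := by
          rw [lintegral_add_left measurable_const]
          simp only [lintegral_const, measure_univ, mul_one]
          gcongr
          exact hunif _
      _ = 2 + A := by rw [← add_assoc, one_add_one_eq_two]
  have h9 : ENNReal.ofReal (|c| ^ (-β₀)) * ENNReal.ofReal (|c| ^ β₀) = 1 := by
    rw [← ENNReal.ofReal_mul (by positivity), ← Real.rpow_add hc0]; simp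
  calc _ = ENNReal.ofReal (|c| ^ (-β₀)) * (ENNReal.ofReal (|c| ^ β₀) *
        ∫⁻ a, ENNReal.ofReal (|c - κ * a| ^ (-β₀)) ∂unifMeasure) := by
        rw [← mul_assoc, h9, one_mul]
    _ ≤ ENNReal.ofReal (|c| ^ (-β₀)) * (2 + A) := by gcongr
    _ = _ := mul_comm _ _

/-- The mollified temporal covariance is dominated by the temporal covariance. -/
lemma exists_timeKernel_le (hβ : β₀ ∈ Ioo (0 : ℝ) 1) :
    ∃ C : ℝ≥0∞, C < ∞ ∧ ∀ t δ δ' s s' : ℝ, 0 < δ → 0 < δ' → s ≠ s' →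
      timeKernel β₀ t δ δ' s s' ≤ C * ENNReal.ofReal (|s - s'| ^ (-β₀)) := by
  obtain ⟨C, hC, h⟩ := exists_lintegral_segment_le hβ
  refine ⟨C * C, ENNReal.mul_lt_top hC hC, fun t δ δ' s s' hδ hδ' hs => ?_⟩
  -- The segment bound is used twice: in a', starting from s' - s - δa, which is nonzero for almost
  -- every a, and then in a, starting from s' - s.
  have h1 : ∀ᵐ a ∂unifMeasure, s' - s - δ * a ≠ 0 := by
    refine ae_restrict_of_ae ?_
    have : ∀ᵐ a : ℝ, a ≠ (s' - s) / δ := by rw [ae_iff]; simp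
    filter_upwards [this] with a ha h0
    apply ha
    rw [eq_div_iff hδ.ne']
    linarith
  calc timeKernel β₀ t δ δ' s s'
      ≤ ∫⁻ a, ∫⁻ a', ENNReal.ofReal (|(s' - s - δ * a) - (-δ') * a'| ^ (-β₀))
          ∂unifMeasure ∂unifMeasure := by
        refine lintegral_mono fun a => lintegral_mono fun a' => ?_
        rw [show s' - s - δ * a - (-δ') * a' = s' - s + δ' * a' - δ * a by ring]
        calc _ ≤ 1 * 1 * ENNReal.ofReal (|s' - s + δ' * a' - δ * a| ^ (-β₀)) := by
              gcongr <;> exact cutoff_le_one _ _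
          _ = _ := by rw [one_mul, one_mul]
    _ ≤ ∫⁻ a, C * ENNReal.ofReal (|s' - s - δ * a| ^ (-β₀)) ∂unifMeasure :=
        lintegral_mono_ae (h1.mono fun a ha => h _ _ ha (by linarith))
    _ ≤ C * (C * ENNReal.ofReal (|s' - s| ^ (-β₀))) := by
        rw [lintegral_const_mul' _ _ hC.ne]
        gcongr
        exact h _ _ (sub_ne_zero.2 hs.symm) hδ.ne'
    _ = _ := by rw [mul_assoc, abs_sub_comm]

lemma unifMeasure_ae : ∀ᵐ a ∂unifMeasure, a ∈ Icc (0 : ℝ) 1 := ae_restrict_mem measurableSet_Icc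

/-- For small δ and δ' the shifted time difference keeps modulus at least |s - s'|/2, which bounds
the integrand. Both cutoffs are eventually 1 because s, s' < t; at s = t the time t - s - δa would
be negative for a > 0. -/
lemma tendsto_timeKernel {ι : Type*} {l : Filter ι} [l.IsCountablyGenerated] {δ δ' : ι → ℝ}
    (hδ0 : ∀ᶠ i in l, 0 < δ i) (hδ0' : ∀ᶠ i in l, 0 < δ' i)
    (hδ : Tendsto δ l (𝓝 0)) (hδ' : Tendsto δ' l (𝓝 0)) {s s' : ℝ} (hs : s ∈ Ico 0 t)
    (hs' : s' ∈ Ico 0 t) (hne : s ≠ s') (hβ : 0 < β₀) :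
    Tendsto (fun i => timeKernel β₀ t (δ i) (δ' i) s s') l
      (𝓝 (ENNReal.ofReal (|s - s'| ^ (-β₀)))) := by
  set v := |s' - s| with hv
  have hv0 : 0 < v := abs_pos.2 (sub_ne_zero.2 hne.symm)
  have hq : ∀ᵐ q ∂(unifMeasure.prod unifMeasure), q.1 ∈ Icc (0 : ℝ) 1 ∧ q.2 ∈ Icc (0 : ℝ) 1 :=
    (Measure.quasiMeasurePreserving_fst.ae unifMeasure_ae).and
      (Measure.quasiMeasurePreserving_snd.ae unifMeasure_ae)
  have h1 : Tendsto (fun i => ∫⁻ q : ℝ × ℝ, cutoff t (t - s - δ i * q.1) *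
      cutoff t (t - s' - δ' i * q.2) *
      ENNReal.ofReal (|s' - s + δ' i * q.2 - δ i * q.1| ^ (-β₀)) ∂(unifMeasure.prod unifMeasure)) l
      (𝓝 (∫⁻ q : ℝ × ℝ, ENNReal.ofReal (v ^ (-β₀)) ∂(unifMeasure.prod unifMeasure))) := by
    refine tendsto_lintegral_filter_of_dominated_convergence
      (fun _ => ENNReal.ofReal ((v / 2) ^ (-β₀))) ?_ ?_ (by simp) ?_
    · exact Eventually.of_forall fun i => by fun_prop
    · have e1 : ∀ᶠ i in l, δ i < v / 2 := hδ.eventually_lt_const (by positivity)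
      have e2 : ∀ᶠ i in l, δ' i < v / 2 := hδ'.eventually_lt_const (by positivity)
      filter_upwards [hδ0, hδ0', e1, e2] with i p1 p2 p3 p4
      filter_upwards [hq] with q hq
      calc _ ≤ 1 * 1 * ENNReal.ofReal (|s' - s + δ' i * q.2 - δ i * q.1| ^ (-β₀)) := by
            gcongr <;> exact cutoff_le_one _ _
        _ ≤ _ := by
            rw [one_mul, one_mul]
            refine ENNReal.ofReal_le_ofReal ?_
            refine Real.rpow_le_rpow_of_nonpos (by positivity) ?_ (by linarith)
            have h3 : |δ' i * q.2 - δ i * q.1| ≤ v / 2 := by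
              rw [abs_le]
              constructor <;> nlinarith [hq.1.1, hq.1.2, hq.2.1, hq.2.2]
            have h4 := abs_sub_abs_le_abs_sub (s' - s) (-(δ' i * q.2 - δ i * q.1))
            rw [abs_neg] at h4
            rw [show s' - s + δ' i * q.2 - δ i * q.1 =
              s' - s - -(δ' i * q.2 - δ i * q.1) by ring]
            linarith
    · filter_upwards [hq] with q hq
      have c1 : ∀ᶠ i in l, cutoff t (t - s - δ i * q.1) = 1 := by
        filter_upwards [hδ0, hδ.eventually_lt_const (sub_pos.2 hs.2)] with i p1 p2
        rw [cutoff, indicator_of_mem]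
        constructor <;> nlinarith [hq.1.1, hq.1.2, hs.1, hs.2]
      have c2 : ∀ᶠ i in l, cutoff t (t - s' - δ' i * q.2) = 1 := by
        filter_upwards [hδ0', hδ'.eventually_lt_const (sub_pos.2 hs'.2)] with i p1 p2
        rw [cutoff, indicator_of_mem]
        constructor <;> nlinarith [hq.2.1, hq.2.2, hs'.1, hs'.2]
      have c3 : Tendsto (fun i => |s' - s + δ' i * q.2 - δ i * q.1|) l (𝓝 v) := by
        have := ((((hδ'.mul_const q.2).const_add (s' - s)).sub (hδ.mul_const q.1))).abs
        simpa using this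
      have c4 := (ENNReal.continuous_ofReal.tendsto _).comp
        (c3.rpow_const (p := -β₀) (Or.inl hv0.ne'))
      refine c4.congr' ?_
      filter_upwards [c1, c2] with i e1 e2
      simp [e1, e2]
  rw [lintegral_const, measure_univ, mul_one, hv, abs_sub_comm] at h1
  refine h1.congr fun i => ?_
  rw [timeKernel, lintegral_prod]
  fun_prop

/-- Where γ(w) < ∞, continuity into [0, ∞] gives γ < γ(w) + 1 near w, and compact support of p makes
all shifts uniformly small. -/
lemma tendsto_smoothCov (hγ : IsSpatialCovariance γ γhat) (hp : IsMollifier p) {ι : Type*}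
    {l : Filter ι} [l.IsCountablyGenerated] {ε ε' : ι → ℝ} (hε : Tendsto ε l (𝓝 0))
    (hε' : Tendsto ε' l (𝓝 0)) {w : Space d} (hw : γ w < ∞) :
    Tendsto (fun i => smoothCov γ p (ε i) (ε' i) w) l (𝓝 (γ w)) := by
  have := isProbabilityMeasure_densityMeasure hp
  have hm := hγ.measurable
  obtain ⟨B, R, hBR⟩ := exists_bddSupp hp.smooth.continuous hp.compact
  have hsupp : ∀ᵐ b ∂(densityMeasure p), ‖b‖ ≤ R := by
    have hmp : Measurable fun b => ENNReal.ofReal (p b) := by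
      have := hp.smooth.continuous.measurable; fun_prop
    rw [densityMeasure, ae_withDensity_iff hmp]
    refine Eventually.of_forall fun b hb => ?_
    by_contra h
    exact hb (by simp [hBR.2 b (not_le.1 h)])
  have hq : ∀ᵐ q ∂((densityMeasure p).prod (densityMeasure p)), ‖q.1‖ ≤ R ∧ ‖q.2‖ ≤ R :=
    (Measure.quasiMeasurePreserving_fst.ae hsupp).and (Measure.quasiMeasurePreserving_snd.ae hsupp)
  have h1 : Tendsto (fun i => ∫⁻ q : Space d × Space d, γ (w + ε' i • q.2 - ε i • q.1)
      ∂((densityMeasure p).prod (densityMeasure p))) l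
      (𝓝 (∫⁻ q : Space d × Space d, γ w ∂((densityMeasure p).prod (densityMeasure p)))) := by
    refine tendsto_lintegral_filter_of_dominated_convergence (fun _ => γ w + 1) ?_ ?_ ?_ ?_
    · exact Eventually.of_forall fun i => by fun_prop
    · have h2 : ∀ᶠ y in 𝓝 w, γ y < γ w + 1 :=
        hγ.continuous.continuousAt.eventually_lt_const
          (ENNReal.lt_add_right hw.ne one_ne_zero)
      obtain ⟨r, hr, hball⟩ := Metric.eventually_nhds_iff.1 h2
      have h3 : Tendsto (fun i => (|ε' i| + |ε i|) * R) l (𝓝 0) := by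
        have := ((hε'.abs).add (hε.abs)).mul_const R
        simpa using this
      filter_upwards [h3.eventually_lt_const hr] with i hi
      filter_upwards [hq] with q hq
      refine (hball ?_).le
      rw [dist_eq_norm, show w + ε' i • q.2 - ε i • q.1 - w = ε' i • q.2 - ε i • q.1 by abel]
      refine lt_of_le_of_lt ((norm_sub_le _ _).trans ?_) hi
      rw [norm_smul, norm_smul, add_mul]
      gcongr
      · exact (Real.norm_eq_abs _).le
      · exact hq.2
      · exact (Real.norm_eq_abs _).le
      · exact hq.1
    · simp [hw.ne]
    · refine Eventually.of_forall fun q => (hγ.continuous.tendsto w).comp ?_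
      have := ((hε'.smul_const q.2).const_add w).sub (hε.smul_const q.1)
      simpa using this
  rw [lintegral_const, measure_univ, mul_one] at h1
  refine h1.congr fun i => ?_
  rw [smoothCov, lintegral_prod]
  fun_prop

/-- Scheffé's lemma. -/
lemma tendsto_lintegral_sub_add_sub {α : Type*} [MeasurableSpace α] {m : Measure α} {ι : Type*}
    {l : Filter ι} [l.IsCountablyGenerated] {f : ι → α → ℝ≥0∞} {g : α → ℝ≥0∞}
    (hf : ∀ i, Measurable (f i)) (hg : Measurable g) (hgi : ∫⁻ a, g a ∂m ≠ ∞)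
    (hlim : ∀ᵐ a ∂m, Tendsto (fun i => f i a) l (𝓝 (g a)))
    (hint : Tendsto (fun i => ∫⁻ a, f i a ∂m) l (𝓝 (∫⁻ a, g a ∂m))) :
    Tendsto (fun i => ∫⁻ a, ((f i a - g a) + (g a - f i a)) ∂m) l (𝓝 0) := by
  have h1 : Tendsto (fun i => ∫⁻ a, (g a - f i a) ∂m) l (𝓝 0) := by
    have : (0 : ℝ≥0∞) = ∫⁻ a, (0 : ℝ≥0∞) ∂m := by simp
    rw [this]
    refine tendsto_lintegral_filter_of_dominated_convergence g
      (Eventually.of_forall fun i => hg.sub (hf i))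
      (Eventually.of_forall fun i => Eventually.of_forall fun a => tsub_le_self) hgi ?_
    filter_upwards [hlim, ae_lt_top hg hgi] with a ha hga
    have := ENNReal.Tendsto.sub (tendsto_const_nhds (x := g a)) ha (Or.inl hga.ne)
    rwa [tsub_self] at this
  -- Only the deficit (g - f)⁺ is dominated, by g. The excess is recovered from (f - g)⁺ + g = f +
  -- (g - f)⁺ and the convergence of the integrals.
  have h2 : ∀ i, ∫⁻ a, (f i a - g a) ∂m =
      (∫⁻ a, f i a ∂m + ∫⁻ a, (g a - f i a) ∂m) - ∫⁻ a, g a ∂m := by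
    intro i
    have h3 : ∫⁻ a, f i a ∂m + ∫⁻ a, (g a - f i a) ∂m =
        ∫⁻ a, (f i a - g a) ∂m + ∫⁻ a, g a ∂m := by
      rw [← lintegral_add_left (hf i), ← lintegral_add_right _ hg]
      refine lintegral_congr fun a => ?_
      rcases le_total (f i a) (g a) with h | h
      · rw [tsub_eq_zero_of_le h, zero_add, add_tsub_cancel_of_le h]
      · rw [tsub_eq_zero_of_le h, add_zero, tsub_add_cancel_of_le h]
    rw [h3, ENNReal.add_sub_cancel_right hgi]
  have h4 : Tendsto (fun i => ∫⁻ a, (f i a - g a) ∂m) l (𝓝 0) := by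
    simp_rw [h2]
    have := ENNReal.Tendsto.sub (hint.add h1) (tendsto_const_nhds (x := ∫⁻ a, g a ∂m))
      (Or.inr hgi)
    rwa [add_zero, tsub_self] at this
  have h5 := h4.add h1
  rw [add_zero] at h5
  refine h5.congr fun i => ?_
  exact (lintegral_add_left (f := fun a => f i a - g a) ((hf i).sub hg) _).symm

end FeynmanKac

namespace FeynmanKac

/-! ### Right-continuous paths -/

/-- The path is right-continuous with left limits. -/
def IsCadlag {E : Type*} [TopologicalSpace E] (path : ℝ≥0 → E) : Prop :=
  ∀ t, ContinuousWithinAt path (Ici t) t ∧ ∃ l, Tendsto path (𝓝[<] t) (𝓝 l)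

/-- The smallest multiple of `1 / (n + 1)` which is at least `s`. -/
def gridCeil (n : ℕ) (s : ℝ≥0) : ℝ≥0 := (⌈((n : ℝ≥0) + 1) * s⌉₊ : ℝ≥0) / ((n : ℝ≥0) + 1)

lemma le_gridCeil (n : ℕ) (s : ℝ≥0) : s ≤ gridCeil n s := by
  rw [gridCeil, le_div_iff₀ (by positivity), mul_comm]
  exact Nat.le_ceil _

lemma gridCeil_le (n : ℕ) (s : ℝ≥0) : gridCeil n s ≤ s + 1 / ((n : ℝ≥0) + 1) := by
  have h : (s + 1 / ((n : ℝ≥0) + 1)) * ((n : ℝ≥0) + 1) = ((n : ℝ≥0) + 1) * s + 1 := by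
    field_simp
  rw [gridCeil, div_le_iff₀ (by positivity), h]
  exact (Nat.ceil_lt_add_one zero_le).le

lemma tendsto_gridCeil (s : ℝ≥0) : Tendsto (fun n => gridCeil n s) atTop (𝓝[≥] s) := by
  refine tendsto_nhdsWithin_iff.2 ⟨?_, Eventually.of_forall fun n => le_gridCeil n s⟩
  refine tendsto_of_tendsto_of_tendsto_of_le_of_le tendsto_const_nhds ?_
    (fun n => le_gridCeil n s) (fun n => gridCeil_le n s)
  have h : Tendsto (fun n : ℕ => 1 / ((n : ℝ≥0) + 1)) atTop (𝓝 0) := by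
    rw [← NNReal.tendsto_coe]
    push_cast
    exact tendsto_one_div_add_atTop_nhds_zero_nat
  simpa using h.const_add s

lemma measurable_gridCeil (n : ℕ) : Measurable (gridCeil n) := by
  unfold gridCeil
  have h : Measurable fun s : ℝ≥0 => (⌈((n : ℝ≥0) + 1) * s⌉₊ : ℝ≥0) :=
    (measurable_from_nat (f := fun k : ℕ => (k : ℝ≥0))).comp
      (Nat.measurable_ceil.comp (measurable_const.mul measurable_id))
  exact h.div_const _

lemma IsCadlag.tendsto_gridCeil {E : Type*} [TopologicalSpace E] {path : ℝ≥0 → E}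
    (h : IsCadlag path) (s : ℝ≥0) : Tendsto (fun n => path (gridCeil n s)) atTop (𝓝 (path s)) :=
  (h s).1.tendsto.comp (FeynmanKac.tendsto_gridCeil s)

/-- Piecewise constant paths are measurable in the path and the time jointly. -/
lemma measurable_comp_gridCeil {Ω E : Type*} [MeasurableSpace Ω] [MeasurableSpace E]
    {X : ℝ≥0 → Ω → E} (hX : ∀ s, Measurable (X s)) (n : ℕ) :
    Measurable fun q : ℝ≥0 × Ω => X (gridCeil n q.1) q.2 := by
  have h1 : Measurable fun q : ℕ × Ω => X ((q.1 : ℝ≥0) / ((n : ℝ≥0) + 1)) q.2 :=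
    measurable_from_prod_countable_right (f := fun q : ℕ × Ω =>
      X ((q.1 : ℝ≥0) / ((n : ℝ≥0) + 1)) q.2) fun k => hX ((k : ℝ≥0) / ((n : ℝ≥0) + 1))
  have h2 : Measurable fun q : ℝ≥0 × Ω => (⌈((n : ℝ≥0) + 1) * q.1⌉₊, q.2) :=
    (Nat.measurable_ceil.comp (measurable_const.mul measurable_fst)).prodMk measurable_snd
  exact h1.comp h2

/-- Grid points approach s from the right, so right-continuity suffices, and each approximant
depends on time through a countable index. -/
lemma measurable_uncurry_of_cadlag {Ω E : Type*} [MeasurableSpace Ω] [TopologicalSpace E]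
    [TopologicalSpace.PseudoMetrizableSpace E] [MeasurableSpace E] [BorelSpace E]
    {X : ℝ≥0 → Ω → E} (hX : ∀ s, Measurable (X s)) (hc : ∀ ω, IsCadlag fun s => X s ω) :
    Measurable fun q : ℝ≥0 × Ω => X q.1 q.2 := by
  refine measurable_of_tendsto_metrizable (fun n => measurable_comp_gridCeil hX n) ?_
  rw [tendsto_pi_nhds]
  exact fun q => (hc q.2).tendsto_gridCeil q.1

lemma IsCadlag.measurable {E : Type*} [TopologicalSpace E]
    [TopologicalSpace.PseudoMetrizableSpace E] [MeasurableSpace E] [BorelSpace E]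
    {path : ℝ≥0 → E} (h : IsCadlag path) : Measurable path :=
  (measurable_uncurry_of_cadlag (X := fun s (_ : Unit) => path s) (fun _ => measurable_const)
    (fun _ => h)).comp (f := fun s => (s, ())) (measurable_id.prodMk measurable_const)

/-- One-sided limits bound the path near each time; compactness of [0, T] makes the bound global. -/
lemma IsCadlag.exists_norm_le {E : Type*} [NormedAddCommGroup E] {path : ℝ≥0 → E}
    (h : IsCadlag path) (T : ℝ≥0) : ∃ b : ℝ, ∀ s ≤ T, ‖path s‖ ≤ b := by
  have hK : IsCompact (Icc 0 T) := isCompact_Icc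
  have : ∃ b : ℝ, ∀ s ∈ Icc 0 T, ‖path s‖ ≤ b := by
    refine hK.induction_on (p := fun A => ∃ b : ℝ, ∀ s ∈ A, ‖path s‖ ≤ b) ⟨0, by simp⟩ ?_ ?_ ?_
    · rintro A A' hA ⟨b, hb⟩
      exact ⟨b, fun s hs => hb s (hA hs)⟩
    · rintro A A' ⟨b, hb⟩ ⟨b', hb'⟩
      refine ⟨max b b', fun s hs => ?_⟩
      rcases hs with hs | hs
      · exact (hb s hs).trans (le_max_left _ _)
      · exact (hb' s hs).trans (le_max_right _ _)
    · intro s _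
      obtain ⟨h1, l, h2⟩ := h s
      have e1 : ∀ᶠ r in 𝓝[≥] s, ‖path r‖ < ‖path s‖ + 1 :=
        h1.norm.tendsto.eventually_lt_const (lt_add_one _)
      have e2 : ∀ᶠ r in 𝓝[<] s, ‖path r‖ < ‖l‖ + 1 := h2.norm.eventually_lt_const (lt_add_one _)
      have e3 : ∀ᶠ r in 𝓝 s, ‖path r‖ ≤ max (‖path s‖ + 1) (‖l‖ + 1) := by
        rw [← nhdsLT_sup_nhdsGE, eventually_sup]
        exact ⟨e2.mono fun r hr => hr.le.trans (le_max_right _ _),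
          e1.mono fun r hr => hr.le.trans (le_max_left _ _)⟩
      exact ⟨_, mem_nhdsWithin_of_mem_nhds e3, _, fun r hr => hr⟩
  obtain ⟨b, hb⟩ := this
  exact ⟨b, fun s hs => hb s ⟨zero_le, hs⟩⟩

/-! ### Convergence of the covariances to the Hamiltonian -/

variable {Ω : Type*} [MeasurableSpace Ω] {P : Measure Ω}
  {d : ℕ} {β₀ : ℝ} {γ : Space d → ℝ≥0∞} {γhat : Space d → ℝ} {p : Space d → ℝ}
  {X : ℝ≥0 → Ω → Space d} {Ψ : Space d → ℝ} {t : ℝ}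

/-- The covariance of two mollified kernels along a path. -/
def mollifiedCov (β₀ : ℝ) (γ : Space d → ℝ≥0∞) (p : Space d → ℝ) (t ε δ ε' δ' : ℝ)
    (path : ℝ≥0 → Space d) : ℝ≥0∞ :=
  ∫⁻ s in Icc 0 t, ∫⁻ s' in Icc 0 t, timeKernel β₀ t δ δ' s s' *
    smoothCov γ p ε ε' (path s.toNNReal - path s'.toNNReal)

/-- Paths are reset to 0 on a measurable null set that contains the exceptional ones. Joint
measurability in time and chance needs every path to be càdlàg. -/
lemma IsSymmetricLevy.exists_modification (hX : IsSymmetricLevy X P) :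
    ∃ Y : ℝ≥0 → Ω → Space d, (∀ s, Measurable (Y s)) ∧ (∀ ω, IsCadlag fun s => Y s ω) ∧
      ∀ᵐ ω ∂P, ∀ s, Y s ω = X s ω := by
  set N := toMeasurable P {ω | ¬ IsCadlag fun s => X s ω} with hN
  have hN0 : P N = 0 := by
    rw [hN, measure_toMeasurable]
    exact hX.cadlag
  have hNm : MeasurableSet N := measurableSet_toMeasurable _ _
  refine ⟨fun s => Nᶜ.indicator (X s), fun s => (hX.measurable s).indicator hNm.compl,
    fun ω => ?_, ?_⟩
  · by_cases h : ω ∈ Nᶜ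
    · simp only [indicator_of_mem h]
      by_contra h'
      exact h (subset_toMeasurable P _ h')
    · simp only [indicator_of_notMem h]
      exact fun t => ⟨continuousWithinAt_const, 0, tendsto_const_nhds⟩
  · have : ∀ᵐ ω ∂P, ω ∈ Nᶜ := measure_eq_zero_iff_ae_notMem.1 hN0
    filter_upwards [this] with ω hω s
    exact indicator_of_mem hω _

/-- The increment has a density, and points are Lebesgue null because d ≥ 1. -/
lemma IsSymmetricLevy.ae_increment_ne (hd : 1 ≤ d) (hX : IsSymmetricLevy X P) {s s' : ℝ≥0}
    (hne : s ≠ s') : ∀ᵐ ω ∂P, X s ω - X s' ω ≠ 0 := by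
  have : Nonempty (Fin d) := ⟨⟨0, hd⟩⟩
  have hpos : 0 < nndist s s' := by rw [pos_iff_ne_zero, Ne, nndist_eq_zero]; exact hne
  have h1 : ∀ᵐ y ∂(P.map (X (nndist s s'))), y ≠ (0 : Space d) := by
    refine (hX.density _ hpos).ae_le ?_
    change ∀ᵐ y ∂volume, y ≠ (0 : Space d)
    rw [ae_iff]; simp
  rw [← map_increment hX] at h1
  exact ae_of_ae_map ((hX.measurable s).sub (hX.measurable s')).aemeasurable h1

lemma coe_nndist_toNNReal {s s' : ℝ} (hs : 0 ≤ s) (hs' : 0 ≤ s') :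
    ((nndist s.toNNReal s'.toNNReal : ℝ≥0) : ℝ) = |s - s'| := by
  rw [coe_nndist, NNReal.dist_eq, Real.coe_toNNReal _ hs, Real.coe_toNNReal _ hs']

variable [IsProbabilityMeasure P]

/-- The mollified covariances converge in `L¹` to the Hamiltonian. -/
lemma tendsto_mollifiedCov (hd : 1 ≤ d) (hβ : β₀ ∈ Ioo (0 : ℝ) 1)
    (hγ : IsSpatialCovariance γ γhat) (hp : IsMollifier p)
    (hX : IsSymmetricLevy X P) (hΨ : IsCharExponent X P Ψ) (hI : HypothesisI β₀ Ψ γhat)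
    (t : ℝ) {ι : Type*} {l : Filter ι} [l.IsCountablyGenerated] {ε δ ε' δ' : ι → ℝ}
    (hε'0 : ∀ i, 0 < ε' i) (hδ0 : ∀ i, 0 < δ i) (hδ'0 : ∀ i, 0 < δ' i)
    (hε : Tendsto ε l (𝓝 0)) (hδ : Tendsto δ l (𝓝 0)) (hε' : Tendsto ε' l (𝓝 0))
    (hδ' : Tendsto δ' l (𝓝 0)) :
    ∫⁻ ω, hamiltonian β₀ γ t (trajectory X ω) ∂P < ∞ ∧
    (∀ i, ∫⁻ ω, mollifiedCov β₀ γ p t (ε i) (δ i) (ε' i) (δ' i) (trajectory X ω) ∂P < ∞) ∧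
    Tendsto (fun i => ∫⁻ ω,
      ((mollifiedCov β₀ γ p t (ε i) (δ i) (ε' i) (δ' i) (trajectory X ω) -
        hamiltonian β₀ γ t (trajectory X ω)) + (hamiltonian β₀ γ t (trajectory X ω) -
        mollifiedCov β₀ γ p t (ε i) (δ i) (ε' i) (δ' i) (trajectory X ω))) ∂P) l (𝓝 0) := by
  obtain ⟨Y, hYm, hYc, hYX⟩ := hX.exists_modification
  have hm := hγ.measurable
  have hYj : Measurable fun q : ℝ≥0 × Ω => Y q.1 q.2 := measurable_uncurry_of_cadlag hYm hYc
  have hYi : Measurable fun q : (ℝ × ℝ) × Ω => Y q.1.1.toNNReal q.2 - Y q.1.2.toNNReal q.2 := by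
    refine Measurable.sub ?_ ?_
    · exact hYj.comp (f := fun q : (ℝ × ℝ) × Ω => (q.1.1.toNNReal, q.2)) (by fun_prop)
    · exact hYj.comp (f := fun q : (ℝ × ℝ) × Ω => (q.1.2.toNNReal, q.2)) (by fun_prop)
  set lam : Measure ℝ := volume.restrict (Icc 0 t) with hlam
  set f : ι → (ℝ × ℝ) × Ω → ℝ≥0∞ := fun i q => timeKernel β₀ t (δ i) (δ' i) q.1.1 q.1.2 *
    smoothCov γ p (ε i) (ε' i) (Y q.1.1.toNNReal q.2 - Y q.1.2.toNNReal q.2) with hf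
  set g : (ℝ × ℝ) × Ω → ℝ≥0∞ := fun q => ENNReal.ofReal (|q.1.1 - q.1.2| ^ (-β₀)) *
    γ (Y q.1.1.toNNReal q.2 - Y q.1.2.toNNReal q.2) with hg
  have hsm : ∀ i, Measurable (smoothCov γ p (ε i) (ε' i)) := fun i => measurable_smoothCov hm
  have htk : ∀ i, Measurable fun q : ℝ × ℝ => timeKernel β₀ t (δ i) (δ' i) q.1 q.2 := fun i =>
    measurable_timeKernel
  have hfm : ∀ i, Measurable (f i) := fun i =>
    ((htk i).comp measurable_fst).mul ((hsm i).comp hYi)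
  have hgm : Measurable g := by
    refine Measurable.mul ?_ (hm.comp hYi)
    fun_prop
  -- The diagonal and the endpoint t, to which the limit of `timeKernel` does not apply, are null
  -- sets of times.
  have hlamlt : ∀ᵐ q ∂(lam.prod lam), q.1 ∈ Ico 0 t ∧ q.2 ∈ Ico 0 t ∧ q.1 ≠ q.2 := by
    have h1 : ∀ᵐ s ∂lam, s ∈ Ico 0 t := by
      rw [hlam, ← Measure.restrict_congr_set Ico_ae_eq_Icc]
      exact ae_restrict_mem measurableSet_Ico
    have h2 : ∀ᵐ q ∂(lam.prod lam), q.1 ≠ q.2 := by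
      have hms : MeasurableSet {q : ℝ × ℝ | q.1 ≠ q.2} :=
        (measurableSet_eq_fun measurable_fst measurable_snd).compl
      rw [Measure.ae_prod_iff_ae_ae hms]
      refine Eventually.of_forall fun s => ae_restrict_of_ae ?_
      rw [ae_iff]
      simp
    filter_upwards [Measure.quasiMeasurePreserving_fst.ae h1,
      Measure.quasiMeasurePreserving_snd.ae h1, h2] with q a b c
    exact ⟨a, b, c⟩
  have hmean : ∀ (F : Space d → ℝ≥0∞), Measurable F → ∀ s s' : ℝ,
      ∫⁻ ω, F (Y s.toNNReal ω - Y s'.toNNReal ω) ∂P =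
        ∫⁻ y, F y ∂(P.map (X (nndist s.toNNReal s'.toNNReal))) := by
    intro F hF s s'
    rw [← map_increment hX, lintegral_map (g := fun ω => X s.toNNReal ω - X s'.toNNReal ω) hF
      ((hX.measurable _).sub (hX.measurable _))]
    refine lintegral_congr_ae ?_
    filter_upwards [hYX] with ω hω
    rw [hω, hω]
  set M : ℝ × ℝ → ℝ≥0∞ := fun q => ENNReal.ofReal (levyPotential γhat Ψ |q.1 - q.2| 0) with hM
  have hupos : ∀ q : ℝ × ℝ, q.1 ∈ Ico 0 t ∧ q.2 ∈ Ico 0 t ∧ q.1 ≠ q.2 →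
      0 < nndist q.1.toNNReal q.2.toNNReal ∧
      ((nndist q.1.toNNReal q.2.toNNReal : ℝ≥0) : ℝ) = |q.1 - q.2| := by
    rintro q ⟨h1, h2, h3⟩
    have := coe_nndist_toNNReal h1.1 h2.1
    refine ⟨?_, this⟩
    rw [← NNReal.coe_pos, this]
    exact abs_pos.2 (sub_ne_zero.2 h3)
  have hgmean : ∀ q : ℝ × ℝ, q.1 ∈ Ico 0 t ∧ q.2 ∈ Ico 0 t ∧ q.1 ≠ q.2 →
      ∫⁻ ω, g (q, ω) ∂P = ENNReal.ofReal (|q.1 - q.2| ^ (-β₀)) * M q := by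
    intro q hq
    obtain ⟨h1, h2⟩ := hupos q hq
    simp only [hg, hM]
    rw [lintegral_const_mul' _ _ ENNReal.ofReal_ne_top, hmean γ hm,
      lintegral_law hβ hγ hX hΨ hI h1, h2]
  obtain ⟨C, hC, hCle⟩ := exists_timeKernel_le hβ
  have htkfin : ∀ i, ∀ q : ℝ × ℝ, q.1 ≠ q.2 → timeKernel β₀ t (δ i) (δ' i) q.1 q.2 ≠ ∞ :=
    fun i q hq => ((hCle t _ _ _ _ (hδ0 i) (hδ'0 i) hq).trans_lt
      (ENNReal.mul_lt_top hC ENNReal.ofReal_lt_top)).ne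
  have hfmean : ∀ i, ∀ q : ℝ × ℝ, q.1 ∈ Ico 0 t ∧ q.2 ∈ Ico 0 t ∧ q.1 ≠ q.2 →
      ∫⁻ ω, f i (q, ω) ∂P = timeKernel β₀ t (δ i) (δ' i) q.1 q.2 *
        ∫⁻ y, smoothCov γ p (ε i) (ε' i) y
          ∂(P.map (X (nndist q.1.toNNReal q.2.toNNReal))) := by
    intro i q hq
    simp only [hf]
    rw [lintegral_const_mul' _ _ (htkfin i q hq.2.2), hmean _ (hsm i)]
  -- The mean over ω at fixed times is at most C times the mean of the limit, uniformly in the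
  -- mollification: the time factor by `exists_timeKernel_le`, the space factor because the
  -- potential is largest at 0.
  have hfbound : ∀ i, ∀ q : ℝ × ℝ, q.1 ∈ Ico 0 t ∧ q.2 ∈ Ico 0 t ∧ q.1 ≠ q.2 →
      ∫⁻ ω, f i (q, ω) ∂P ≤ C * (ENNReal.ofReal (|q.1 - q.2| ^ (-β₀)) * M q) := by
    intro i q hq
    obtain ⟨h1, h2⟩ := hupos q hq
    rw [hfmean i q hq, ← mul_assoc]
    refine mul_le_mul' (hCle t _ _ _ _ (hδ0 i) (hδ'0 i) hq.2.2) ?_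
    refine (lintegral_smoothCov_le hβ hγ hp hX hΨ hI h1 (ε i) (hε'0 i)).trans_eq ?_
    rw [h2]
  have hgM : Measurable fun q : ℝ × ℝ => ∫⁻ ω, g (q, ω) ∂P := hgm.lintegral_prod_right'
  have hbfin : ∫⁻ q, ∫⁻ ω, g (q, ω) ∂P ∂(lam.prod lam) < ∞ := by
    rw [lintegral_prod _ hgM.aemeasurable]
    refine lt_of_le_of_lt (le_of_eq ?_) (lintegral_levyPotential_lt_top hβ hX hΨ hI t)
    have h3 := Measure.ae_ae_of_ae_prod hlamlt
    refine lintegral_congr_ae ?_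
    filter_upwards [h3] with s hs
    refine lintegral_congr_ae ?_
    filter_upwards [hs] with s' hs'
    exact hgmean (s, s') hs'
  have hcomb : ∀ (F : (ℝ × ℝ) × Ω → ℝ≥0∞), Measurable F →
      ∫⁻ q, F q ∂((lam.prod lam).prod P) =
        ∫⁻ ω, (∫⁻ s in Icc 0 t, ∫⁻ s' in Icc 0 t, F ((s, s'), ω)) ∂P := by
    intro F hF
    rw [lintegral_prod_symm _ hF.aemeasurable]
    refine lintegral_congr fun ω => ?_
    exact lintegral_prod (fun q : ℝ × ℝ => F (q, ω))
      (hF.comp (by fun_prop : Measurable fun q : ℝ × ℝ => (q, ω))).aemeasurable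
  have hVg : ∀ᵐ ω ∂P, hamiltonian β₀ γ t (trajectory X ω) =
      ∫⁻ s in Icc 0 t, ∫⁻ s' in Icc 0 t, g ((s, s'), ω) := by
    filter_upwards [hYX] with ω hω
    simp only [hamiltonian, hg, hω, trajectory]
  have hAf : ∀ i, ∀ᵐ ω ∂P, mollifiedCov β₀ γ p t (ε i) (δ i) (ε' i) (δ' i) (trajectory X ω) =
      ∫⁻ s in Icc 0 t, ∫⁻ s' in Icc 0 t, f i ((s, s'), ω) := by
    intro i
    filter_upwards [hYX] with ω hω
    simp only [mollifiedCov, hf, hω, trajectory]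
  have hgfin : ∫⁻ q, g q ∂((lam.prod lam).prod P) < ∞ := by
    rwa [lintegral_prod _ hgm.aemeasurable]
  have hffin : ∀ i, ∫⁻ q, f i q ∂((lam.prod lam).prod P) < ∞ := by
    intro i
    rw [lintegral_prod _ (hfm i).aemeasurable]
    refine lt_of_le_of_lt (lintegral_mono_ae (?_ : ∀ᵐ q ∂(lam.prod lam), ∫⁻ ω, f i (q, ω) ∂P ≤
      C * ∫⁻ ω, g (q, ω) ∂P)) ?_
    · filter_upwards [hlamlt] with q hq
      rw [hgmean q hq]
      exact hfbound i q hq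
    · rw [lintegral_const_mul' _ _ hC.ne]
      exact ENNReal.mul_lt_top hC hbfin
  refine ⟨?_, fun i => ?_, ?_⟩
  · rwa [lintegral_congr_ae hVg, ← hcomb g hgm]
  · rw [lintegral_congr_ae (hAf i), ← hcomb (f i) (hfm i)]
    exact hffin i
  -- Convergence of the total masses, with ω integrated out first so that only the potential at
  -- shifted points enters, followed by dominated convergence in the times.
  have hconv : Tendsto (fun i => ∫⁻ q, f i q ∂((lam.prod lam).prod P)) l
      (𝓝 (∫⁻ q, g q ∂((lam.prod lam).prod P))) := by
    simp_rw [fun i => lintegral_prod (μ := lam.prod lam) (ν := P) (f i) (hfm i).aemeasurable]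
    rw [lintegral_prod _ hgm.aemeasurable]
    refine tendsto_lintegral_filter_of_dominated_convergence
      (fun q => C * ∫⁻ ω, g (q, ω) ∂P) ?_ ?_ ?_ ?_
    · exact Eventually.of_forall fun i => (hfm i).lintegral_prod_right'
    · refine Eventually.of_forall fun i => ?_
      filter_upwards [hlamlt] with q hq
      rw [hgmean q hq]
      exact hfbound i q hq
    · rw [lintegral_const_mul' _ _ hC.ne]
      exact (ENNReal.mul_lt_top hC hbfin).ne
    · filter_upwards [hlamlt] with q hq
      obtain ⟨h1, h2⟩ := hupos q hq
      rw [hgmean q hq]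
      simp_rw [fun i => hfmean i q hq]
      have t1 := tendsto_timeKernel (Eventually.of_forall hδ0) (Eventually.of_forall hδ'0) hδ hδ'
        hq.1 hq.2.1 hq.2.2 hβ.1
      have t2 := tendsto_lintegral_smoothCov hβ hγ hp hX hΨ hI h1 (Eventually.of_forall hε'0) hε hε'
      rw [h2] at t2
      exact ENNReal.Tendsto.mul t1 (Or.inr ENNReal.ofReal_ne_top) t2 (Or.inr ENNReal.ofReal_ne_top)
  -- Both alternatives of `finite_iff` give γ < ∞ off the origin, and the increments avoid the
  -- origin almost surely.
  have hptw : ∀ᵐ q ∂((lam.prod lam).prod P), Tendsto (fun i => f i q) l (𝓝 (g q)) := by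
    have h1 : ∀ᵐ q ∂((lam.prod lam).prod P),
        Y q.1.1.toNNReal q.2 - Y q.1.2.toNNReal q.2 ≠ 0 := by
      have hms : MeasurableSet {q : (ℝ × ℝ) × Ω |
          Y q.1.1.toNNReal q.2 - Y q.1.2.toNNReal q.2 ≠ 0} :=
        (measurableSet_eq_fun hYi measurable_const).compl
      rw [Measure.ae_prod_iff_ae_ae hms]
      filter_upwards [hlamlt] with q hq
      have hne : q.1.toNNReal ≠ q.2.toNNReal := by
        intro h
        have := (hupos q hq).1
        rw [h, nndist_self] at this
        exact lt_irrefl _ this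
      filter_upwards [hYX, hX.ae_increment_ne hd hne] with ω hω hω'
      rwa [hω, hω]
    filter_upwards [h1, Measure.quasiMeasurePreserving_fst.ae hlamlt] with q hq hq'
    have hfin : γ (Y q.1.1.toNNReal q.2 - Y q.1.2.toNNReal q.2) < ∞ := by
      rcases hγ.finite_iff with h | h
      · exact (h _).2 hq
      · exact h.2 _ hq
    exact ENNReal.Tendsto.mul (tendsto_timeKernel (Eventually.of_forall hδ0)
      (Eventually.of_forall hδ'0) hδ hδ' hq'.1 hq'.2.1 hq'.2.2 hβ.1) (Or.inr hfin.ne)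
      (tendsto_smoothCov hγ hp hε hε' hfin) (Or.inr ENNReal.ofReal_ne_top)
  have key := tendsto_lintegral_sub_add_sub hfm hgm hgfin.ne hptw hconv
  -- A truncated difference of integrals is at most the integral of the truncated difference, so
  -- integrating out the times carries the L¹ limit from [0,t]² × Ω to Ω.
  refine tendsto_of_tendsto_of_tendsto_of_le_of_le tendsto_const_nhds key
    (fun i => zero_le) (fun i => ?_)
  have hsum : Measurable fun q => (f i q - g q) + (g q - f i q) :=
    ((hfm i).sub hgm).add (hgm.sub (hfm i))
  dsimp only
  rw [hcomb _ hsum]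
  refine lintegral_mono_ae ?_
  filter_upwards [hVg, hAf i] with ω h1 h2
  rw [h1, h2]
  have hfω : Measurable fun q : ℝ × ℝ => f i (q, ω) := (hfm i).comp (by fun_prop)
  have hgω : Measurable fun q : ℝ × ℝ => g (q, ω) := hgm.comp (by fun_prop)
  rw [← lintegral_prod (μ := lam) (ν := lam) (fun q => f i (q, ω)) hfω.aemeasurable,
    ← lintegral_prod (μ := lam) (ν := lam) (fun q => g (q, ω)) hgω.aemeasurable,
    ← lintegral_prod (μ := lam) (ν := lam)
      (fun q => f i (q, ω) - g (q, ω) + (g (q, ω) - f i (q, ω)))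
      ((hfω.sub hgω).add (hgω.sub hfω)).aemeasurable, 
    lintegral_add_left (f := fun q => f i (q, ω) - g (q, ω)) (hfω.sub hgω)]
  exact add_le_add (lintegral_sub_le _ _ hgω) (lintegral_sub_le _ _ hfω)

end FeynmanKac

namespace FeynmanKac

/-! ### Mixtures of centered Gaussian laws -/

section Mixture

variable {Ω : Type*} [MeasurableSpace Ω] {ν : Measure Ω}

/-- Under `ν`, the law of `Z` is that of `σ ξ`, with `ξ` standard normal and independent. -/
def IsGaussianMixture (ν : Measure Ω) (Z σ : Ω → ℝ) : Prop :=
  ν.map Z = (ν.prod (gaussianReal 0 1)).map fun q => σ q.1 * q.2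

lemma tendsto_lintegral_comp_boundedContinuous [IsFiniteMeasure ν] {Z : ℕ → Ω → ℝ} {Z' : Ω → ℝ}
    (hZ : ∀ n, AEMeasurable (Z n) ν)
    (h : ∀ᵐ ω ∂ν, Tendsto (fun n => Z n ω) atTop (𝓝 (Z' ω)))
    (f : BoundedContinuousFunction ℝ ℝ≥0) :
    Tendsto (fun n => ∫⁻ ω, f (Z n ω) ∂ν) atTop (𝓝 (∫⁻ ω, f (Z' ω) ∂ν)) := by
  refine tendsto_lintegral_of_dominated_convergence' (fun _ => (nndist f 0 : ℝ≥0∞)) ?_ ?_ ?_ ?_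
  · intro n
    exact (f.continuous.measurable.comp_aemeasurable (hZ n)).coe_nnreal_ennreal
  · exact fun n => Eventually.of_forall fun ω =>
      ENNReal.coe_le_coe.2 (BoundedContinuousFunction.NNReal.upper_bound f _)
  · rw [lintegral_const]
    exact ENNReal.mul_ne_top ENNReal.coe_ne_top (measure_ne_top _ _)
  · filter_upwards [h] with ω hω
    exact ENNReal.tendsto_coe.2 ((f.continuous.tendsto _).comp hω)

lemma aemeasurable_mul_prod {σ : Ω → ℝ} (hσ : AEMeasurable σ ν) :
    AEMeasurable (fun q : Ω × ℝ => σ q.1 * q.2) (ν.prod (gaussianReal 0 1)) :=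
  (hσ.comp_quasiMeasurePreserving Measure.quasiMeasurePreserving_fst).mul
    measurable_snd.aemeasurable

/-- Almost everywhere convergence implies convergence of integrals of bounded continuous functions
on both sides, and these determine a finite measure. -/
lemma IsGaussianMixture.of_tendsto [IsFiniteMeasure ν] {Z σ : ℕ → Ω → ℝ} {Z' σ' : Ω → ℝ}
    (hZ : ∀ n, AEMeasurable (Z n) ν) (hσ : ∀ n, AEMeasurable (σ n) ν)
    (h : ∀ n, IsGaussianMixture ν (Z n) (σ n))
    (hZ' : ∀ᵐ ω ∂ν, Tendsto (fun n => Z n ω) atTop (𝓝 (Z' ω)))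
    (hσ' : ∀ᵐ ω ∂ν, Tendsto (fun n => σ n ω) atTop (𝓝 (σ' ω))) :
    IsGaussianMixture ν Z' σ' := by
  have hZm : AEMeasurable Z' ν := aemeasurable_of_tendsto_metrizable_ae atTop hZ hZ'
  have hσm : AEMeasurable σ' ν := aemeasurable_of_tendsto_metrizable_ae atTop hσ hσ'
  refine ext_of_forall_lintegral_eq_of_IsFiniteMeasure fun f => ?_
  have hf : Measurable fun x => (f x : ℝ≥0∞) := f.continuous.measurable.coe_nnreal_ennreal
  rw [lintegral_map' hf.aemeasurable hZm, lintegral_map' hf.aemeasurable (aemeasurable_mul_prod hσm)]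
  have h1 := tendsto_lintegral_comp_boundedContinuous hZ hZ' f
  have h2 := tendsto_lintegral_comp_boundedContinuous
    (fun n => aemeasurable_mul_prod (hσ n)) (Z' := fun q => σ' q.1 * q.2) ?_ f
  · refine tendsto_nhds_unique h1 (h2.congr fun n => ?_)
    have := h n
    rw [IsGaussianMixture] at this
    rw [← lintegral_map' hf.aemeasurable (hZ n), this,
      lintegral_map' hf.aemeasurable (aemeasurable_mul_prod (hσ n))]
  · filter_upwards [Measure.quasiMeasurePreserving_fst.ae hσ'] with q hq
    exact hq.mul_const _

lemma lintegral_enorm_sq_gaussianReal : ∫⁻ x, ‖x‖ₑ ^ 2 ∂(gaussianReal 0 1) = 1 := by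
  have h1 : Integrable (fun x : ℝ => x ^ 2) (gaussianReal 0 1) :=
    (memLp_id_gaussianReal (μ := 0) (v := 1) 2).integrable_sq
  have h2 : ∫ x, x ^ 2 ∂(gaussianReal 0 1) = 1 := by
    have := variance_fun_id_gaussianReal (μ := 0) (v := 1)
    rw [variance_of_integral_eq_zero aemeasurable_id' (by simp)] at this
    simpa using this
  have h3 : ∀ x : ℝ, ‖x‖ₑ ^ 2 = ENNReal.ofReal (x ^ 2) := fun x => by
    rw [Real.enorm_eq_ofReal_abs, ← ENNReal.ofReal_pow (abs_nonneg _), sq_abs]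
  simp_rw [h3]
  rw [← ofReal_integral_eq_lintegral_ofReal h1 (Eventually.of_forall fun x => sq_nonneg x), h2,
    ENNReal.ofReal_one]

/-- Tonelli, with the second moment of the standard normal factor equal to 1. Applied to differences
of integrals, this is the isometry. -/
lemma IsGaussianMixture.lintegral_sq [SFinite ν] {Z σ : Ω → ℝ} (hZ : AEMeasurable Z ν)
    (hσ : AEMeasurable σ ν) (h : IsGaussianMixture ν Z σ) :
    ∫⁻ ω, ‖Z ω‖ₑ ^ 2 ∂ν = ∫⁻ ω, ‖σ ω‖ₑ ^ 2 ∂ν := by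
  have hf : Measurable fun x : ℝ => ‖x‖ₑ ^ 2 := by fun_prop
  rw [← lintegral_map' (f := fun x : ℝ => ‖x‖ₑ ^ 2) hf.aemeasurable hZ, h,
    lintegral_map' hf.aemeasurable (aemeasurable_mul_prod hσ)]
  simp_rw [enorm_mul, mul_pow]
  rw [lintegral_prod_mul (f := fun ω => ‖σ ω‖ₑ ^ 2) (g := fun x : ℝ => ‖x‖ₑ ^ 2)
    (hσ.enorm.pow_const _) hf.aemeasurable, lintegral_enorm_sq_gaussianReal, mul_one]

lemma eLpNorm_two_eq {E : Type*} [NormedAddCommGroup E] (f : Ω → E) :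
    eLpNorm f 2 ν = (∫⁻ ω, ‖f ω‖ₑ ^ 2 ∂ν) ^ (1 / 2 : ℝ) := by
  rw [eLpNorm_eq_lintegral_rpow_enorm_toReal (by norm_num) (by norm_num)]
  simp

end Mixture

/-! ### The integral of a random element -/

section RandomIntegral

/-- `S` is a simple function with `m`-measurable fibres. -/
def IsSimple {Ω K : Type*} (m : MeasurableSpace Ω) (S : Ω → K) : Prop :=
  (range S).Finite ∧ ∀ h, MeasurableSet[m] (S ⁻¹' {h})

lemma isSimple_coe {Ω : Type*} [m : MeasurableSpace Ω] {K : Type*} (S : SimpleFunc Ω K) :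
    IsSimple m S := ⟨S.finite_range, S.measurableSet_fiber⟩

lemma IsSimple.pair {Ω K L : Type*} {m : MeasurableSpace Ω} {S : Ω → K} {T : Ω → L} (hS : IsSimple m S)
    (hT : IsSimple m T) : IsSimple m fun ω => (S ω, T ω) := by
  refine ⟨(hS.1.prod hT.1).subset ?_, fun h => ?_⟩
  · rintro _ ⟨ω, rfl⟩
    exact ⟨⟨ω, rfl⟩, ⟨ω, rfl⟩⟩
  · convert (hS.2 h.1).inter (hT.2 h.2) using 1
    ext ω
    simp [Prod.ext_iff]

lemma IsSimple.stronglyMeasurable {Ω : Type*} [m : MeasurableSpace Ω] {K : Type*}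
    [TopologicalSpace K] {S : Ω → K} (hS : IsSimple m S) : StronglyMeasurable S :=
  (⟨S, hS.2, hS.1⟩ : SimpleFunc Ω K).stronglyMeasurable

lemma measurable_indicator_one {Ω : Type*} {m : MeasurableSpace Ω} {B : Set Ω}
    (hB : MeasurableSet B) : Measurable (B.indicator (1 : Ω → ℝ≥0∞)) :=
  measurable_one.indicator hB

lemma IsSimple.measurable_eval {Ω : Type*} [m : MeasurableSpace Ω] {K : Type*}
    {S : Ω → K} (hS : IsSimple m S) {F : K → Ω → ℝ} (hF : ∀ k, Measurable (F k)) :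
    Measurable fun ω => F (S ω) ω :=
  (⟨S, hS.2, hS.1⟩ : SimpleFunc Ω K).measurable_bind F hF

/-- The σ-algebra generated by the noise. -/
@[reducible]
def noiseAlgebra {Ω H : Type*} (W : H → Ω → ℝ) : MeasurableSpace Ω :=
  MeasurableSpace.comap (fun ω h => W h ω) inferInstance

lemma measurable_noiseAlgebra_sub {Ω H : Type*} {W : H → Ω → ℝ} (h g : H) :
    Measurable[noiseAlgebra W] fun ω => W h ω - W g ω :=
  ((measurable_pi_apply (X := fun _ : H => ℝ) h).sub (measurable_pi_apply g)).comp
    (comap_measurable fun ω h => W h ω)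

variable {Ω H : Type*} {m mW : MeasurableSpace Ω} [mΩ : MeasurableSpace Ω] {P : Measure Ω}

lemma IsSimple.mono {K : Type*} (hm : m ≤ mΩ) {S : Ω → K} (hS : IsSimple m S) :
    IsSimple mΩ S := ⟨hS.1, fun h => hm _ (hS.2 h)⟩

/-- Simple random variables may be frozen when integrating an independent random function. -/
lemma lintegral_simpleFunc_of_indep (hm : m ≤ mΩ) (hmW : mW ≤ mΩ) (hind : Indep m mW P)
    {K : Type*} {U : Ω → K} (hU : IsSimple m U) {F : K → Ω → ℝ≥0∞} (hF : ∀ k, Measurable[mW] (F k))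
    {A : Set Ω} (hA : MeasurableSet[m] A) :
    ∫⁻ ω in A, F (U ω) ω ∂P = ∫⁻ ω in A, (∫⁻ ω', F (U ω) ω' ∂P) ∂P := by
  classical
  have hAU : A = ⋃ k ∈ hU.1.toFinset, A ∩ U ⁻¹' {k} := by
    ext ω
    simp only [mem_iUnion, mem_inter_iff, mem_preimage, mem_singleton_iff, exists_prop,
      Finite.mem_toFinset]
    exact ⟨fun h => ⟨U ω, ⟨ω, rfl⟩, h, rfl⟩, fun ⟨k, _, h, _⟩ => h⟩
  have hsum : ∀ G : Ω → ℝ≥0∞, ∫⁻ ω in A, G ω ∂P =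
      ∑ k ∈ hU.1.toFinset, ∫⁻ ω in A ∩ U ⁻¹' {k}, G ω ∂P := by
    intro G
    conv_lhs => rw [hAU]
    refine lintegral_biUnion_finset ?_ (fun k _ => hm _ (hA.inter (hU.2 k))) _
    intro k _ k' _ hkk
    refine Set.disjoint_left.2 fun ω h h' => hkk ?_
    exact h.2.symm.trans h'.2
  rw [hsum, hsum]
  refine Finset.sum_congr rfl fun k _ => ?_
  have hB : MeasurableSet[m] (A ∩ U ⁻¹' {k}) := hA.inter (hU.2 k)
  set B := A ∩ U ⁻¹' {k} with hBdef
  have e1 : ∫⁻ ω in B, F (U ω) ω ∂P = ∫⁻ ω in B, F k ω ∂P :=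
    setLIntegral_congr_fun (hm _ hB) fun ω hω => by
      have : U ω = k := hω.2
      simp only [this]
  have e2 : ∫⁻ ω in B, (∫⁻ ω', F (U ω) ω' ∂P) ∂P = ∫⁻ ω in B, (∫⁻ ω', F k ω' ∂P) ∂P :=
    setLIntegral_congr_fun (hm _ hB) fun ω hω => by
      have : U ω = k := hω.2
      simp only [this]
  rw [e1, e2, setLIntegral_const, mul_comm, ← lintegral_indicator (hm _ hB)]
  have e3 : ∀ ω, B.indicator (F k) ω = B.indicator 1 ω * F k ω := by
    intro ω
    by_cases h : ω ∈ B <;> simp [h]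
  simp_rw [e3]
  have hB1 : Measurable[m] (B.indicator (1 : Ω → ℝ≥0∞)) :=
    measurable_indicator_one hB
  rw [lintegral_mul_eq_lintegral_mul_lintegral_of_independent_measurableSpace hm hmW hind
    hB1 (hF k), lintegral_indicator_one (hm _ hB)]

variable [NormedAddCommGroup H] [InnerProductSpace ℝ H] {W : H → Ω → ℝ}

/-- Isonormality prescribes joint laws, not linearity, so W(h) - W(g) takes the place of W(h - g):
the pair is jointly Gaussian and the variance expands to ‖h - g‖². -/
lemma IsIsonormal.map_sub (hW : IsIsonormal W P) (h g : H) :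
    P.map (fun ω => W h ω - W g ω) = (gaussianReal 0 1).map fun x => ‖h - g‖ * x := by
  have hG := hW.gaussian.hasGaussianLaw_fun_sub (s := h) (t := g)
  have := hG.isProbabilityMeasure
  have h2 : ∀ h, MemLp (W h) 2 P := fun h => (hW.gaussian.hasGaussianLaw_eval h).memLp_two
  have hi : ∀ h g, Integrable (fun ω => W h ω * W g ω) P := fun h g =>
    (h2 h).integrable_mul (h2 g)
  have hmean : ∫ ω, (W h ω - W g ω) ∂P = 0 := by
    rw [integral_sub ((h2 h).integrable (by norm_num)) ((h2 g).integrable (by norm_num)), hW.mean,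
      hW.mean, sub_zero]
  have hvar : Var[fun ω => W h ω - W g ω; P] = ‖h - g‖ ^ 2 := by
    rw [variance_of_integral_eq_zero (X := fun ω => W h ω - W g ω)
      ((hW.measurable h).sub (hW.measurable g)).aemeasurable hmean]
    have : ∀ ω, (W h ω - W g ω) ^ 2 =
        (W h ω * W h ω - 2 * (W h ω * W g ω)) + W g ω * W g ω := fun ω => by ring
    simp_rw [this]
    rw [integral_add (f := fun ω => W h ω * W h ω - 2 * (W h ω * W g ω))
      ((hi h h).sub ((hi h g).const_mul 2)) (hi g g),
      integral_sub (hi h h) ((hi h g).const_mul 2), integral_const_mul, hW.cov, hW.cov, hW.cov,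
      norm_sub_sq_real, real_inner_self_eq_norm_sq, real_inner_self_eq_norm_sq]
  rw [hG.map_eq_gaussianReal, hmean, hvar, gaussianReal_map_const_mul, mul_zero, mul_one]
  congr 1
  ext
  simp

lemma IsIsonormal.noiseAlgebra_le (hW : IsIsonormal W P) : noiseAlgebra W ≤ mΩ :=
  (measurable_pi_lambda _ hW.measurable).comap_le

/-- By independence the pair (S, T) may be frozen at its value (h, g), and W(h) - W(g) is centered
Gaussian with standard deviation ‖h - g‖. Letting A range over m is how conditioning on m is
expressed. -/
lemma isGaussianMixture_simpleFunc [IsProbabilityMeasure P] (hm : m ≤ mΩ) (hW : IsIsonormal W P)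
    (hind : Indep m (noiseAlgebra W) P) {S T : Ω → H} (hS : IsSimple m S) (hT : IsSimple m T)
    {A : Set Ω} (hA : MeasurableSet[m] A) :
    IsGaussianMixture (P.restrict A) (fun ω => W (S ω) ω - W (T ω) ω)
      (fun ω => ‖S ω - T ω‖) := by
  have hn' : Measurable fun ω => ‖S ω - T ω‖ :=
    ((hS.mono hm).stronglyMeasurable.sub (hT.mono hm).stronglyMeasurable).norm.measurable
  have hWm : Measurable fun ω => W (S ω) ω - W (T ω) ω :=
    ((hS.mono hm).measurable_eval hW.measurable).sub ((hT.mono hm).measurable_eval hW.measurable)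
  rw [IsGaussianMixture]
  ext B hB
  have hg : Measurable fun q : Ω × ℝ => ‖S q.1 - T q.1‖ * q.2 :=
    (hn'.comp measurable_fst).mul measurable_snd
  rw [Measure.map_apply hWm hB, Measure.map_apply hg hB, Measure.prod_apply (hg hB)]
  have h1 := lintegral_simpleFunc_of_indep hm hW.noiseAlgebra_le hind (hS.pair hT)
    (F := fun k ω => ((fun ω => W k.1 ω - W k.2 ω) ⁻¹' B).indicator 1 ω) (fun k => by
      exact measurable_indicator_one (measurable_noiseAlgebra_sub k.1 k.2 hB)) hA
  have e1 : ∫⁻ ω in A, ((fun ω' => W (S ω) ω' - W (T ω) ω') ⁻¹' B).indicator 1 ω ∂P =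
      (P.restrict A) ((fun ω => W (S ω) ω - W (T ω) ω) ⁻¹' B) := by
    rw [← lintegral_indicator_one (hWm hB)]
    rfl
  rw [← e1, h1]
  refine lintegral_congr fun ω => ?_
  have hms : Measurable fun ω' => W (S ω) ω' - W (T ω) ω' :=
    (hW.measurable _).sub (hW.measurable _)
  rw [lintegral_indicator_one (hms hB), ← Measure.map_apply hms hB, hW.map_sub,
    Measure.map_apply (measurable_const_mul _) hB]
  rfl

/-- The integral of 0 appears as W(0), which vanishes only almost surely. It turns statements about
differences of integrals into statements about one integral. -/
lemma isRandomIntegral_zero : IsRandomIntegral m W P (0 : Ω → H) (W 0) := by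
  refine ⟨fun _ _ => 0, fun _ => ⟨finite_range_const, fun h => measurableSet_preimage
    (@measurable_const _ _ ⊤ m _) trivial⟩, ?_, ?_⟩
  · simp
  · intro ε hε
    simp [hε.ne']

variable {Φ Φ' : Ω → H} {Z Z' : Ω → ℝ}

lemma IsRandomIntegral.aestronglyMeasurable (hm : m ≤ mΩ) (h : IsRandomIntegral m W P Φ Z) :
    AEStronglyMeasurable Φ P := by
  obtain ⟨S, h1, h2, -⟩ := h
  exact aestronglyMeasurable_of_tendsto_ae atTop
    (fun n => (IsSimple.mono hm (h1 n)).stronglyMeasurable.aestronglyMeasurable) h2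

lemma IsRandomIntegral.aemeasurable (hm : m ≤ mΩ) (hW : IsIsonormal W P)
    (h : IsRandomIntegral m W P Φ Z) : AEMeasurable Z P := by
  obtain ⟨S, h1, -, h3⟩ := h
  exact h3.aemeasurable
    fun n => ((IsSimple.mono hm (h1 n)).measurable_eval hW.measurable).aemeasurable

/-- The difference of two integrals is, conditionally, a centered Gaussian variable. -/
lemma IsRandomIntegral.isGaussianMixture_sub [IsProbabilityMeasure P] (hm : m ≤ mΩ) (hW : IsIsonormal W P)
    (hind : Indep m (noiseAlgebra W) P) (h : IsRandomIntegral m W P Φ Z)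
    (h' : IsRandomIntegral m W P Φ' Z') {A : Set Ω} (hA : MeasurableSet[m] A) :
    IsGaussianMixture (P.restrict A) (fun ω => Z ω - Z' ω) (fun ω => ‖Φ ω - Φ' ω‖) := by
  obtain ⟨S, hS, hSΦ, hSZ⟩ := h
  obtain ⟨T, hT, hTΦ, hTZ⟩ := h'
  -- Successive extraction gives one subsequence along which both sequences of integrals converge
  -- almost surely.
  obtain ⟨ns, hns, hZ⟩ := hSZ.exists_seq_tendsto_ae
  obtain ⟨ks, hks, hZ'⟩ := (hTZ.comp hns.tendsto_atTop).exists_seq_tendsto_ae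
  have hmeas : ∀ {S : Ω → H}, IsSimple m S → Measurable fun ω => W (S ω) ω := fun h =>
    (h.mono hm).measurable_eval hW.measurable
  refine IsGaussianMixture.of_tendsto
    (Z := fun n ω => W (S (ns (ks n)) ω) ω - W (T (ns (ks n)) ω) ω)
    (σ := fun n ω => ‖S (ns (ks n)) ω - T (ns (ks n)) ω‖) ?_ ?_ ?_ ?_ ?_
  · exact fun n => ((hmeas (hS _)).sub (hmeas (hT _))).aemeasurable
  · exact fun n => ((IsSimple.mono hm (hS _)).stronglyMeasurable.sub
      (IsSimple.mono hm (hT _)).stronglyMeasurable).norm.measurable.aemeasurable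
  · exact fun n => isGaussianMixture_simpleFunc hm hW hind (hS _) (hT _) hA
  · refine ae_restrict_of_ae ?_
    filter_upwards [hZ, hZ'] with ω h1 h2
    exact (h1.comp hks.tendsto_atTop).sub h2
  · refine ae_restrict_of_ae ?_
    have ht := hns.tendsto_atTop.comp hks.tendsto_atTop
    filter_upwards [hSΦ, hTΦ] with ω h1 h2
    exact ((h1.comp ht).sub (h2.comp ht)).norm

lemma IsIsonormal.zero_ae (hW : IsIsonormal W P) : W 0 =ᵐ[P] 0 := by
  have h1 : ∫ ω, (W 0 ω) ^ 2 ∂P = 0 := by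
    simp_rw [sq]
    rw [hW.cov, inner_zero_left]
  have h2 : Integrable (fun ω => W 0 ω ^ 2) P :=
    (hW.gaussian.hasGaussianLaw_eval 0).memLp_two.integrable_sq
  rw [integral_eq_zero_iff_of_nonneg (fun ω => sq_nonneg _) h2] at h1
  filter_upwards [h1] with ω hω
  simpa using hω

lemma IsRandomIntegral.isGaussianMixture [IsProbabilityMeasure P] (hm : m ≤ mΩ) (hW : IsIsonormal W P)
    (hind : Indep m (noiseAlgebra W) P) (h : IsRandomIntegral m W P Φ Z)
    {A : Set Ω} (hA : MeasurableSet[m] A) :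
    IsGaussianMixture (P.restrict A) Z (fun ω => ‖Φ ω‖) := by
  have := h.isGaussianMixture_sub hm hW hind isRandomIntegral_zero hA
  simp only [Pi.zero_apply, sub_zero] at this
  rw [IsGaussianMixture, ← this]
  refine Measure.map_congr (ae_restrict_of_ae ?_)
  filter_upwards [hW.zero_ae] with ω hω
  simp [hω]

/-- The isometry property. -/
lemma IsRandomIntegral.eLpNorm_sub [IsProbabilityMeasure P] (hm : m ≤ mΩ) (hW : IsIsonormal W P)
    (hind : Indep m (noiseAlgebra W) P) (h : IsRandomIntegral m W P Φ Z)
    (h' : IsRandomIntegral m W P Φ' Z') :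
    eLpNorm (Z - Z') 2 P = eLpNorm (Φ - Φ') 2 P := by
  have := h.isGaussianMixture_sub hm hW hind h' MeasurableSet.univ
  rw [Measure.restrict_univ] at this
  rw [eLpNorm_two_eq, eLpNorm_two_eq]
  congr 1
  have h2 := this.lintegral_sq ((h.aemeasurable hm hW).sub (h'.aemeasurable hm hW))
    ((h.aestronglyMeasurable hm).sub (h'.aestronglyMeasurable hm)).norm.aemeasurable
  simpa using h2

lemma IsRandomIntegral.eLpNorm_eq [IsProbabilityMeasure P] (hm : m ≤ mΩ) (hW : IsIsonormal W P)
    (hind : Indep m (noiseAlgebra W) P) (h : IsRandomIntegral m W P Φ Z) :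
    eLpNorm Z 2 P = eLpNorm Φ 2 P := by
  have := h.eLpNorm_sub hm hW hind isRandomIntegral_zero
  rw [sub_zero] at this
  rw [← this]
  refine eLpNorm_congr_ae ?_
  filter_upwards [hW.zero_ae] with ω hω
  simp [hω]

/-- The isometry with Φ = Φ' makes the L² distance zero. -/
lemma IsRandomIntegral.unique [IsProbabilityMeasure P] (hm : m ≤ mΩ) (hW : IsIsonormal W P)
    (hind : Indep m (noiseAlgebra W) P) (h : IsRandomIntegral m W P Φ Z)
    (h' : IsRandomIntegral m W P Φ Z') : Z =ᵐ[P] Z' := by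
  have := h.eLpNorm_sub hm hW hind h'
  rw [sub_self, eLpNorm_zero, eLpNorm_eq_zero_iff
    ((h.aemeasurable hm hW).sub (h'.aemeasurable hm hW)).aestronglyMeasurable (by norm_num)] at this
  filter_upwards [this] with ω hω
  exact sub_eq_zero.1 hω

lemma isRandomIntegral_of_isSimple {S : Ω → H} (hS : IsSimple m S) :
    IsRandomIntegral m W P S fun ω => W (S ω) ω := by
  refine ⟨fun _ => S, fun _ => hS, Eventually.of_forall fun ω => tendsto_const_nhds, ?_⟩
  intro ε hε
  simp [hε.ne']

lemma exists_isSimple_eLpNorm_sub_le {Ω H : Type*} [m : MeasurableSpace Ω]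
    [NormedAddCommGroup H] {μ : Measure Ω} {Φ : Ω → H} (hΦ : MemLp Φ 2 μ) : ∃ S : ℕ → Ω → H, (∀ n, IsSimple m (S n)) ∧
      ∀ n, eLpNorm (S n - Φ) 2 μ < (1 / 2 : ℝ≥0∞) ^ n := by
  have : ∀ n : ℕ, ∃ S : SimpleFunc Ω H, eLpNorm (Φ - ⇑S) 2 μ < (1 / 2 : ℝ≥0∞) ^ n ∧ MemLp S 2 μ :=
    fun n => hΦ.exists_simpleFunc_eLpNorm_sub_lt (by norm_num) (by simp)
  choose S hS _ using this
  exact ⟨fun n => S n, fun n => isSimple_coe _, fun n => by rw [eLpNorm_sub_comm]; exact hS n⟩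

/-- Square-integrable random elements have an integral. -/
lemma exists_isRandomIntegral [IsProbabilityMeasure P] (hm : m ≤ mΩ) (hW : IsIsonormal W P)
    (hind : Indep m (noiseAlgebra W) P) (hΦm : StronglyMeasurable[m] Φ) (hΦ : MemLp Φ 2 P) :
    ∃ Z, IsRandomIntegral m W P Φ Z := by
  -- The approximation takes place for `P.trim hm` on the σ-algebra m, so that the simple functions
  -- are m-measurable.
  obtain ⟨S, hS, hSΦ⟩ := exists_isSimple_eLpNorm_sub_le (m := m) (μ := P.trim hm) (Φ := Φ)
    ⟨hΦm.aestronglyMeasurable, by rw [eLpNorm_trim hm hΦm]; exact hΦ.2⟩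
  have hSm : ∀ n, StronglyMeasurable[m] (S n) := fun n =>
    IsSimple.stronglyMeasurable (m := m) (hS n)
  have hb : ∀ n, eLpNorm (S n - Φ) 2 P < (1 / 2 : ℝ≥0∞) ^ n := fun n => by
    rw [← eLpNorm_trim hm ((hSm n).sub hΦm)]
    exact hSΦ n
  have hSΦ0 : Tendsto (fun n => eLpNorm (S n - Φ) 2 P) atTop (𝓝 0) :=
    tendsto_of_tendsto_of_tendsto_of_le_of_le tendsto_const_nhds
      (ENNReal.tendsto_pow_atTop_nhds_zero_of_lt_one (by norm_num : (1 / 2 : ℝ≥0∞) < 1))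
      (fun n => zero_le) (fun n => (hb n).le)
  have hSmP : ∀ n, AEStronglyMeasurable (S n) P := fun n => ((hSm n).mono hm).aestronglyMeasurable
  have hI : ∀ n, IsRandomIntegral m W P (S n) fun ω => W (S n ω) ω := fun n =>
    isRandomIntegral_of_isSimple (hS n)
  have hSL : ∀ n, MemLp (S n) 2 P := fun n => by
    have : MemLp (S n - Φ) 2 P :=
      ⟨(hSmP n).sub hΦ.1, (hb n).trans_le (pow_le_one₀ zero_le (by norm_num)) |>.trans
        ENNReal.one_lt_top⟩
    simpa using this.add hΦ
  obtain ⟨Z, hZ, hZlim⟩ := Lp.cauchy_complete_eLpNorm (μ := P) (p := 2) (by norm_num)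
    (f := fun n ω => W (S n ω) ω) (B := fun n => 2 * (1 / 2 : ℝ≥0∞) ^ n)
    (fun n => ⟨((hI n).aemeasurable hm hW).aestronglyMeasurable, by
      rw [(hI n).eLpNorm_eq hm hW hind]; exact (hSL n).2⟩)
    (by
      rw [ENNReal.tsum_mul_left, ENNReal.tsum_geometric]
      norm_num)
    (fun N n k hn hk => by
      have e := (hI n).eLpNorm_sub hm hW hind (hI k)
      rw [e]
      have : S n - S k = (S n - Φ) - (S k - Φ) := by abel
      rw [this]
      refine (eLpNorm_sub_le ((hSmP n).sub hΦ.1) ((hSmP k).sub hΦ.1) (by norm_num)).trans_lt ?_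
      rw [two_mul]
      have hp : ∀ n, N ≤ n → (1 / 2 : ℝ≥0∞) ^ n ≤ (1 / 2) ^ N := fun n hn =>
        pow_le_pow_of_le_one zero_le (by norm_num) hn
      exact ENNReal.add_lt_add ((hb n).trans_le (hp n hn)) ((hb k).trans_le (hp k hk)))
  have hin := tendstoInMeasure_of_tendsto_eLpNorm (by norm_num)
    (fun n => ((hI n).aemeasurable hm hW).aestronglyMeasurable) hZ.1 hZlim
  -- Almost sure convergence of the simple functions holds along a subsequence, and convergence in
  -- probability of their integrals is inherited by it.
  obtain ⟨ns, hns, hlim⟩ :=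
    (tendstoInMeasure_of_tendsto_eLpNorm (by norm_num) hSmP hΦ.1 hSΦ0).exists_seq_tendsto_ae
  exact ⟨Z, fun n => S (ns n), fun n => hS _, hlim, hin.comp hns.tendsto_atTop⟩

lemma IsRandomIntegral.congr (h : IsRandomIntegral m W P Φ Z) (hΦ : Φ =ᵐ[P] Φ') :
    IsRandomIntegral m W P Φ' Z := by
  obtain ⟨S, h1, h2, h3⟩ := h
  refine ⟨S, h1, ?_, h3⟩
  filter_upwards [h2, hΦ] with ω hω hω'
  rwa [← hω']

end RandomIntegral

end FeynmanKac

namespace FeynmanKac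

/-! ### Square-integrable random elements of a Hilbert space -/

lemma stronglyMeasurable_limUnder {Ω H : Type*} {m : MeasurableSpace Ω} [NormedAddCommGroup H]
    [CompleteSpace H] {Φ : ℕ → Ω → H} (hΦ : ∀ n, StronglyMeasurable (Φ n)) :
    StronglyMeasurable fun ω => limUnder atTop fun n => Φ n ω :=
  StronglyMeasurable.limUnder hΦ

section Limits

variable {Ω H : Type*} {m : MeasurableSpace Ω} [mΩ : MeasurableSpace Ω] {P : Measure Ω}

/-- An almost sure limit of `m`-measurable functions has an `m`-measurable version. -/
lemma exists_stronglyMeasurable_ae_eq [NormedAddCommGroup H] [CompleteSpace H]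
    {Φ : ℕ → Ω → H} {Φ' : Ω → H} (hΦ : ∀ n, StronglyMeasurable[m] (Φ n))
    (h : ∀ᵐ ω ∂P, Tendsto (fun n => Φ n ω) atTop (𝓝 (Φ' ω))) :
    ∃ Φ'' : Ω → H, StronglyMeasurable[m] Φ'' ∧ Φ' =ᵐ[P] Φ'' :=
  ⟨fun ω => limUnder atTop fun n => Φ n ω, stronglyMeasurable_limUnder hΦ,
    h.mono fun _ hω => hω.limUnder_eq.symm⟩

lemma exists_tendsto_eLpNorm [NormedAddCommGroup H] [CompleteSpace H] {ι : Type*} {l : Filter ι}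
    [l.NeBot] {Φ : ι → Ω → H} (hΦ : ∀ i, MemLp (Φ i) 2 P)
    (h : Tendsto (fun q : ι × ι => eLpNorm (Φ q.1 - Φ q.2) 2 P) (l ×ˢ l) (𝓝 0)) :
    ∃ Φ' : Ω → H, MemLp Φ' 2 P ∧ Tendsto (fun i => eLpNorm (Φ i - Φ') 2 P) l (𝓝 0) := by
  have hc : Cauchy (map (fun i => (hΦ i).toLp (Φ i)) l) := by
    rw [cauchy_map_iff]
    refine ⟨inferInstance, ?_⟩
    rw [tendsto_uniformity_iff_dist_tendsto_zero]
    have h0 := (ENNReal.tendsto_toReal ENNReal.zero_ne_top).comp h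
    refine h0.congr fun q => ?_
    simp only [Function.comp_apply]
    rw [Lp.dist_def]
    congr 1
    refine eLpNorm_congr_ae ?_
    exact ((hΦ q.1).coeFn_toLp.sub (hΦ q.2).coeFn_toLp).symm
  obtain ⟨F, hF⟩ := CompleteSpace.complete hc
  refine ⟨F, Lp.memLp F, ?_⟩
  have := (Lp.tendsto_Lp_iff_tendsto_eLpNorm' _ _).1 hF
  refine this.congr fun i => eLpNorm_congr_ae ?_
  exact (hΦ i).coeFn_toLp.sub EventuallyEq.rfl

variable [NormedAddCommGroup H] [InnerProductSpace ℝ H]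

/-- ‖f - g‖² = (⟨f,f⟩ - v) + (⟨g,g⟩ - v) - 2(⟨f,g⟩ - v), since the multiples of v cancel. -/
lemma enorm_sub_sq_le (f g : H) (v : ℝ) : ‖f - g‖ₑ ^ 2 ≤ ‖inner ℝ f f - v‖ₑ +
    ‖inner ℝ g g - v‖ₑ + 2 * ‖inner ℝ f g - v‖ₑ := by
  have h1 : ‖f - g‖ ^ 2 ≤ |inner ℝ f f - v| + |inner ℝ g g - v| + 2 * |inner ℝ f g - v| := by
    rw [norm_sub_sq_real, real_inner_self_eq_norm_sq, real_inner_self_eq_norm_sq]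
    have a := le_abs_self (‖f‖ ^ 2 - v)
    have b := le_abs_self (‖g‖ ^ 2 - v)
    have c := neg_abs_le (inner ℝ f g - v)
    linarith
  have h2 := ENNReal.ofReal_le_ofReal h1
  rw [ENNReal.ofReal_add (by positivity) (by positivity),
    ENNReal.ofReal_add (by positivity) (by positivity), ENNReal.ofReal_mul (by norm_num),
    ENNReal.ofReal_pow (norm_nonneg _), ofReal_norm] at h2
  simpa [Real.enorm_eq_ofReal_abs] using h2

/-- If the inner products `⟪Φ i, Φ j⟫` converge in `L¹` to `v`, the `Φ i` converge in `L²`, and the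
squared norm of the limit is `v`. -/
lemma exists_limit_of_tendsto_inner [CompleteSpace H] {ι : Type*} {l : Filter ι}
    [l.NeBot] [l.IsCountablyGenerated] {Φ : ι → Ω → H} {v : Ω → ℝ}
    (hΦ : ∀ i, StronglyMeasurable[m] (Φ i)) (hL : ∀ i, MemLp (Φ i) 2 P) (hv : AEMeasurable v P)
    (h : Tendsto (fun q : ι × ι => ∫⁻ ω, ‖inner ℝ (Φ q.1 ω) (Φ q.2 ω) - v ω‖ₑ ∂P) (l ×ˢ l)
      (𝓝 0)) :
    Tendsto (fun q : ι × ι => eLpNorm (Φ q.1 - Φ q.2) 2 P) (l ×ˢ l) (𝓝 0) ∧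
    ∃ Φ' : Ω → H, StronglyMeasurable[m] Φ' ∧ MemLp Φ' 2 P ∧
      Tendsto (fun i => eLpNorm (Φ i - Φ') 2 P) l (𝓝 0) ∧ ∀ᵐ ω ∂P, ‖Φ' ω‖ ^ 2 = v ω := by
  have hdiag : Tendsto (fun i => ∫⁻ ω, ‖inner ℝ (Φ i ω) (Φ i ω) - v ω‖ₑ ∂P) l (𝓝 0) :=
    h.comp (f := fun i => (i, i)) (tendsto_id.prodMk tendsto_id)
  have hmeas : ∀ i j, AEMeasurable (fun ω => ‖inner ℝ (Φ i ω) (Φ j ω) - v ω‖ₑ) P := fun i j =>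
    (((hL i).1.inner (hL j).1).aemeasurable.sub hv).enorm
  have hcau : Tendsto (fun q : ι × ι => eLpNorm (Φ q.1 - Φ q.2) 2 P) (l ×ˢ l) (𝓝 0) := by
    have hb : Tendsto (fun q : ι × ι => (∫⁻ ω, ‖inner ℝ (Φ q.1 ω) (Φ q.1 ω) - v ω‖ₑ ∂P +
        ∫⁻ ω, ‖inner ℝ (Φ q.2 ω) (Φ q.2 ω) - v ω‖ₑ ∂P +
        2 * ∫⁻ ω, ‖inner ℝ (Φ q.1 ω) (Φ q.2 ω) - v ω‖ₑ ∂P) ^ (1 / 2 : ℝ)) (l ×ˢ l) (𝓝 0) := by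
      have := ((hdiag.comp tendsto_fst).add (hdiag.comp tendsto_snd)).add
        (ENNReal.Tendsto.const_mul h (Or.inr (by norm_num : (2 : ℝ≥0∞) ≠ ∞)))
      have h2 := (ENNReal.continuous_rpow_const (y := 1 / 2)).continuousAt.tendsto.comp this
      simpa [Function.comp_def] using h2
    refine tendsto_of_tendsto_of_tendsto_of_le_of_le tendsto_const_nhds hb
      (fun q => zero_le) (fun q => ?_)
    simp only
    rw [eLpNorm_two_eq]
    refine ENNReal.rpow_le_rpow ?_ (by norm_num)
    refine (lintegral_mono fun ω => enorm_sub_sq_le (Φ q.1 ω) (Φ q.2 ω) (v ω)).trans_eq ?_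
    rw [lintegral_add_left' (f := fun ω => ‖inner ℝ (Φ q.1 ω) (Φ q.1 ω) - v ω‖ₑ +
      ‖inner ℝ (Φ q.2 ω) (Φ q.2 ω) - v ω‖ₑ) ((hmeas _ _).add (hmeas _ _)), lintegral_add_left' (hmeas _ _),
      lintegral_const_mul' _ _ (by norm_num)]
  refine ⟨hcau, ?_⟩
  obtain ⟨F, hF, hFlim⟩ := exists_tendsto_eLpNorm hL hcau
  have t1 : TendstoInMeasure P (fun i ω => inner ℝ (Φ i ω) (Φ i ω)) l v := by
    refine tendstoInMeasure_of_tendsto_eLpNorm (p := 1) one_ne_zero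
      (fun i => (hL i).1.inner (hL i).1) hv.aestronglyMeasurable ?_
    simpa [eLpNorm_one_eq_lintegral_enorm] using hdiag
  -- Along a common subsequence ‖Φ_i‖² → v and Φ_i → F almost surely, which identifies the squared
  -- norm of the limit and yields its m-measurable version.
  obtain ⟨ns, hns, hvlim⟩ := t1.exists_seq_tendsto_ae'
  have t2 := tendstoInMeasure_of_tendsto_eLpNorm (by norm_num) (fun n => (hL (ns n)).1) hF.1
    (hFlim.comp hns)
  obtain ⟨ks, hks, hlim⟩ := t2.exists_seq_tendsto_ae
  obtain ⟨Φ', hΦ', hFΦ⟩ := exists_stronglyMeasurable_ae_eq (fun n => hΦ (ns (ks n))) hlim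
  refine ⟨Φ', hΦ', (memLp_congr_ae hFΦ).1 hF, ?_, ?_⟩
  · exact hFlim.congr fun i => eLpNorm_congr_ae (EventuallyEq.rfl.sub hFΦ)
  · filter_upwards [hvlim, hlim, hFΦ] with ω h1 h2 h3
    rw [← h3, ← real_inner_self_eq_norm_sq]
    exact tendsto_nhds_unique (h2.inner h2) (h1.comp hks.tendsto_atTop)

end Limits

/-! ### The conditional law -/

section ConditionalLaw

variable {Ω H E : Type*} [mΩ : MeasurableSpace Ω] [mE : MeasurableSpace E] {P : Measure Ω}
  [IsProbabilityMeasure P] {T : Ω → E} {Z : Ω → ℝ}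

/-- The mixture law on every set T⁻¹(s) says that the law of (T, Z) agrees on rectangles with the
composition of the law of T and the kernel y ↦ N(0, v(y)); this characterises the conditional
distribution. -/
lemma IsGaussianMixture.condDistrib_eq (hT : Measurable T) (hZ : AEMeasurable Z P) {v : E → ℝ≥0}
    (hv : Measurable v) (h : ∀ A, MeasurableSet[mE.comap T] A →
      IsGaussianMixture (P.restrict A) Z fun ω => √(v (T ω))) :
    ∀ᵐ ω ∂P, condDistrib Z T P (T ω) = gaussianReal 0 (v (T ω)) := by
  let κ : Kernel E ℝ := ⟨fun y => gaussianReal 0 (v y),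
    measurable_gaussianReal.comp (measurable_const.prodMk hv)⟩
  have hκ : ∀ y, κ y = gaussianReal 0 (v y) := fun y => rfl
  have : IsMarkovKernel κ := ⟨fun y => by rw [hκ]; infer_instance⟩
  refine ae_of_ae_map hT.aemeasurable
    (p := fun y => condDistrib Z T P y = gaussianReal 0 (v y)) ?_
  refine condDistrib_ae_eq_of_measure_eq_compProd T hZ (κ := κ) ?_
  have : IsProbabilityMeasure (P.map fun ω => (T ω, Z ω)) :=
    Measure.isProbabilityMeasure_map (hT.aemeasurable.prodMk hZ)
  refine Measure.ext_prod fun {s B} hs hB => ?_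
  have hσ : Measurable fun ω => √((v (T ω) : ℝ)) := by
    have := hv.comp hT
    fun_prop
  have hg : Measurable fun q : Ω × ℝ => √((v (T q.1) : ℝ)) * q.2 :=
    (hσ.comp measurable_fst).mul measurable_snd
  have h1 := h (T ⁻¹' s) ⟨s, hs, rfl⟩
  rw [IsGaussianMixture] at h1
  have h2 : (P.restrict (T ⁻¹' s)).map Z B = _ := congrArg (fun μ => μ B) h1
  rw [Measure.map_apply_of_aemeasurable hZ.restrict hB, Measure.map_apply hg hB,
    Measure.prod_apply (hg hB)] at h2
  rw [Measure.map_apply_of_aemeasurable (hT.aemeasurable.prodMk hZ) (hs.prod hB),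
    Measure.compProd_apply_prod hs hB, setLIntegral_map hs (Kernel.measurable_coe κ hB) hT]
  have e1 : (P.restrict (T ⁻¹' s)) (Z ⁻¹' B) = P ((fun ω => (T ω, Z ω)) ⁻¹' s ×ˢ B) := by
    rw [Measure.restrict_apply' (hT hs), inter_comm]
    rfl
  rw [← e1, h2]
  refine lintegral_congr fun ω => ?_
  rw [hκ]
  have e2 : gaussianReal 0 (v (T ω)) =
      (gaussianReal 0 1).map fun x => √((v (T ω) : ℝ)) * x := by
    rw [gaussianReal_map_const_mul, mul_zero, mul_one]
    congr 1
    ext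
    simp
  rw [e2, Measure.map_apply (measurable_const_mul _) hB]
  rfl

lemma condVar_eq_of_condDistrib (hT : Measurable T) (hZ : MemLp Z 2 P) {V : Ω → ℝ≥0}
    (h : ∀ᵐ ω ∂P, condDistrib Z T P (T ω) = gaussianReal 0 (V ω)) :
    Var[Z; P | mE.comap T] =ᵐ[P] fun ω => (V ω : ℝ) := by
  have h1 := condExp_ae_eq_integral_condDistrib hT hZ.1.aemeasurable (f := fun x : ℝ => x)
    stronglyMeasurable_id (hZ.integrable (by norm_num))
  have h2 := condExp_ae_eq_integral_condDistrib hT hZ.1.aemeasurable (f := fun x : ℝ => x ^ 2)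
    (by fun_prop) hZ.integrable_sq
  filter_upwards [condVar_ae_eq_condExp_sq_sub_sq_condExp hT.comap_le hZ, h1, h2, h] with ω e e1 e2 e3
  rw [e, Pi.sub_apply, Pi.pow_apply]
  have e2' : (P[Z ^ 2 | mE.comap T]) ω = (V ω : ℝ) := by
    refine e2.trans ?_
    rw [e3]
    have := variance_fun_id_gaussianReal (μ := 0) (v := V ω)
    rwa [variance_of_integral_eq_zero aemeasurable_id' (by simp)] at this
  have e1' : (P[Z | mE.comap T]) ω = 0 := by
    refine e1.trans ?_
    rw [e3]
    simp
  rw [e1', e2']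
  simp

variable [NormedAddCommGroup H] [InnerProductSpace ℝ H] {W : H → Ω → ℝ}

/-- Conditionally on `T`, the integral of a `T`-measurable random element is centered Gaussian. -/
lemma IsRandomIntegral.condDistrib_eq (hT : Measurable T) (hW : IsIsonormal W P)
    (hind : Indep (mE.comap T) (noiseAlgebra W) P) {Φ : Ω → H}
    (hΦ : StronglyMeasurable[mE.comap T] Φ) (h : IsRandomIntegral (mE.comap T) W P Φ Z)
    {V : Ω → ℝ≥0} (hV : ∀ᵐ ω ∂P, ‖Φ ω‖ ^ 2 = V ω) :
    ∀ᵐ ω ∂P, condDistrib Z T P (T ω) = gaussianReal 0 (V ω) := by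
  have hn : Measurable[mE.comap T] fun ω => ‖Φ ω‖₊ ^ 2 :=
    (StronglyMeasurable.nnnorm hΦ).measurable.pow_const 2
  -- Being measurable for the σ-algebra of T, the squared norm factors through T.
  obtain ⟨v, hv, hvT⟩ := hn.exists_eq_measurable_comp
  have key := IsGaussianMixture.condDistrib_eq hT (h.aemeasurable hT.comap_le hW) hv ?_
  · filter_upwards [key, hV] with ω h1 h2
    rw [h1]
    congr 1
    have := congrFun hvT ω
    simp only [Function.comp_apply] at this
    rw [← this]
    ext
    simpa using h2
  · intro A hA
    have h1 := h.isGaussianMixture hT.comap_le hW hind hA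
    convert h1 using 2 with ω
    have := congrFun hvT ω
    simp only [Function.comp_apply] at this
    rw [← this]
    simp

end ConditionalLaw

end FeynmanKac

namespace FeynmanKac

/-! ### The mollified kernels along the Lévy process -/

variable {Ω : Type*} [mΩ : MeasurableSpace Ω] {P : Measure Ω} {d : ℕ} {β₀ : ℝ}
  {γ : Space d → ℝ≥0∞} {γhat : Space d → ℝ} {p : Space d → ℝ}
  {X : ℝ≥0 → Ω → Space d} {Ψ : Space d → ℝ} {t ε δ ε' δ' : ℝ} {x : Space d}

lemma IsSymmetricLevy.measurable_trajectory (hX : IsSymmetricLevy X P) :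
    Measurable (trajectory X) :=
  measurable_pi_lambda _ hX.measurable

lemma IsSymmetricLevy.isCadlag (hX : IsSymmetricLevy X P) :
    ∀ᵐ ω ∂P, IsCadlag (trajectory X ω) := hX.cadlag

lemma IsCadlag.inNoiseSpace_mollifiedKernel {path : ℝ≥0 → Space d} (h : IsCadlag path)
    (hβ : β₀ ∈ Ioo (0 : ℝ) 1) (hγ : IsSpatialCovariance γ γhat) (hp : IsMollifier p) (ht : 0 ≤ t)
    (hε : 0 < ε) (hδ : 0 < δ) : InNoiseSpace β₀ γ (mollifiedKernel p t x ε δ path) := by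
  obtain ⟨b, hb⟩ := h.exists_norm_le t.toNNReal
  exact FeynmanKac.inNoiseSpace_mollifiedKernel hβ hγ hp ht hε hδ h.measurable
    fun s hs => hb s (NNReal.le_toNNReal_of_coe_le hs)

lemma IsCadlag.inner_mollifiedKernel {path : ℝ≥0 → Space d} (h : IsCadlag path)
    (hβ : β₀ ∈ Ioo (0 : ℝ) 1) (hγ : IsSpatialCovariance γ γhat) (hp : IsMollifier p) (ht : 0 ≤ t)
    (hε : 0 < ε) (hδ : 0 < δ) (hε' : 0 < ε') (hδ' : 0 < δ') :
    0 ≤ inner ℝ (toNoiseSpace β₀ γ (mollifiedKernel p t x ε δ path))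
      (toNoiseSpace β₀ γ (mollifiedKernel p t x ε' δ' path)) ∧
    ENNReal.ofReal (inner ℝ (toNoiseSpace β₀ γ (mollifiedKernel p t x ε δ path))
      (toNoiseSpace β₀ γ (mollifiedKernel p t x ε' δ' path))) =
      mollifiedCov β₀ γ p t ε δ ε' δ' path := by
  obtain ⟨b, hb⟩ := h.exists_norm_le t.toNNReal
  have hb' : ∀ s : ℝ≥0, (s : ℝ) ≤ t → ‖path s‖ ≤ b := fun s hs =>
    hb s (NNReal.le_toNNReal_of_coe_le hs)
  obtain ⟨B, R, hB⟩ := exists_bddSupp_mollifiedKernel hp ht hε hδ x b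
  obtain ⟨B', R', hB'⟩ := exists_bddSupp_mollifiedKernel hp ht hε' hδ' x b
  rw [inner_toNoiseSpace hβ hγ (hB _ hb') (measurable_mollifiedKernel hp ht h.measurable)
    (hB' _ hb') (measurable_mollifiedKernel hp ht h.measurable)]
  refine ⟨integral_nonneg fun q => ?_, ofReal_covForm_mollifiedKernel hβ hγ hp ht hε hδ hε' hδ'
    h.measurable hb'⟩
  exact mul_nonneg (mul_nonneg (mollifiedKernel_nonneg hp ht hε hδ _)
    (mollifiedKernel_nonneg hp ht hε' hδ' _)) ENNReal.toReal_nonneg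

/-- The left-open step path with value `w k` up to time `k / (n + 1)`. -/
def stepPath {E : Type*} (n : ℕ) (w : ℕ → E) (s : ℝ≥0) : E := w ⌈((n : ℝ≥0) + 1) * s⌉₊

lemma comp_gridCeil_eq {E : Type*} (n : ℕ) (path : ℝ≥0 → E) :
    (fun s => path (gridCeil n s)) =
      stepPath n fun k : ℕ => path ((k : ℝ≥0) / ((n : ℝ≥0) + 1)) := rfl

lemma measurable_stepPath {E : Type*} [MeasurableSpace E] (n : ℕ) (w : ℕ → E) :
    Measurable (stepPath n w) :=
  (measurable_from_nat (f := w)).comp (Nat.measurable_ceil.comp (measurable_const.mul measurable_id))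

/-- The kernel along a step path is a continuous function of the values of the path. -/
lemma continuous_toNoiseSpace_step (hβ : β₀ ∈ Ioo (0 : ℝ) 1) (hγ : IsSpatialCovariance γ γhat)
    (hp : IsMollifier p) (ht : 0 ≤ t) (hε : 0 < ε) (hδ : 0 < δ) (n : ℕ) :
    Continuous fun w : ℕ → Space d => toNoiseSpace β₀ γ
      (mollifiedKernel p t x ε δ (stepPath n w)) := by
  refine continuous_iff_seqContinuous.2 fun w w' hw => ?_
  rw [tendsto_pi_nhds] at hw
  have hb : ∀ k, ∃ b, ∀ i, ‖w i k‖ ≤ b := fun k => by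
    obtain ⟨b, hb⟩ := (Metric.isBounded_range_of_tendsto _ (hw k)).exists_norm_le
    exact ⟨b, fun i => hb _ ⟨i, rfl⟩⟩
  choose b hb using hb
  -- Up to time t a step path visits only the values with index at most N, so coordinatewise
  -- convergence bounds all the paths at once.
  set N := ⌈((n : ℝ≥0) + 1) * t.toNNReal⌉₊ with hN
  have hk : ∀ s : ℝ≥0, (s : ℝ) ≤ t → ⌈((n : ℝ≥0) + 1) * s⌉₊ ∈ Finset.range (N + 1) := fun s hs => by
    rw [Finset.mem_range, Nat.lt_succ_iff]
    exact Nat.ceil_mono (by gcongr; exact NNReal.le_toNNReal_of_coe_le hs)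
  have hb0 : ∀ k, 0 ≤ b k := fun k => (norm_nonneg _).trans (hb k 0)
  have hbN : ∀ i, ∀ s : ℝ≥0, (s : ℝ) ≤ t →
      ‖w i ⌈((n : ℝ≥0) + 1) * s⌉₊‖ ≤ ∑ k ∈ Finset.range (N + 1), b k := fun i s hs =>
    (hb _ i).trans (Finset.single_le_sum (fun k _ => hb0 k) (hk s hs))
  exact tendsto_toNoiseSpace_mollifiedKernel hβ hγ hp ht hε hδ
    (fun i => measurable_stepPath n (w i)) (measurable_stepPath n w') hbN
    (fun s hs => le_of_tendsto (hw _).norm (Eventually.of_forall fun i => hbN i s hs))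
    fun s _ => hw _

/-- Paths along the grid depend on countably many values of X, and the kernel is a continuous
function of these, hence strongly measurable for σ(X). For càdlàg paths the kernels along the grid
converge, but only almost surely, so a version of the limit is obtained. -/
lemma exists_stronglyMeasurable_kernelElement (hβ : β₀ ∈ Ioo (0 : ℝ) 1)
    (hγ : IsSpatialCovariance γ γhat) (hp : IsMollifier p) (hX : IsSymmetricLevy X P)
    (ht : 0 ≤ t) (hε : 0 < ε) (hδ : 0 < δ) (x : Space d) :
    ∃ Φ : Ω → NoiseSpace β₀ γ, StronglyMeasurable[sigmaAlgebra X] Φ ∧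
      kernelElement β₀ γ X p t x ε δ =ᵐ[P] Φ := by
  refine exists_stronglyMeasurable_ae_eq (Φ := fun n ω => toNoiseSpace β₀ γ
    (mollifiedKernel p t x ε δ fun s => trajectory X ω (gridCeil n s))) ?_ ?_
  · intro n
    have h1 : StronglyMeasurable fun w : ℕ → Space d => toNoiseSpace β₀ γ
        (mollifiedKernel p t x ε δ (stepPath n w)) :=
      (continuous_toNoiseSpace_step hβ hγ hp ht hε hδ n).stronglyMeasurable
    have h2 : Measurable[sigmaAlgebra X] fun ω (k : ℕ) =>
        trajectory X ω ((k : ℝ≥0) / ((n : ℝ≥0) + 1)) := by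
      have h3 : Measurable fun (w : ℝ≥0 → Space d) (k : ℕ) => w ((k : ℝ≥0) / ((n : ℝ≥0) + 1)) :=
        measurable_pi_lambda _ fun k => measurable_pi_apply _
      exact h3.comp (comap_measurable (trajectory X))
    simp only [comp_gridCeil_eq]
    exact h1.comp_measurable h2
  · filter_upwards [hX.isCadlag] with ω hω
    -- The grid point above s ≤ t may exceed t, by at most 1/(n+1) ≤ 1.
    obtain ⟨b, hb⟩ := hω.exists_norm_le (t.toNNReal + 1)
    refine tendsto_toNoiseSpace_mollifiedKernel (b := b) hβ hγ hp ht hε hδ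
      (fun n => hω.measurable.comp (measurable_gridCeil n)) hω.measurable (fun n s hs => ?_)
      (fun s hs => ?_) (fun s _ => hω.tendsto_gridCeil s)
    · refine hb _ ((gridCeil_le n s).trans (add_le_add (NNReal.le_toNNReal_of_coe_le hs) ?_))
      rw [div_le_iff₀ (by positivity), one_mul]
      exact le_add_self
    · exact hb _ ((NNReal.le_toNNReal_of_coe_le hs).trans le_self_add)

lemma aemeasurable_hamiltonian (hγ : IsSpatialCovariance γ γhat) (hX : IsSymmetricLevy X P)
    (t : ℝ) : AEMeasurable (fun ω => hamiltonian β₀ γ t (trajectory X ω)) P := by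
  obtain ⟨Y, hYm, hYc, hYX⟩ := hX.exists_modification
  have hYj : Measurable fun q : ℝ≥0 × Ω => Y q.1 q.2 := measurable_uncurry_of_cadlag hYm hYc
  have hYi : Measurable fun q : (Ω × ℝ) × ℝ => Y q.1.2.toNNReal q.1.1 - Y q.2.toNNReal q.1.1 := by
    refine Measurable.sub ?_ ?_
    · exact hYj.comp (f := fun q : (Ω × ℝ) × ℝ => (q.1.2.toNNReal, q.1.1)) (by fun_prop)
    · exact hYj.comp (f := fun q : (Ω × ℝ) × ℝ => (q.2.toNNReal, q.1.1)) (by fun_prop)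
  have hg : Measurable fun q : (Ω × ℝ) × ℝ => ENNReal.ofReal (|q.1.2 - q.2| ^ (-β₀)) *
      γ (Y q.1.2.toNNReal q.1.1 - Y q.2.toNNReal q.1.1) := by
    refine Measurable.mul ?_ (hγ.measurable.comp hYi)
    fun_prop
  have h1 := (hg.lintegral_prod_right' (ν := volume.restrict (Icc 0 t))).lintegral_prod_right'
    (ν := volume.restrict (Icc 0 t))
  refine h1.aemeasurable.congr ?_
  filter_upwards [hYX] with ω hω
  simp only [hamiltonian, hω, trajectory]

/-- The parameters `(ε, δ)` of the mollification. -/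
abbrev PosPair : Type := {q : ℝ × ℝ // 0 < q.1 ∧ 0 < q.2}

/-- Both parameters tend to `0`. -/
def toZero : Filter PosPair := comap Subtype.val (𝓝[>] (0 : ℝ) ×ˢ 𝓝[>] (0 : ℝ))

lemma range_val_mem : range (Subtype.val : PosPair → ℝ × ℝ) ∈ 𝓝[>] (0 : ℝ) ×ˢ 𝓝[>] (0 : ℝ) := by
  rw [Subtype.range_coe_subtype]
  exact prod_mem_prod self_mem_nhdsWithin self_mem_nhdsWithin

/-- The limit theorems above ask for positive parameters at every index, which `PosPair` provides;
this returns to one-sided limits in ε and δ. -/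
lemma tendsto_toZero_iff {α : Type*} {f : ℝ × ℝ → α} {l : Filter α} :
    Tendsto (fun q : PosPair => f q.1) toZero l ↔ Tendsto f (𝓝[>] (0 : ℝ) ×ˢ 𝓝[>] (0 : ℝ)) l :=
  tendsto_comap'_iff range_val_mem

lemma tendsto_toZero_prod_iff {α : Type*} {f : (ℝ × ℝ) × (ℝ × ℝ) → α} {l : Filter α} :
    Tendsto (fun q : PosPair × PosPair => f (q.1.1, q.2.1)) (toZero ×ˢ toZero) l ↔
      Tendsto f ((𝓝[>] (0 : ℝ) ×ˢ 𝓝[>] (0 : ℝ)) ×ˢ (𝓝[>] (0 : ℝ) ×ˢ 𝓝[>] (0 : ℝ))) l := by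
  rw [toZero, prod_comap_comap_eq]
  refine tendsto_comap'_iff (i := fun q : PosPair × PosPair => (q.1.1, q.2.1)) ?_
  convert prod_mem_prod range_val_mem range_val_mem
  rw [← range_prodMap]
  rfl

instance : toZero.NeBot := by
  rw [toZero]
  exact NeBot.comap_of_range_mem inferInstance range_val_mem

instance : toZero.IsCountablyGenerated := by
  unfold toZero
  infer_instance

lemma tendsto_toZero_fst : Tendsto (fun q : PosPair => q.1.1) toZero (𝓝 0) :=
  (tendsto_nhdsWithin_iff.1 (tendsto_fst.comp tendsto_comap)).1

lemma tendsto_toZero_snd : Tendsto (fun q : PosPair => q.1.2) toZero (𝓝 0) :=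
  (tendsto_nhdsWithin_iff.1 (tendsto_snd.comp tendsto_comap)).1

lemma enorm_sub_toReal {a : ℝ} (ha : 0 ≤ a) {V : ℝ≥0∞} (hV : V < ∞) :
    ‖a - V.toReal‖ₑ = (ENNReal.ofReal a - V) + (V - ENNReal.ofReal a) := by
  lift V to ℝ≥0 using hV.ne
  have e : (V : ℝ≥0∞) = ENNReal.ofReal V := by simp
  rw [ENNReal.coe_toReal, e, ← ENNReal.ofReal_sub _ V.coe_nonneg, ← ENNReal.ofReal_sub _ ha,
    Real.enorm_eq_ofReal_abs]
  rcases le_total a V with h | h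
  · rw [abs_of_nonpos (by linarith), ENNReal.ofReal_of_nonpos (sub_nonpos.2 h), zero_add, neg_sub]
  · rw [abs_of_nonneg (by linarith), ENNReal.ofReal_of_nonpos (p := V - a) (by linarith), add_zero]

variable [IsProbabilityMeasure P]

/-- The mollified kernels are square-integrable and their inner products converge. -/
lemma memLp_and_tendsto_inner_kernelElement (hd : 1 ≤ d) (hβ : β₀ ∈ Ioo (0 : ℝ) 1)
    (hγ : IsSpatialCovariance γ γhat) (hp : IsMollifier p) (hX : IsSymmetricLevy X P)
    (hΨ : IsCharExponent X P Ψ) (hI : HypothesisI β₀ Ψ γhat) (ht : 0 ≤ t) (x : Space d) :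
    (∀ᵐ ω ∂P, hamiltonian β₀ γ t (trajectory X ω) < ∞) ∧
    (∀ q : PosPair, MemLp (kernelElement β₀ γ X p t x q.1.1 q.1.2) 2 P) ∧
    Tendsto (fun q : PosPair × PosPair =>
      ∫⁻ ω, ‖inner ℝ (kernelElement β₀ γ X p t x q.1.1.1 q.1.1.2 ω)
        (kernelElement β₀ γ X p t x q.2.1.1 q.2.1.2 ω) -
        (hamiltonian β₀ γ t (trajectory X ω)).toReal‖ₑ ∂P) (toZero ×ˢ toZero) (𝓝 0) := by
  obtain ⟨hfin, hint, hlim⟩ := tendsto_mollifiedCov hd hβ hγ hp hX hΨ hI t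
    (l := toZero ×ˢ toZero) (ε := fun q : PosPair × PosPair => q.1.1.1)
    (δ := fun q => q.1.1.2) (ε' := fun q => q.2.1.1) (δ' := fun q => q.2.1.2)
    (fun q => q.2.2.1) (fun q => q.1.2.2) (fun q => q.2.2.2)
    (tendsto_toZero_fst.comp tendsto_fst) (tendsto_toZero_snd.comp tendsto_fst)
    (tendsto_toZero_fst.comp tendsto_snd) (tendsto_toZero_snd.comp tendsto_snd)
  have hV : ∀ᵐ ω ∂P, hamiltonian β₀ γ t (trajectory X ω) < ∞ :=
    ae_lt_top' (aemeasurable_hamiltonian hγ hX t) hfin.ne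
  refine ⟨hV, fun q => ?_, hlim.congr fun q => ?_⟩
  · obtain ⟨Φ, hΦ, hΦe⟩ :=
      exists_stronglyMeasurable_kernelElement hβ hγ hp hX ht q.2.1 q.2.2 x
    refine ⟨(hΦ.mono hX.measurable_trajectory.comap_le).aestronglyMeasurable.congr hΦe.symm, ?_⟩
    rw [eLpNorm_two_eq]
    refine ENNReal.rpow_lt_top_of_nonneg (by norm_num) (lt_of_le_of_lt (le_of_eq ?_) (hint (q, q))).ne
    refine lintegral_congr_ae ?_
    filter_upwards [hX.isCadlag] with ω hω
    rw [← (hω.inner_mollifiedKernel (x := x) hβ hγ hp ht q.2.1 q.2.2 q.2.1 q.2.2).2,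
      real_inner_self_eq_norm_sq, ENNReal.ofReal_pow (norm_nonneg _), ofReal_norm]
    rfl
  · refine lintegral_congr_ae ?_
    filter_upwards [hX.isCadlag, hV] with ω hω hVω
    have h := hω.inner_mollifiedKernel (x := x) hβ hγ hp ht q.1.2.1 q.1.2.2 q.2.2.1 q.2.2.2
    rw [← h.2]
    exact (enorm_sub_toReal h.1 hVω).symm

end FeynmanKac

/-! ### Assembly of the theorem -/

namespace FeynmanKac

lemma randomIntegral_spec {Ω H : Type*} {m : MeasurableSpace Ω} [MeasurableSpace Ω]
    [NormedAddCommGroup H] [InnerProductSpace ℝ H] {W : H → Ω → ℝ} {P : Measure Ω} {Φ : Ω → H}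
    (h : ∃ Z : Ω → ℝ, IsRandomIntegral m W P Φ Z) :
    IsRandomIntegral m W P Φ (randomIntegral m W P Φ) := by
  rw [randomIntegral, dif_pos h]
  exact h.choose_spec

end FeynmanKac

end

theorem theorem4p1 {Ω : Type*} [MeasurableSpace Ω] (P : Measure Ω) [IsProbabilityMeasure P]
    {d : ℕ} (hd : 1 ≤ d) (β₀ : ℝ) (hβ₀ : β₀ ∈ Set.Ioo (0 : ℝ) 1)
    (γ : FeynmanKac.Space d → ℝ≥0∞) (γhat : FeynmanKac.Space d → ℝ)
    (hγ : FeynmanKac.IsSpatialCovariance γ γhat)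
    (X : ℝ≥0 → Ω → FeynmanKac.Space d) (hX : FeynmanKac.IsSymmetricLevy X P)
    (Ψ : FeynmanKac.Space d → ℝ) (hΨ : FeynmanKac.IsCharExponent X P Ψ)
    (W : FeynmanKac.NoiseSpace β₀ γ → Ω → ℝ) (hW : FeynmanKac.IsIsonormal W P)
    (hXW : IndepFun (FeynmanKac.trajectory X) (fun ω h => W h ω) P)
    (hI : FeynmanKac.HypothesisI β₀ Ψ γhat)
    (p : FeynmanKac.Space d → ℝ) (hp : FeynmanKac.IsMollifier p)
    (t : ℝ) (ht : 0 ≤ t) (x : FeynmanKac.Space d) :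
    -- `W(Φ^{ε,δ})` is well defined: almost surely `Φ^{ε,δ} ∈ 𝓗`, and its integral exists and is
    -- almost surely unique; moreover it is in `L²`
    (∀ ε δ : ℝ, 0 < ε → 0 < δ →
      (∀ᵐ ω ∂P, FeynmanKac.InNoiseSpace β₀ γ
        (FeynmanKac.mollifiedKernel p t x ε δ (FeynmanKac.trajectory X ω))) ∧
      (∃ Z : Ω → ℝ, FeynmanKac.IsRandomIntegral (FeynmanKac.sigmaAlgebra X) W P
        (FeynmanKac.kernelElement β₀ γ X p t x ε δ) Z) ∧
      (∀ Z Z' : Ω → ℝ,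
        FeynmanKac.IsRandomIntegral (FeynmanKac.sigmaAlgebra X) W P
          (FeynmanKac.kernelElement β₀ γ X p t x ε δ) Z →
        FeynmanKac.IsRandomIntegral (FeynmanKac.sigmaAlgebra X) W P
          (FeynmanKac.kernelElement β₀ γ X p t x ε δ) Z' →
        Z =ᵐ[P] Z') ∧
      MemLp (FeynmanKac.mollifiedIntegral β₀ γ X W P p t x ε δ) 2 P) ∧
    -- the family is Cauchy in `L²` as `(ε, δ) → 0`
    Tendsto
      (fun q : (ℝ × ℝ) × (ℝ × ℝ) =>
        eLpNorm (FeynmanKac.mollifiedIntegral β₀ γ X W P p t x q.1.1 q.1.2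
          - FeynmanKac.mollifiedIntegral β₀ γ X W P p t x q.2.1 q.2.2) 2 P)
      ((𝓝[>] 0 ×ˢ 𝓝[>] 0) ×ˢ (𝓝[>] 0 ×ˢ 𝓝[>] 0)) (𝓝 0) ∧
    -- its `L²` limit is, conditionally on `X`, centered Gaussian with the stated variance
    ∃ Z : Ω → ℝ, MemLp Z 2 P ∧
      Tendsto
        (fun q : ℝ × ℝ =>
          eLpNorm (FeynmanKac.mollifiedIntegral β₀ γ X W P p t x q.1 q.2 - Z) 2 P)
        (𝓝[>] 0 ×ˢ 𝓝[>] 0) (𝓝 0) ∧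
      (∀ᵐ ω ∂P, FeynmanKac.hamiltonian β₀ γ t (FeynmanKac.trajectory X ω) < ∞) ∧
      (∀ᵐ ω ∂P, condDistrib Z (FeynmanKac.trajectory X) P (FeynmanKac.trajectory X ω)
        = gaussianReal 0 (FeynmanKac.hamiltonian β₀ γ t (FeynmanKac.trajectory X ω)).toNNReal) ∧
      Var[Z; P | FeynmanKac.sigmaAlgebra X] =ᵐ[P]
        fun ω => (FeynmanKac.hamiltonian β₀ γ t (FeynmanKac.trajectory X ω)).toReal := by
  classical
  have hT := hX.measurable_trajectory
  have hm : FeynmanKac.sigmaAlgebra X ≤ _ := hT.comap_le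
  have hind : Indep (FeynmanKac.sigmaAlgebra X) (FeynmanKac.noiseAlgebra W) P :=
    (IndepFun_iff_Indep _ _ _).1 hXW
  obtain ⟨hV, hL, hlim⟩ :=
    FeynmanKac.memLp_and_tendsto_inner_kernelElement hd hβ₀ hγ hp hX hΨ hI ht x
  -- The kernel element agrees only almost surely with a σ(X)-measurable one. The argument runs with
  -- that version, and `IsRandomIntegral.congr` transfers the integrals.
  have hver := fun q : FeynmanKac.PosPair =>
    FeynmanKac.exists_stronglyMeasurable_kernelElement hβ₀ hγ hp hX ht q.2.1 q.2.2 x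
  choose Φ hΦ hΦe using hver
  have hΦL : ∀ q, MemLp (Φ q) 2 P := fun q => (memLp_congr_ae (hΦe q)).1 (hL q)
  have hex : ∀ q : FeynmanKac.PosPair, ∃ Z, FeynmanKac.IsRandomIntegral
      (FeynmanKac.sigmaAlgebra X) W P (FeynmanKac.kernelElement β₀ γ X p t x q.1.1 q.1.2) Z := by
    intro q
    obtain ⟨Z, hZ⟩ := FeynmanKac.exists_isRandomIntegral hm hW hind (hΦ q) (hΦL q)
    exact ⟨Z, hZ.congr (hΦe q).symm⟩
  have hspec : ∀ q : FeynmanKac.PosPair, FeynmanKac.IsRandomIntegral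
      (FeynmanKac.sigmaAlgebra X) W P (Φ q)
      (FeynmanKac.mollifiedIntegral β₀ γ X W P p t x q.1.1 q.1.2) := fun q =>
    (FeynmanKac.randomIntegral_spec (hex q)).congr (hΦe q)
  obtain ⟨hcau, Φ', hΦ', hΦL', hΦlim, hnorm⟩ :=
    FeynmanKac.exists_limit_of_tendsto_inner hΦ hΦL
      (FeynmanKac.aemeasurable_hamiltonian (β₀ := β₀) hγ hX t).ennreal_toReal (hlim.congr fun q => by
        refine lintegral_congr_ae ?_
        filter_upwards [hΦe q.1, hΦe q.2] with ω h1 h2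
        rw [h1, h2])
  -- The limit is realised as the integral of the limiting kernel Φ', so that its conditional
  -- variance is read off from ‖Φ'‖² = V.
  obtain ⟨Z, hZ⟩ := FeynmanKac.exists_isRandomIntegral hm hW hind hΦ' hΦL'
  have hZL : MemLp Z 2 P := ⟨(hZ.aemeasurable hm hW).aestronglyMeasurable, by
    rw [hZ.eLpNorm_eq hm hW hind]; exact hΦL'.2⟩
  have hcond := hZ.condDistrib_eq hT hW hind hΦ'
    (V := fun ω => (FeynmanKac.hamiltonian β₀ γ t (FeynmanKac.trajectory X ω)).toNNReal) hnorm
  refine ⟨fun ε δ hε hδ => ⟨?_, hex ⟨(ε, δ), hε, hδ⟩, fun Z Z' h h' => h.unique hm hW hind h', ?_⟩,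
    ?_, Z, hZL, ?_, hV, hcond, FeynmanKac.condVar_eq_of_condDistrib hT hZL hcond⟩
  · filter_upwards [hX.isCadlag] with ω hω
    exact hω.inNoiseSpace_mollifiedKernel hβ₀ hγ hp ht hε hδ
  · have h := hspec ⟨(ε, δ), hε, hδ⟩
    refine ⟨(h.aemeasurable hm hW).aestronglyMeasurable, ?_⟩
    rw [h.eLpNorm_eq hm hW hind]
    exact (hΦL _).2
  -- By the isometry, the distances between integrals are those between kernels.
  · refine FeynmanKac.tendsto_toZero_prod_iff.1 (hcau.congr fun q => ?_)
    exact ((hspec q.1).eLpNorm_sub hm hW hind (hspec q.2)).symm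
  · refine FeynmanKac.tendsto_toZero_iff.1 (hΦlim.congr fun q => ?_)
    exact ((hspec q).eLpNorm_sub hm hW hind hZ).symm
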